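/- **Setting.** Let $f(x,y_1)=\mathbb E_{\zeta\sim\mathcal D_f}[f(x,y_1;\zeta)]$ and $g(x,y_1)=\mathbb E_{\phi\sim\mathcal D_g}[g(x,y_1;\phi)]$ for $x\in\mathbb R^{d_x}$, $y_1\in\mathbb R^{d_y}$, and let $y_1^*(x)=\arg\min_{y_1}g(x,y_1)$ and $F(x)=f(x,y_1^*(x))$. Assume: (a) $f$ is differentiable, $f(x,\cdot)$ is $\ell_f$-Lipschitz for every $x$ and $\nabla f$ is $\ell_f$-Lipschitz in $(x,y_1)$; $\nabla_{y_1}g$ exists and is differentiable, and $\nabla_{y_1}g$, $\nabla^2_{xy_1}g$ and $\nabla^2_{y_1y_1}g$ are $\ell_g$-Lipschitz in $(x,y_1)$ (no Lipschitz continuity of $\nabla^2 f$ or $\nabla^3 g$ is assumed); (b) $g(x,\cdot)$ is $\mu_g$-strongly convex for every $x$, with $\mu_g>0$; (c) $\nabla f(x,y_1;\zeta)$, $\nabla_{y_1}g(x,y_1;\phi)$, $\nabla^2_{xy_1}g(x,y_1;\phi)$, $\nabla^2_{y_1y_1}g(x,y_1;\phi)$ are unbiased estimators of $\nabla f$, $\nabla_{y_1}g$,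 $\nabla^2_{xy_1}g$, $\nabla^2_{y_1y_1}g$ at $(x,y_1)$, with variances at most $\hat\sigma^2$. For each horizon $K$, SOBA with step sizes $\alpha^k,\beta_1^k,\beta_2^k$ (which may depend on $K$) is, for $0\le k<K$, $$y_1^{k+1}=y_1^k-\beta_1^k\nabla_{y_1}g(x^k,y_1^k;\phi_1^k),$$ $$y_2^{k+1}=y_2^k-\beta_2^k\big(\nabla_{y_1}f(x^k,y_1^k;\zeta_2^k)+\nabla^2_{y_1y_1}g(x^k,y_1^k;\phi_2^k)y_2^k\big),$$ $$x^{k+1}=x^k-\alpha^k\big(\nabla_xf(x^k,y_1^k;\zeta_0^k)+\nabla^2_{xy_1}g(x^k,y_1^k;\phi_0^k)y_2^k\big),$$ where the initial point does not depend on $K$ and has finite second moments, and all samples $\zeta_0^k,\zeta_2^k\sim\mathcal D_f$, $\phi_0^k,\phi_1^k,\phi_2^k\sim\mathcal D_g$ are mutually independent and independent of the initial point. Below, $a^k=\Theta(r(K))$ means that there are constants $0<c'\le C'$ with $c'r(K)\le a^k\le C'r(K)$ for all large $K$ and all $0\le k<K$. **Corollary.** Let $\mu_x>0$ and $M>0$.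 1. There are constants $c,\kappa>0$, depending only on $\ell_f,\ell_g,\mu_g,\mu_x,\hat\sigma,M$, such that, if (a)–(c) hold, $F$ is $\mu_x$-strongly convex with minimizer $x^*$, the step sizes $\alpha^k,\beta_1^k,\beta_2^k$ are all $\Theta(\log K/K)$, and $\alpha^k\ge c\log K/K$, $\alpha^k\le\kappa\beta_1^k$, $\beta_1^k\le M\beta_2^k$ for all large $K$ and all $0\le k<K$, then $x^K-x^*$ and $y_1^K-y_1^*(x^K)$ are square integrable and $$\mathbb E\|x^K-x^*\|^2+\mathbb E\|y_1^K-y_1^*(x^K)\|^2=\tilde{\mathcal O}(1/K)\quad(K\to\infty),$$ where $u=\tilde{\mathcal O}(r)$ means $u=\mathcal O(r\max\{1,|\log r|\})$. 2. There is a constant $\kappa>0$, depending only on $\ell_f,\ell_g,\mu_g,\mu_x,\hat\sigma,M$ (with $\mu_x$ playing no role), such that, if (a)–(c) hold, $F$ is bounded below, the step sizes are all $\Theta(1/\sqrt K)$, and $\alpha^k\le\kappa\beta_1^k$, $\beta_1^k\le M\beta_2^k$ for all large $K$ and all $0\le k<K$, then $F$ is differentiable, $\nabla F(x^k)$ and $y_1^k-y_1^*(x^k)$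 are square integrable, and $$\frac1K\sum_{k=1}^K\Big(\mathbb E\|\nabla F(x^k)\|^2+\mathbb E\|y_1^k-y_1^*(x^k)\|^2\Big)=\mathcal O(1/\sqrt K)\quad(K\to\infty).$$ -/

import Mathlib

open MeasureTheory ProbabilityTheory Filter Topology Asymptotics
open scoped NNReal

noncomputable section

namespace Bilevel

/-- The Euclidean space `ℝ^d`. -/
abbrev Vec (d : ℕ) : Type := EuclideanSpace ℝ (Fin d)

/-- The space of pairs `(x, y₁)`, with the Euclidean norm `√(‖x‖² + ‖y₁‖²)`. -/
abbrev Pt (dx dy : ℕ) : Type := WithLp 2 (Vec dx × Vec dy)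

/-- A minimizer of `φ` over the whole space (arbitrary if there is none). -/
def argmin {E : Type*} [Nonempty E] (φ : E → ℝ) : E :=
  Classical.epsilon fun z => ∀ w, φ z ≤ φ w

theorem argmin_le {E : Type*} [Nonempty E] {φ : E → ℝ} (h : ∃ z, ∀ w, φ z ≤ φ w) (w : E) :
    φ (argmin φ) ≤ φ w :=
  Classical.epsilon_spec (p := fun z => ∀ w, φ z ≤ φ w) h w

section Derivatives

variable {dx dy : ℕ}

/-- `∇ₓ G (x, y₁)`. -/
def gradX (G : Vec dx → Vec dy → ℝ) (x : Vec dx) (y : Vec dy) : Vec dx :=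
  gradient (fun x' => G x' y) x

/-- `∇_{y₁} G (x, y₁)`. -/
def gradY (G : Vec dx → Vec dy → ℝ) (x : Vec dx) (y : Vec dy) : Vec dy :=
  gradient (fun y' => G x y') y

/-- The full gradient `∇ G (x, y₁) = (∇ₓ G (x, y₁), ∇_{y₁} G (x, y₁))`. -/
def grad (G : Vec dx → Vec dy → ℝ) (x : Vec dx) (y : Vec dy) : Pt dx dy :=
  WithLp.toLp 2 (gradX G x y, gradY G x y)

/-- `∇²_{y₁y₁} G (x, y₁)`, the derivative in `y₁` of `∇_{y₁} G`. -/
def hessYY (G : Vec dx → Vec dy → ℝ) (x : Vec dx) (y : Vec dy) : Vec dy →L[ℝ] Vec dy :=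
  fderiv ℝ (fun y' => gradY G x y') y

/-- `∇²_{xy₁} G (x, y₁)`, the `dx × dy` matrix of mixed second derivatives: the transpose of the
derivative in `x` of `∇_{y₁} G`. -/
def hessXY (G : Vec dx → Vec dy → ℝ) (x : Vec dx) (y : Vec dy) : Vec dy →L[ℝ] Vec dx :=
  ContinuousLinearMap.adjoint (fderiv ℝ (fun x' => gradY G x' y) x)

/-- `T` is `L`-Lipschitz jointly in `(x, y₁)`, for the Euclidean norm of the pair. -/
def JointLipschitz {E : Type*} [PseudoEMetricSpace E] (L : ℝ≥0) (T : Vec dx → Vec dy → E) :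
    Prop :=
  LipschitzWith L fun p : Pt dx dy => T p.fst p.snd

end Derivatives

/-- The data of a stochastic bilevel problem: the distributions of `ζ` and `φ` and the sample
functions `f(x, y₁; ζ)` and `g(x, y₁; φ)`. -/
structure Problem (dx dy : ℕ) (Zf Zg : Type*) [MeasurableSpace Zf] [MeasurableSpace Zg] where
  Df : Measure Zf
  Dg : Measure Zg
  fS : Zf → Vec dx → Vec dy → ℝ
  gS : Zg → Vec dx → Vec dy → ℝ

/-- `O(x, y₁; z)`, `z ∼ D`, is an unbiased estimator of `T(x, y₁)` with variance at most `σ²`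
(operator norm if the values are matrices). -/
structure IsUnbiasedEstimator {dx dy : ℕ} {Z E : Type*} [MeasurableSpace Z]
    [NormedAddCommGroup E] [NormedSpace ℝ E] [MeasurableSpace E]
    (D : Measure Z) (O : Z → Vec dx → Vec dy → E) (T : Vec dx → Vec dy → E) (σ : ℝ) : Prop where
  measurable : Measurable fun q : Z × Vec dx × Vec dy => O q.1 q.2.1 q.2.2
  memLp : ∀ x y, MemLp (fun z => O z x y) 2 D
  unbiased : ∀ x y, ∫ z, O z x y ∂D = T x y
  variance : ∀ x y, ∫ z, ‖O z x y - T x y‖ ^ 2 ∂D ≤ σ ^ 2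

namespace Problem

variable {dx dy : ℕ} {Zf Zg : Type*} [MeasurableSpace Zf] [MeasurableSpace Zg]

/-- The upper-level function `f(x, y₁) = 𝔼 f(x, y₁; ζ)`. -/
def f (B : Problem dx dy Zf Zg) (x : Vec dx) (y : Vec dy) : ℝ := ∫ ζ, B.fS ζ x y ∂B.Df

/-- The lower-level function `g(x, y₁) = 𝔼 g(x, y₁; φ)`. -/
def g (B : Problem dx dy Zf Zg) (x : Vec dx) (y : Vec dy) : ℝ := ∫ φ, B.gS φ x y ∂B.Dg

/-- The lower-level solution `y₁*(x)`. -/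
def yStar (B : Problem dx dy Zf Zg) (x : Vec dx) : Vec dy := argmin (B.g x)

/-- The bilevel objective `F(x) = f(x, y₁*(x))`. -/
def F (B : Problem dx dy Zf Zg) (x : Vec dx) : ℝ := B.f x (B.yStar x)

/-- The standing regularity conditions of the bilevel problem. -/
structure Regular (B : Problem dx dy Zf Zg) (ℓf ℓg : ℝ≥0) (μg σ : ℝ) : Prop where
  prob_f : IsProbabilityMeasure B.Df
  prob_g : IsProbabilityMeasure B.Dg
  -- `f` and `g` are well-defined expectations of sample functions that have the derivatives used
  integrable_f : ∀ x y, Integrable (fun ζ => B.fS ζ x y) B.Df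
  integrable_g : ∀ x y, Integrable (fun φ => B.gS φ x y) B.Dg
  diff_fS : ∀ x y, ∀ᵐ ζ ∂B.Df, DifferentiableAt ℝ (fun x' => B.fS ζ x' y) x ∧
    DifferentiableAt ℝ (fun y' => B.fS ζ x y') y
  diff_gS : ∀ x, ∀ᵐ φ ∂B.Dg, Differentiable ℝ (B.gS φ x)
  diff_gradY_gS : ∀ x y, ∀ᵐ φ ∂B.Dg,
    DifferentiableAt ℝ (fun x' => gradY (B.gS φ) x' y) x ∧
    DifferentiableAt ℝ (fun y' => gradY (B.gS φ) x y') y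
  -- smoothness of `f` and `g`; `f` itself need only be Lipschitz in `y₁`
  diff_f : Differentiable ℝ fun p : Pt dx dy => B.f p.fst p.snd
  diff_g : ∀ x, Differentiable ℝ (B.g x)
  diff_gradY_g : Differentiable ℝ fun p : Pt dx dy => gradY B.g p.fst p.snd
  lip_f : ∀ x, LipschitzWith ℓf (B.f x)
  lip_grad_f : JointLipschitz ℓf (grad B.f)
  lip_gradY_g : JointLipschitz ℓg (gradY B.g)
  lip_hessXY_g : JointLipschitz ℓg (hessXY B.g)
  lip_hessYY_g : JointLipschitz ℓg (hessYY B.g)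
  -- strong convexity of the lower level
  strong_g : ∀ x, StrongConvexOn Set.univ μg (B.g x)
  -- the stochastic oracles
  est_grad_f : IsUnbiasedEstimator B.Df (fun ζ => grad (B.fS ζ)) (grad B.f) σ
  est_gradY_g : IsUnbiasedEstimator B.Dg (fun φ => gradY (B.gS φ)) (gradY B.g) σ
  est_hessXY_g : IsUnbiasedEstimator B.Dg (fun φ => hessXY (B.gS φ)) (hessXY B.g) σ
  est_hessYY_g : IsUnbiasedEstimator B.Dg (fun φ => hessYY (B.gS φ)) (hessYY B.g) σ

end Problem

/-- The samples drawn by the algorithm at the times `k = 0, 1, 2, …`. -/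
structure Samples (Ω Zf Zg : Type*) where
  ζ₀ : ℕ → Ω → Zf
  ζ₂ : ℕ → Ω → Zf
  φ₀ : ℕ → Ω → Zg
  φ₁ : ℕ → Ω → Zg
  φ₂ : ℕ → Ω → Zg

/-- All the samples of time `k`. -/
def Samples.at {Ω Zf Zg : Type*} (S : Samples Ω Zf Zg) (k : ℕ) (ω : Ω) :
    Zf × Zf × Zg × Zg × Zg :=
  (S.ζ₀ k ω, S.ζ₂ k ω, S.φ₀ k ω, S.φ₁ k ω, S.φ₂ k ω)

section Algorithm

variable {dx dy : ℕ} {Zf Zg Ω : Type*} [MeasurableSpace Zf] [MeasurableSpace Zg]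
  [MeasurableSpace Ω]

/-- The initial point is square integrable, the five samples of each time are independent with
`ζ₀, ζ₂ ∼ Df` and `φ₀, φ₁, φ₂ ∼ Dg`, and they are independent of the initial point and of all
earlier samples. -/
structure IsSampling (B : Problem dx dy Zf Zg) (P : Measure Ω) (S : Samples Ω Zf Zg)
    (x₀ : Ω → Vec dx) (y₁₀ y₂₀ : Ω → Vec dy) : Prop where
  meas_x₀ : Measurable x₀
  meas_y₁₀ : Measurable y₁₀
  meas_y₂₀ : Measurable y₂₀
  memLp_x₀ : MemLp x₀ 2 P
  memLp_y₁₀ : MemLp y₁₀ 2 P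
  memLp_y₂₀ : MemLp y₂₀ 2 P
  meas : ∀ k, Measurable (S.at k)
  law : ∀ k, P.map (S.at k) = B.Df.prod (B.Df.prod (B.Dg.prod (B.Dg.prod B.Dg)))
  indep : ∀ k, IndepFun (S.at k)
    (fun ω => ((x₀ ω, y₁₀ ω, y₂₀ ω), fun j : Fin k => S.at j ω)) P

/-- `(x k, y₁ k, y₂ k)` are the SOBA iterates with step sizes `α k, β₁ k, β₂ k`. -/
structure IsSOBA (B : Problem dx dy Zf Zg) (S : Samples Ω Zf Zg)
    (x₀ : Ω → Vec dx) (y₁₀ y₂₀ : Ω → Vec dy) (α β₁ β₂ : ℕ → ℝ)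
    (x : ℕ → Ω → Vec dx) (y₁ y₂ : ℕ → Ω → Vec dy) : Prop where
  init_x : x 0 = x₀
  init_y₁ : y₁ 0 = y₁₀
  init_y₂ : y₂ 0 = y₂₀
  step_y₁ : ∀ k ω, y₁ (k + 1) ω =
    y₁ k ω - β₁ k • gradY (B.gS (S.φ₁ k ω)) (x k ω) (y₁ k ω)
  step_y₂ : ∀ k ω, y₂ (k + 1) ω =
    y₂ k ω - β₂ k • (gradY (B.fS (S.ζ₂ k ω)) (x k ω) (y₁ k ω)
      + hessYY (B.gS (S.φ₂ k ω)) (x k ω) (y₁ k ω) (y₂ k ω))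
  step_x : ∀ k ω, x (k + 1) ω =
    x k ω - α k • (gradX (B.fS (S.ζ₀ k ω)) (x k ω) (y₁ k ω)
      + hessXY (B.gS (S.φ₀ k ω)) (x k ω) (y₁ k ω) (y₂ k ω))

end Algorithm

/-- Step sizes `a K k`, used at the times `k < K` of the run with `K` iterations, are `Θ(r K)` as
`K → ∞`, uniformly in `k`. -/
def IsThetaSteps (a : ℕ → ℕ → ℝ) (r : ℕ → ℝ) : Prop :=
  ∃ c > 0, ∃ C : ℝ, ∀ᶠ K in atTop, ∀ k < K, c * r K ≤ a K k ∧ a K k ≤ C * r K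

/-- `u = Õ(r)`: `u = O(r max{1, |log r|})`. -/
def IsSoftO (u r : ℕ → ℝ) : Prop :=
  u =O[atTop] fun K => r K * max 1 |Real.log (r K)|

end Bilevel

end

/-! The three recursions run on the same time scale, so each inner sequence chases a moving target:
`y₁` chases y₁*(x), and `y₂` chases u*(x, y₁) = -(∇²_yy g)⁻¹∇_y f. Under the given regularity
`uStar` is only known to be Lipschitz. A direct comparison with u*(xᵏ, y₁ᵏ) or y₁*(xᵏ), using
Lipschitz continuity alone, lets the fresh noise of the step move the target, and Young's inequality
then charges α²/β per step, which is no smaller than α when α and β are comparable.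

The remedy is to compare with lagged targets. Let z be the moving average of x with weight β₁, and
q, w those of x, y₁ with weight β₂ (`smooth`). The new average depends only on old iterates, so
y*(z) and u*(q, w) move by at most a constant times β‖x - z‖, respectively β(‖x - q‖ + ‖y₁ - w‖),
with no fresh noise. The noise enters the gaps x - z, x - q, y₁ - w linearly; there it is orthogonal
to the past and costs only the square of the step size.

With E₁ = 𝔼‖y₁ - y*(z)‖², E₂ = 𝔼‖y₂ - u*(q, w)‖², D = 𝔼‖x - z‖² and Q = 𝔼‖x - q‖² + 𝔼‖y₁ - w‖², one
step gives the coupled inequalities `StepBound` (`NoisyStep.stepBound`). Each error contracts, E₂ is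
fed by Q, Q by E₁ and D, E₁ by D, and D and Q also by α²/β times V, the second moment of the mean
direction. The descent inequality for 𝔼F supplies -(α/4)V, which pays for this once α/β is small.
Hence F + aE₁ + E₂ + bQ + cD decreases up to squared step sizes (`lyap_step`, `exists_lyapunov`).
Descent needs `F` to have a Lipschitz gradient, the hypergradient: `hasGradientAt_F`,
`hyperGrad_lip`.

In the lower bounded case the decrease is telescoped (`IsSOBA.sum_errors_le`). In the strongly
convex case the Polyak–Łojasiewicz inequality makes it a contraction with factor 1 - log K / K; over
K steps the initial gap shrinks to order 1/K and the noise floor is of order log K / K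
(`IsSOBA.last_error_le`). -/

noncomputable section

namespace Bilevel

/-! ### Strong convexity, Lipschitz gradients and one-step norm inequalities. -/

section General

variable {E : Type*} [NormedAddCommGroup E] [InnerProductSpace ℝ E]

local notation "⟪" x ", " y "⟫" => inner ℝ x y

theorem hasGradientAt_line [CompleteSpace E] {φ : E → ℝ} {x d : E} (h : DifferentiableAt ℝ φ x) :
    HasDerivAt (fun t : ℝ => φ (x + t • d)) ⟪gradient φ x, d⟫ 0 := by
  have h1 : HasFDerivAt φ (fderiv ℝ φ x) (x + (0 : ℝ) • d) := by simpa using h.hasFDerivAt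
  have h2 : HasDerivAt (fun t : ℝ => x + t • d) d 0 := by
    simpa using ((hasDerivAt_id (0 : ℝ)).smul_const d).const_add x
  have := h1.comp_hasDerivAt (0 : ℝ) h2
  rwa [inner_gradient_left]

/-- The first-order lower bound for a strongly convex function. -/
theorem _root_.StrongConvexOn.le_of_differentiableAt [CompleteSpace E] {φ : E → ℝ} {m : ℝ}
    (h : StrongConvexOn Set.univ m φ) {x : E} (hd : DifferentiableAt ℝ φ x) (y : E) :
    φ x + ⟪gradient φ x, y - x⟫ + m / 2 * ‖y - x‖ ^ 2 ≤ φ y := by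
  -- Strong convexity on the segment from `x` to `y`, divided by t, passes to the limit t ↓ 0.
  have hl := (hasDerivAt_iff_tendsto_slope_zero.1
    (hasGradientAt_line (d := y - x) hd)).mono_left
    (nhdsWithin_mono (0 : ℝ) (s := Set.Ioi 0) (fun t ht => ne_of_gt ht))
  have hr : Tendsto (fun t : ℝ => φ y - φ x - (1 - t) * (m / 2 * ‖y - x‖ ^ 2)) (𝓝[>] 0)
      (𝓝 (φ y - φ x - (1 - 0) * (m / 2 * ‖y - x‖ ^ 2))) := by
    apply Tendsto.mono_left _ nhdsWithin_le_nhds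
    apply Continuous.tendsto
    fun_prop
  have := le_of_tendsto_of_tendsto hl hr ?_
  · linarith
  have h01 : Set.Ioo (0 : ℝ) 1 ∈ 𝓝[>] (0 : ℝ) := Ioo_mem_nhdsGT one_pos
  filter_upwards [h01] with t ht
  have hc := h.2 (Set.mem_univ y) (Set.mem_univ x) ht.1.le (sub_nonneg.2 ht.2.le) (by ring)
  have e : t • y + (1 - t) • x = x + t • (y - x) := by module
  rw [e] at hc
  simp only [smul_eq_mul, zero_add, zero_smul, add_zero] at hc ⊢
  rw [inv_mul_le_iff₀ ht.1]
  nlinarith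

/-- A strongly convex differentiable function on a finite-dimensional space has a minimizer. -/
theorem exists_minimizer [FiniteDimensional ℝ E] {φ : E → ℝ} {m : ℝ} (hm : 0 < m)
    (h : StrongConvexOn Set.univ m φ) (hd : Differentiable ℝ φ) : ∃ z, ∀ w, φ z ≤ φ w := by
  apply hd.continuous.exists_forall_le
  -- The first-order lower bound at 0 grows quadratically in ‖y‖, so `φ` is coercive.
  have hq : Tendsto (fun r : ℝ => φ 0 + r * (m / 2 * r - ‖gradient φ 0‖)) atTop atTop := by
    apply tendsto_atTop_add_const_left
    apply Tendsto.atTop_mul_atTop₀ tendsto_id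
    apply tendsto_atTop_add_const_right
    exact tendsto_id.const_mul_atTop (by positivity)
  apply tendsto_atTop_mono _ (hq.comp (tendsto_norm_cocompact_atTop (E := E)))
  intro y
  have h1 := h.le_of_differentiableAt (hd 0) y
  have h2 := abs_le.1 (abs_real_inner_le_norm (gradient φ 0) y)
  simp only [sub_zero, Function.comp] at h1 ⊢
  nlinarith

theorem gradient_eq_zero_of_minimizer [CompleteSpace E] {φ : E → ℝ} {z : E}
    (h : ∀ w, φ z ≤ φ w) : gradient φ z = 0 := by
  have : fderiv ℝ φ z = 0 := IsLocalMin.fderiv_eq_zero (Eventually.of_forall h)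
  simp [gradient, this]

theorem strongConvex_gradient_mono [CompleteSpace E] {φ : E → ℝ} {m : ℝ}
    (h : StrongConvexOn Set.univ m φ) (hd : Differentiable ℝ φ) (x y : E) :
    m * ‖x - y‖ ^ 2 ≤ ⟪gradient φ x - gradient φ y, x - y⟫ := by
  have h1 := h.le_of_differentiableAt (hd x) y
  have h2 := h.le_of_differentiableAt (hd y) x
  rw [norm_sub_rev y x] at h1
  rw [← neg_sub x y, inner_neg_right] at h1
  rw [inner_sub_left]
  linarith

/-- Polyak–Łojasiewicz: complete the square in the first-order lower bound. With `y` the minimizer,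
it turns a decrease by ‖∇F‖² into a contraction of the gap. -/
theorem strongConvex_gap_le [CompleteSpace E] {φ : E → ℝ} {m : ℝ} (hm : 0 < m)
    (h : StrongConvexOn Set.univ m φ) (hd : Differentiable ℝ φ) (x y : E) :
    2 * m * (φ x - φ y) ≤ ‖gradient φ x‖ ^ 2 := by
  have h1 := h.le_of_differentiableAt (hd x) y
  have h2 : 0 ≤ ‖gradient φ x + m • (y - x)‖ ^ 2 := by positivity
  rw [norm_add_sq_real, inner_smul_right, norm_smul, Real.norm_eq_abs, mul_pow, sq_abs] at h2
  nlinarith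

/-- Descent along a Lipschitz gradient. -/
theorem le_of_lipschitz_gradient [CompleteSpace E] {φ : E → ℝ} {φ' : E → E} {L : ℝ} (hL : 0 ≤ L)
    (hd : ∀ x, HasGradientAt φ (φ' x) x) (hl : ∀ x y, ‖φ' x - φ' y‖ ≤ L * ‖x - y‖) (x d : E) :
    |φ (x + d) - φ x - ⟪φ' x, d⟫| ≤ L * ‖d‖ ^ 2 := by
  -- The mean value inequality bounds the derivative deviation by L‖d‖ on the whole segment; hence
  -- the constant L instead of L/2.
  have := Convex.norm_image_sub_le_of_norm_hasFDerivWithin_le' (𝕜 := ℝ) (f := φ)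
    (C := L * ‖d‖) (s := segment ℝ x (x + d)) (x := x) (y := x + d)
    (f' := fun z => InnerProductSpace.toDual ℝ E (φ' z)) (φ := InnerProductSpace.toDual ℝ E (φ' x))
    (fun z _ => (hd z).hasFDerivAt.hasFDerivWithinAt) ?_ (convex_segment _ _)
    (left_mem_segment _ _ _) (right_mem_segment _ _ _)
  · simp only [add_sub_cancel_left, InnerProductSpace.toDual_apply_apply, Real.norm_eq_abs] at this
    calc _ ≤ _ := this
      _ = _ := by ring
  · intro z hz
    rw [← map_sub, LinearIsometryEquiv.norm_map]
    refine (hl z x).trans ?_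
    rw [segment_eq_image'] at hz
    obtain ⟨t, ht, rfl⟩ := hz
    simp only [add_sub_cancel_left, norm_smul, Real.norm_eq_abs, abs_of_nonneg ht.1]
    gcongr
    exact mul_le_of_le_one_left (norm_nonneg _) ht.2

/-- A gradient step of length 1/(2L) lowers `φ` by at least ‖φ' x‖²/(4L) and cannot get below `b`.
-/
theorem sq_norm_gradient_le [CompleteSpace E] {φ : E → ℝ} {φ' : E → E} {L b : ℝ} (hL : 0 < L)
    (hd : ∀ x, HasGradientAt φ (φ' x) x) (hl : ∀ x y, ‖φ' x - φ' y‖ ≤ L * ‖x - y‖)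
    (hb : ∀ x, b ≤ φ x) (x : E) : ‖φ' x‖ ^ 2 ≤ 4 * L * (φ x - b) := by
  have h := (abs_le.1 (le_of_lipschitz_gradient hL.le hd hl x (-(1 / (2 * L)) • φ' x))).2
  have h1 := hb (x + -(1 / (2 * L)) • φ' x)
  rw [inner_smul_right, real_inner_self_eq_norm_sq, norm_smul, mul_pow, Real.norm_eq_abs, sq_abs]
    at h
  have e : L * ((-(1 / (2 * L))) ^ 2 * ‖φ' x‖ ^ 2) = 1 / (4 * L) * ‖φ' x‖ ^ 2 := by
    field_simp; ring
  have e2 : -(1 / (2 * L)) * ‖φ' x‖ ^ 2 = -2 * (1 / (4 * L) * ‖φ' x‖ ^ 2) := by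
    field_simp; ring
  rw [e, e2] at h
  have h3 : 1 / (4 * L) * ‖φ' x‖ ^ 2 ≤ φ x - b := by linarith
  rwa [one_div, inv_mul_le_iff₀ (by positivity)] at h3

theorem sq_norm_add_le (a b : E) : ‖a + b‖ ^ 2 ≤ 2 * ‖a‖ ^ 2 + 2 * ‖b‖ ^ 2 := by
  have := parallelogram_law_with_norm ℝ a b
  nlinarith [sq_nonneg ‖a - b‖]

/-- A step along a coercive field, perturbed by `m`, contracts up to the size of `m`. -/
theorem sq_norm_contract {e a m : E} {μ ℓ β : ℝ} (hμ : 0 < μ) (hβ : 0 < β) (hβ1 : β ≤ 1)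
    (hℓ : 4 * β * ℓ ^ 2 ≤ μ) (ha : μ * ‖e‖ ^ 2 ≤ ⟪a, e⟫) (hae : ‖a‖ ≤ ℓ * ‖e‖) :
    ‖e - β • (a + m)‖ ^ 2 ≤ (1 - μ * β) * ‖e‖ ^ 2 + β * ((2 / μ + 2) * ‖m‖ ^ 2) := by
  -- Coercivity yields a decrease 2μβ‖e‖². Young's inequality for ⟨e, m⟩ uses up μβ/2 of it, and the
  -- quadratic term, by smallness of β, another μβ/2.
  rw [norm_sub_sq_real, inner_smul_right, norm_smul, mul_pow, Real.norm_eq_abs, sq_abs,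
    inner_add_right, real_inner_comm]
  have h1 := sq_norm_add_le a m
  have h2 : -(2 * ⟪e, m⟫) ≤ μ / 2 * ‖e‖ ^ 2 + 2 / μ * ‖m‖ ^ 2 := by
    have h3 := (abs_le.1 (abs_real_inner_le_norm e m)).1
    have h4 : 2 * (‖e‖ * ‖m‖) ≤ μ / 2 * ‖e‖ ^ 2 + 2 / μ * ‖m‖ ^ 2 := by
      have : 0 ≤ 2 / μ * (μ / 2 * ‖e‖ - ‖m‖) ^ 2 := by positivity
      have e1 : 2 / μ * (μ / 2 * ‖e‖ - ‖m‖) ^ 2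
        = μ / 2 * ‖e‖ ^ 2 + 2 / μ * ‖m‖ ^ 2 - 2 * (‖e‖ * ‖m‖) := by field_simp; ring
      linarith
    linarith
  have h5 : ‖a‖ ^ 2 ≤ ℓ ^ 2 * ‖e‖ ^ 2 := by
    rw [← mul_pow]; exact pow_le_pow_left₀ (norm_nonneg _) hae 2
  have h6 : β ^ 2 * ‖a + m‖ ^ 2 ≤ β * (μ / 2 * ‖e‖ ^ 2) + β * (2 * ‖m‖ ^ 2) := by
    have i1 : β ^ 2 * ‖a + m‖ ^ 2 ≤ β ^ 2 * (2 * (ℓ ^ 2 * ‖e‖ ^ 2) + 2 * ‖m‖ ^ 2) := by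
      gcongr; linarith
    have i2 : β * (4 * β * ℓ ^ 2) * ‖e‖ ^ 2 ≤ β * μ * ‖e‖ ^ 2 := by gcongr
    have i3 : β * (β * (2 * ‖m‖ ^ 2)) ≤ β * (1 * (2 * ‖m‖ ^ 2)) := by gcongr
    linarith
  have h7 := mul_le_mul_of_nonneg_left h2 hβ.le
  have h8 := mul_le_mul_of_nonneg_left ha hβ.le
  linarith

/-- Convexity of the squared norm at the combination of `d` and -(a/τ)v with weights 1 - τ and τ;
the defect is the square in `h`. -/
theorem sq_norm_smooth_step {d v : E} {τ a : ℝ} (hτ : 0 < τ) (hτ1 : τ ≤ 1) :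
    ‖(1 - τ) • d - a • v‖ ^ 2 ≤ (1 - τ) * ‖d‖ ^ 2 + a ^ 2 / τ * ‖v‖ ^ 2 := by
  have h : 0 ≤ (1 - τ) / τ * ‖τ • d + a • v‖ ^ 2 := by
    have := sub_nonneg.2 hτ1
    positivity
  rw [norm_add_sq_real, inner_smul_left, inner_smul_right, norm_smul, norm_smul, mul_pow, mul_pow,
    Real.norm_eq_abs, Real.norm_eq_abs, sq_abs, sq_abs] at h
  rw [norm_sub_sq_real, inner_smul_left, inner_smul_right, norm_smul, norm_smul, mul_pow, mul_pow,
    Real.norm_eq_abs, Real.norm_eq_abs, sq_abs, sq_abs]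
  simp only [conj_trivial] at h ⊢
  have e : (1 - τ) * ‖d‖ ^ 2 + a ^ 2 / τ * ‖v‖ ^ 2 - ((1 - τ) ^ 2 * ‖d‖ ^ 2
      - 2 * ((1 - τ) * (a * ⟪d, v⟫)) + a ^ 2 * ‖v‖ ^ 2)
      = (1 - τ) / τ * (τ ^ 2 * ‖d‖ ^ 2 + 2 * (τ * (a * ⟪d, v⟫)) + a ^ 2 * ‖v‖ ^ 2) := by
    field_simp; ring
  linarith

end General

/-! ### Pairs (x, y): norms, joint Lipschitz bounds and partial derivatives. -/

section Joint

variable {dx dy : ℕ} {E : Type*} [NormedAddCommGroup E]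

local notation "⟪" x ", " y "⟫" => inner ℝ x y

theorem norm_toLp_le (a : Vec dx) (b : Vec dy) :
    ‖(WithLp.toLp 2 (a, b) : Pt dx dy)‖ ≤ ‖a‖ + ‖b‖ := by
  rw [← abs_of_nonneg (norm_nonneg (WithLp.toLp 2 (a, b) : Pt dx dy)),
    ← abs_of_nonneg (add_nonneg (norm_nonneg a) (norm_nonneg b))]
  apply sq_le_sq.1
  rw [WithLp.prod_norm_sq_eq_of_L2]
  have := mul_nonneg (norm_nonneg a) (norm_nonneg b)
  change ‖a‖ ^ 2 + ‖b‖ ^ 2 ≤ _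
  nlinarith

theorem norm_fst_le (p : Pt dx dy) : ‖p.fst‖ ≤ ‖p‖ := by
  apply le_of_sq_le_sq _ (norm_nonneg _)
  rw [WithLp.prod_norm_sq_eq_of_L2]
  nlinarith [sq_nonneg ‖p.snd‖]

theorem norm_snd_le (p : Pt dx dy) : ‖p.snd‖ ≤ ‖p‖ := by
  apply le_of_sq_le_sq _ (norm_nonneg _)
  rw [WithLp.prod_norm_sq_eq_of_L2]
  nlinarith [sq_nonneg ‖p.fst‖]

theorem JointLipschitz.norm_sub_le {L : ℝ≥0} {T : Vec dx → Vec dy → E} (h : JointLipschitz L T)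
    (x x' : Vec dx) (y y' : Vec dy) : ‖T x y - T x' y'‖ ≤ L * (‖x - x'‖ + ‖y - y'‖) := by
  have := LipschitzWith.norm_sub_le h (WithLp.toLp 2 (x, y)) (WithLp.toLp 2 (x', y'))
  refine this.trans (mul_le_mul_of_nonneg_left ?_ L.2)
  exact norm_toLp_le (x - x') (y - y')

theorem continuous_uncurry_of_norm_sub_le {L : ℝ} {T : Vec dx → Vec dy → E}
    (h : ∀ x x' y y', ‖T x y - T x' y'‖ ≤ L * (‖x - x'‖ + ‖y - y'‖)) :
    Continuous fun q : Vec dx × Vec dy => T q.1 q.2 := by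
  rw [continuous_iff_continuousAt]
  intro q
  rw [ContinuousAt, tendsto_iff_norm_sub_tendsto_zero]
  have hc : Tendsto (fun p : Vec dx × Vec dy => L * (‖p.1 - q.1‖ + ‖p.2 - q.2‖)) (𝓝 q)
      (𝓝 (L * (‖q.1 - q.1‖ + ‖q.2 - q.2‖))) := by
    apply Continuous.tendsto
    fun_prop
  simp only [sub_self, norm_zero, add_zero, mul_zero] at hc
  exact squeeze_zero (fun _ => norm_nonneg _) (fun p => h _ _ _ _) hc

/-- On the plain product the total derivative splits into partial ones, the form needed to expand
along x' ↦ (x', y*(x')). -/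
theorem hasFDerivAt_uncurry [NormedSpace ℝ E] {G : Vec dx → Vec dy → E} {x : Vec dx} {y : Vec dy}
    (h : DifferentiableAt ℝ (fun p : Pt dx dy => G p.fst p.snd) (WithLp.toLp 2 (x, y))) :
    DifferentiableAt ℝ (fun x' => G x' y) x ∧ DifferentiableAt ℝ (G x) y ∧
    HasFDerivAt (fun q : Vec dx × Vec dy => G q.1 q.2)
      ((fderiv ℝ (fun x' => G x' y) x).coprod (fderiv ℝ (fun y' => G x y') y)) (x, y) := by
  let J := (WithLp.prodContinuousLinearEquiv 2 ℝ (Vec dx) (Vec dy)).symm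
  have h1 : HasFDerivAt (fun q : Vec dx × Vec dy => G q.1 q.2) _ (x, y) :=
    HasFDerivAt.comp (x, y) (g := fun p : Pt dx dy => G p.fst p.snd) (f := J)
      h.hasFDerivAt J.hasFDerivAt
  have hx : HasFDerivAt (fun x' => G x' y) _ x :=
    HasFDerivAt.comp x (f := fun x' => (x', y)) h1 (hasFDerivAt_prodMk_left x y)
  have hy : HasFDerivAt (fun y' => G x y') _ y :=
    HasFDerivAt.comp y (f := fun y' => (x, y')) h1 (hasFDerivAt_prodMk_right x y)
  refine ⟨hx.differentiableAt, hy.differentiableAt, ?_⟩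
  rw [hx.fderiv, hy.fderiv]
  refine h1.congr_fderiv (ContinuousLinearMap.ext fun q => ?_)
  simp only [ContinuousLinearMap.coprod_apply, ContinuousLinearMap.comp_apply, ← map_add]
  simp

end Joint

/-! ### The lower-level solution, the auxiliary linear system and the hypergradient. -/

/-- The hypergradient estimate `∇ₓ f (x, y) + ∇²_{xy} g (x, y) u`. -/
def hyperDir {dx dy : ℕ} (f g : Vec dx → Vec dy → ℝ) (x : Vec dx) (y u : Vec dy) : Vec dx :=
  gradX f x y + hessXY g x y u

/-- The residual `∇_y f (x, y) + ∇²_{yy} g (x, y) u` of the auxiliary linear system. -/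
def residual {dx dy : ℕ} (f g : Vec dx → Vec dy → ℝ) (x : Vec dx) (y u : Vec dy) : Vec dy :=
  gradY f x y + hessYY g x y u

namespace Problem

variable {dx dy : ℕ} {Zf Zg : Type*} [MeasurableSpace Zf] [MeasurableSpace Zg]

local notation "⟪" x ", " y "⟫" => inner ℝ x y

/-- The solution `u` of `∇_y f (x, y) + ∇²_{yy} g (x, y) u = 0`. -/
def uStar (B : Problem dx dy Zf Zg) (x : Vec dx) (y : Vec dy) : Vec dy :=
  Classical.epsilon fun u => residual B.f B.g x y u = 0

/-- The hypergradient of the bilevel problem. -/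
def hyperGrad (B : Problem dx dy Zf Zg) (x : Vec dx) : Vec dx :=
  hyperDir B.f B.g x (B.yStar x) (B.uStar x (B.yStar x))

namespace Regular

variable {B : Problem dx dy Zf Zg} {ℓf ℓg : ℝ≥0} {μg σ : ℝ}

theorem gradY_yStar (R : B.Regular ℓf ℓg μg σ) (hμ : 0 < μg) (x : Vec dx) :
    gradY B.g x (B.yStar x) = 0 :=
  gradient_eq_zero_of_minimizer
    (argmin_le (exists_minimizer hμ (R.strong_g x) (R.diff_g x)))

theorem gradY_mono (R : B.Regular ℓf ℓg μg σ) (x : Vec dx) (y y' : Vec dy) :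
    μg * ‖y - y'‖ ^ 2 ≤ ⟪gradY B.g x y - gradY B.g x y', y - y'⟫ :=
  strongConvex_gradient_mono (R.strong_g x) (R.diff_g x) y y'

/-- Both gradients vanish at their own minimizers, so strong monotonicity at `x` bounds the distance
by the change of ∇_y g from `x` to `x'` at the fixed point y*(x'). -/
theorem yStar_lip (R : B.Regular ℓf ℓg μg σ) (hμ : 0 < μg) (x x' : Vec dx) :
    ‖B.yStar x - B.yStar x'‖ ≤ ℓg / μg * ‖x - x'‖ := by
  have h1 := R.gradY_mono x (B.yStar x) (B.yStar x')
  rw [R.gradY_yStar hμ x, ← R.gradY_yStar hμ x'] at h1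
  have h2 := R.lip_gradY_g.norm_sub_le x' x (B.yStar x') (B.yStar x')
  have h3 := (abs_le.1 (abs_real_inner_le_norm (gradY B.g x' (B.yStar x')
    - gradY B.g x (B.yStar x')) (B.yStar x - B.yStar x'))).2
  rw [sub_self, norm_zero, add_zero, norm_sub_rev x' x] at h2
  set t := ‖B.yStar x - B.yStar x'‖ with ht
  have ht0 : 0 ≤ t := norm_nonneg _
  rcases ht0.eq_or_lt with h0 | h0
  · rw [← h0]; positivity
  · rw [div_mul_eq_mul_div, le_div_iff₀ hμ]
    have h4 : μg * t ^ 2 ≤ ℓg * ‖x - x'‖ * t :=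
      h1.trans (h3.trans (mul_le_mul_of_nonneg_right h2 ht0))
    nlinarith

theorem hasFDerivAt_gradY (R : B.Regular ℓf ℓg μg σ) (x : Vec dx) (y : Vec dy) :
    HasFDerivAt (gradY B.g x) (hessYY B.g x y) y :=
  (hasFDerivAt_uncurry (R.diff_gradY_g (WithLp.toLp 2 (x, y)))).2.1.hasFDerivAt

/-- Strong monotonicity of ∇_y g along the line y + te, divided by t² and passed to the limit. -/
theorem hessYY_coercive (R : B.Regular ℓf ℓg μg σ) (x : Vec dx) (y e : Vec dy) :
    μg * ‖e‖ ^ 2 ≤ ⟪hessYY B.g x y e, e⟫ := by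
  have h1 : HasFDerivAt (gradY B.g x) (hessYY B.g x y) (y + (0 : ℝ) • e) := by
    simpa using R.hasFDerivAt_gradY x y
  have h2 : HasDerivAt (fun t : ℝ => y + t • e) e 0 := by
    simpa using ((hasDerivAt_id (0 : ℝ)).smul_const e).const_add y
  have h3 := (hasDerivAt_iff_tendsto_slope_zero.1 (h1.comp_hasDerivAt (0 : ℝ) h2)).mono_left
    (nhdsWithin_mono (0 : ℝ) (s := Set.Ioi 0) (fun t ht => ne_of_gt ht))
  refine ge_of_tendsto (h3.inner tendsto_const_nhds) ?_
  filter_upwards [self_mem_nhdsWithin] with t ht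
  have ht' : (0 : ℝ) < t := ht
  have h4 := R.gradY_mono x (y + t • e) y
  simp only [add_sub_cancel_left, norm_smul, inner_smul_right, Real.norm_eq_abs, mul_pow, sq_abs]
    at h4
  simp only [Function.comp, zero_add, zero_smul, add_zero, inner_smul_left, conj_trivial]
  rw [le_inv_mul_iff₀ ht']
  nlinarith

theorem norm_hessYY_le (R : B.Regular ℓf ℓg μg σ) (x : Vec dx) (y : Vec dy) :
    ‖hessYY B.g x y‖ ≤ ℓg := by
  apply norm_fderiv_le_of_lipschitz
  apply LipschitzWith.of_dist_le_mul
  intro a b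
  simpa [dist_eq_norm] using R.lip_gradY_g.norm_sub_le x x a b

theorem norm_hessXY_le (R : B.Regular ℓf ℓg μg σ) (x : Vec dx) (y : Vec dy) :
    ‖hessXY B.g x y‖ ≤ ℓg := by
  rw [hessXY, LinearIsometryEquiv.norm_map]
  apply norm_fderiv_le_of_lipschitz
  apply LipschitzWith.of_dist_le_mul
  intro a b
  simpa [dist_eq_norm] using R.lip_gradY_g.norm_sub_le a b y y

theorem norm_gradY_f_le (R : B.Regular ℓf ℓg μg σ) (x : Vec dx) (y : Vec dy) :
    ‖gradY B.f x y‖ ≤ ℓf := by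
  rw [gradY, gradient, LinearIsometryEquiv.norm_map]
  exact norm_fderiv_le_of_lipschitz _ (R.lip_f x)

theorem gradX_f_lip (R : B.Regular ℓf ℓg μg σ) (x x' : Vec dx) (y y' : Vec dy) :
    ‖gradX B.f x y - gradX B.f x' y'‖ ≤ ℓf * (‖x - x'‖ + ‖y - y'‖) :=
  (norm_fst_le (grad B.f x y - grad B.f x' y')).trans (R.lip_grad_f.norm_sub_le x x' y y')

theorem gradY_f_lip (R : B.Regular ℓf ℓg μg σ) (x x' : Vec dx) (y y' : Vec dy) :
    ‖gradY B.f x y - gradY B.f x' y'‖ ≤ ℓf * (‖x - x'‖ + ‖y - y'‖) :=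
  (norm_snd_le (grad B.f x y - grad B.f x' y')).trans (R.lip_grad_f.norm_sub_le x x' y y')

/-- Lets the Hessian pass from the increment of y* to `uStar` in `hasGradientAt_F`. -/
theorem hessYY_symm (R : B.Regular ℓf ℓg μg σ) (x : Vec dx) (y v w : Vec dy) :
    ⟪hessYY B.g x y v, w⟫ = ⟪hessYY B.g x y w, v⟫ := by
  let D : Vec dy →L[ℝ] StrongDual ℝ (Vec dy) :=
    (InnerProductSpace.toDual ℝ (Vec dy)).toContinuousLinearEquiv.toContinuousLinearMap
  have := second_derivative_symmetric (𝕜 := ℝ) (f := B.g x)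
    (f' := fun y => InnerProductSpace.toDual ℝ (Vec dy) (gradY B.g x y))
    (f'' := D.comp (hessYY B.g x y)) (x := y)
    (fun y => ((R.diff_g x) y).hasGradientAt.hasFDerivAt)
    (D.hasFDerivAt.comp y (R.hasFDerivAt_gradY x y)) v w
  simpa [D] using this

theorem hessYY_lower (R : B.Regular ℓf ℓg μg σ) (x : Vec dx) (y e : Vec dy) :
    μg * ‖e‖ ≤ ‖hessYY B.g x y e‖ := by
  have h1 := R.hessYY_coercive x y e
  have h2 := (abs_le.1 (abs_real_inner_le_norm (hessYY B.g x y e) e)).2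
  rcases (norm_nonneg e).eq_or_lt with h0 | h0
  · rw [← h0]; simp
  · nlinarith

/-- Coercivity makes the Hessian injective, hence surjective in finite dimension. -/
theorem residual_uStar (R : B.Regular ℓf ℓg μg σ) (hμ : 0 < μg) (x : Vec dx) (y : Vec dy) :
    residual B.f B.g x y (B.uStar x y) = 0 := by
  apply Classical.epsilon_spec (p := fun u => residual B.f B.g x y u = 0)
  have hinj : Function.Injective (hessYY B.g x y : Vec dy →ₗ[ℝ] Vec dy) := by
    rw [← LinearMap.ker_eq_bot, LinearMap.ker_eq_bot']
    intro e he
    have h1 := R.hessYY_lower x y e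
    rw [show hessYY B.g x y e = 0 from he, norm_zero] at h1
    exact norm_le_zero_iff.1 (nonpos_of_mul_nonpos_right h1 hμ)
  obtain ⟨u, hu⟩ := LinearMap.injective_iff_surjective.1 hinj (-gradY B.f x y)
  exact ⟨u, by rw [residual, show hessYY B.g x y u = _ from hu, add_neg_cancel]⟩

theorem hessYY_uStar (R : B.Regular ℓf ℓg μg σ) (hμ : 0 < μg) (x : Vec dx) (y : Vec dy) :
    hessYY B.g x y (B.uStar x y) = -gradY B.f x y :=
  eq_neg_of_add_eq_zero_right (R.residual_uStar hμ x y)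

theorem norm_uStar_le (R : B.Regular ℓf ℓg μg σ) (hμ : 0 < μg) (x : Vec dx) (y : Vec dy) :
    ‖B.uStar x y‖ ≤ ℓf / μg := by
  have h := R.hessYY_lower x y (B.uStar x y)
  rw [R.hessYY_uStar hμ, norm_neg] at h
  rw [le_div_iff₀' hμ]
  exact h.trans (R.norm_gradY_f_le x y)

end Regular

/-- A Lipschitz constant of `uStar`. -/
def lipU (ℓf ℓg μg : ℝ) : ℝ := (ℓf + ℓg * (ℓf / μg)) / μg

/-- A Lipschitz constant of `hyperDir B.f B.g x y (B.uStar x y)`. -/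
def lipDir (ℓf ℓg μg : ℝ) : ℝ := ℓf + ℓg * lipU ℓf ℓg μg + ℓg * (ℓf / μg)

/-- A Lipschitz constant of the hypergradient. -/
def lipF (ℓf ℓg μg : ℝ) : ℝ := lipDir ℓf ℓg μg * (1 + ℓg / μg)

namespace Regular

variable {B : Problem dx dy Zf Zg} {ℓf ℓg : ℝ≥0} {μg σ : ℝ}

theorem uStar_lip (R : B.Regular ℓf ℓg μg σ) (hμ : 0 < μg) (x x' : Vec dx) (y y' : Vec dy) :
    ‖B.uStar x y - B.uStar x' y'‖ ≤ lipU ℓf ℓg μg * (‖x - x'‖ + ‖y - y'‖) := by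
  rw [lipU, div_mul_eq_mul_div, le_div_iff₀' hμ]
  refine (R.hessYY_lower x y _).trans ?_
  -- Subtract the two linear systems so that the Hessian difference acts on a solution, whose norm
  -- is at most ℓf/μg.
  have e : hessYY B.g x y (B.uStar x y - B.uStar x' y') = -(gradY B.f x y - gradY B.f x' y')
      - (hessYY B.g x y - hessYY B.g x' y') (B.uStar x' y') := by
    rw [map_sub, _root_.sub_apply, R.hessYY_uStar hμ, R.hessYY_uStar hμ]
    abel
  rw [e]
  refine (norm_sub_le _ _).trans ?_
  rw [norm_neg, add_mul]
  refine add_le_add (R.gradY_f_lip _ _ _ _) ((ContinuousLinearMap.le_opNorm _ _).trans ?_)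
  calc _ ≤ (ℓg * (‖x - x'‖ + ‖y - y'‖)) * (ℓf / μg) :=
        mul_le_mul (R.lip_hessYY_g.norm_sub_le _ _ _ _) (R.norm_uStar_le hμ _ _) (norm_nonneg _)
          (by positivity)
    _ = _ := by ring

/-- The vector `u` carries no a priori bound, so it enters only through u - u*(x, y), multiplied by
the bounded mixed Hessian. The Lipschitz variation of that Hessian meets only the bounded u*(x',
y'). -/
theorem hyperDir_sub_le (R : B.Regular ℓf ℓg μg σ) (hμ : 0 < μg) (x x' : Vec dx) (y y' u : Vec dy) :
    ‖hyperDir B.f B.g x y u - hyperDir B.f B.g x' y' (B.uStar x' y')‖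
      ≤ lipDir ℓf ℓg μg * (‖x - x'‖ + ‖y - y'‖) + ℓg * ‖u - B.uStar x y‖ := by
  have e : hyperDir B.f B.g x y u - hyperDir B.f B.g x' y' (B.uStar x' y')
      = (gradX B.f x y - gradX B.f x' y') + hessXY B.g x y (u - B.uStar x y)
        + hessXY B.g x y (B.uStar x y - B.uStar x' y')
        + (hessXY B.g x y - hessXY B.g x' y') (B.uStar x' y') := by
    simp only [hyperDir, map_sub, _root_.sub_apply]
    abel
  rw [e, lipDir]
  have h1 := R.gradX_f_lip x x' y y'
  have h2 := (hessXY B.g x y).le_of_opNorm_le (R.norm_hessXY_le x y) (u - B.uStar x y)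
  have h3 := ((hessXY B.g x y).le_of_opNorm_le (R.norm_hessXY_le x y)
    (B.uStar x y - B.uStar x' y')).trans
    (mul_le_mul_of_nonneg_left (R.uStar_lip hμ x x' y y') ℓg.2)
  have h4 := (ContinuousLinearMap.le_opNorm (hessXY B.g x y - hessXY B.g x' y')
    (B.uStar x' y')).trans (mul_le_mul (R.lip_hessXY_g.norm_sub_le x x' y y')
      (R.norm_uStar_le hμ x' y') (norm_nonneg _) (by positivity))
  refine (norm_add_le _ _).trans ((add_le_add_left (norm_add₃_le) _).trans ?_)
  linarith

theorem hyperGrad_lip (R : B.Regular ℓf ℓg μg σ) (hμ : 0 < μg) (x x' : Vec dx) :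
    ‖B.hyperGrad x - B.hyperGrad x'‖ ≤ lipF ℓf ℓg μg * ‖x - x'‖ := by
  have h := R.hyperDir_sub_le hμ x x' (B.yStar x) (B.yStar x') (B.uStar x (B.yStar x))
  rw [sub_self, norm_zero, mul_zero, add_zero] at h
  refine h.trans ?_
  rw [lipF, mul_assoc]
  have h2 := R.yStar_lip hμ x x'
  have : 0 ≤ lipDir ℓf ℓg μg := by unfold lipDir lipU; positivity
  gcongr
  linarith

/-- Adjoint argument that needs y* only Lipschitz, not differentiable. Expand f(x', y*(x')) to first
order, and add the expansion of the identity ∇_y g(x', y*(x')) = 0 paired with u*. By symmetry of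
the Hessian and the equation of u*, the terms in y*(x') - y*(x) cancel, leaving the hypergradient.
-/
theorem hasGradientAt_F (R : B.Regular ℓf ℓg μg σ) (hμ : 0 < μg) (x : Vec dx) :
    HasGradientAt B.F (B.hyperGrad x) x := by
  rw [hasGradientAt_iff_hasFDerivAt, hasFDerivAt_iff_isLittleO]
  have hO : (fun x' => ((x', B.yStar x') : Vec dx × Vec dy) - (x, B.yStar x))
      =O[𝓝 x] fun x' => x' - x := by
    apply IsBigO.of_bound (max 1 (ℓg / μg))
    filter_upwards with x'
    rw [Prod.norm_def]
    apply max_le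
    · exact le_mul_of_one_le_left (norm_nonneg _) (le_max_left _ _)
    · exact (R.yStar_lip hμ x' x).trans
        (mul_le_mul_of_nonneg_right (le_max_right _ _) (norm_nonneg _))
  have hy : Tendsto B.yStar (𝓝 x) (𝓝 (B.yStar x)) := by
    have : LipschitzWith (ℓg / ⟨μg, hμ.le⟩) B.yStar := LipschitzWith.of_dist_le_mul fun a b => by
      rw [dist_eq_norm, dist_eq_norm]
      exact R.yStar_lip hμ a b
    exact this.continuous.tendsto x
  have ht : Tendsto (fun x' => ((x', B.yStar x') : Vec dx × Vec dy)) (𝓝 x)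
      (𝓝 (x, B.yStar x)) := tendsto_id.prodMk_nhds hy
  have hf := (hasFDerivAt_uncurry (G := B.f) (R.diff_f (WithLp.toLp 2 (x, B.yStar x)))).2.2
  have hg := (hasFDerivAt_uncurry (G := gradY B.g)
    (R.diff_gradY_g (WithLp.toLp 2 (x, B.yStar x)))).2.2
  have hf1 := ((hasFDerivAt_iff_isLittleO.1 hf).comp_tendsto ht).trans_isBigO hO
  have hg1 := ((hasFDerivAt_iff_isLittleO.1 hg).comp_tendsto ht).trans_isBigO hO
  have hg2 := ((innerSL ℝ (B.uStar x (B.yStar x))).isBigO_comp (fun x' => _) (𝓝 x)).trans_isLittleO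
    hg1
  refine (hf1.add hg2).congr_left fun x' => ?_
  have s1 : fderiv ℝ (fun x' => B.f x' (B.yStar x)) x (x' - x)
      = ⟪gradX B.f x (B.yStar x), x' - x⟫ := (inner_gradient_left ..).symm
  have s2 : fderiv ℝ (fun y' => B.f x y') (B.yStar x) (B.yStar x' - B.yStar x)
      = ⟪gradY B.f x (B.yStar x), B.yStar x' - B.yStar x⟫ := (inner_gradient_left ..).symm
  have s3 : ⟪hessXY B.g x (B.yStar x) (B.uStar x (B.yStar x)), x' - x⟫
      = ⟪B.uStar x (B.yStar x), fderiv ℝ (fun x' => gradY B.g x' (B.yStar x)) x (x' - x)⟫ :=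
    ContinuousLinearMap.adjoint_inner_left _ _ _
  have s4 : ⟪B.uStar x (B.yStar x), hessYY B.g x (B.yStar x) (B.yStar x' - B.yStar x)⟫
      = -⟪gradY B.f x (B.yStar x), B.yStar x' - B.yStar x⟫ := by
    rw [real_inner_comm, R.hessYY_symm, R.hessYY_uStar hμ, inner_neg_left]
  have s5 : fderiv ℝ (fun y' => gradY B.g x y') (B.yStar x) = hessYY B.g x (B.yStar x) := rfl
  simp only [Function.comp, ContinuousLinearMap.coprod_apply, Prod.mk_sub_mk, s1, s2, s5,
    R.gradY_yStar hμ, InnerProductSpace.toDual_apply_apply, hyperGrad, hyperDir, inner_add_left,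
    s3, innerSL_apply_apply, sub_zero, zero_sub, inner_neg_right, inner_add_right, s4, F]
  ring

/-- Here `q` and `w` are the lagged points: the bias is measured against u*(q, w), at the price of
the gaps to (x, y). -/
theorem hyperDir_error_le (R : B.Regular ℓf ℓg μg σ) (hμ : 0 < μg) (x q : Vec dx)
    (y u w : Vec dy) :
    ‖hyperDir B.f B.g x y u - B.hyperGrad x‖ ≤ lipDir ℓf ℓg μg * ‖y - B.yStar x‖
      + ℓg * (‖u - B.uStar q w‖ + lipU ℓf ℓg μg * (‖x - q‖ + ‖y - w‖)) := by
  have h := R.hyperDir_sub_le hμ x x y (B.yStar x) u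
  rw [sub_self, norm_zero, zero_add] at h
  refine h.trans ?_
  gcongr
  have e : u - B.uStar x y = (u - B.uStar q w) - (B.uStar x y - B.uStar q w) := by abel
  rw [e]
  exact (norm_sub_le _ _).trans (add_le_add_right (R.uStar_lip hμ _ _ _ _) _)

end Regular

end Problem

/-! ### Noise orthogonal to the past in L². -/

theorem memLp_sqInt {Ω E : Type*} {mΩ : MeasurableSpace Ω} [NormedAddCommGroup E] {P : Measure Ω} {a : Ω → E} (ha : MemLp a 2 P) :
    Integrable (fun ω => ‖a ω‖ ^ 2) P :=
  ha.integrable_norm_pow two_ne_zero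

section Noise

variable {Ω : Type*} {m : MeasurableSpace Ω} {mΩ : MeasurableSpace Ω} {E : Type*} [NormedAddCommGroup E]
  [InnerProductSpace ℝ E]

local notation "⟪" x ", " y "⟫" => inner ℝ x y

/-- `n` is square integrable with second moment at most `b`, and orthogonal to every square
integrable `m`-measurable vector. -/
structure IsNoise (P : Measure Ω) (m : MeasurableSpace Ω) [MeasurableSpace E] (n : Ω → E) (b : ℝ) : Prop where
  memLp : MemLp n 2 P
  var : ∫ ω, ‖n ω‖ ^ 2 ∂P ≤ b
  orth : ∀ A : Ω → E, Measurable[m] A → MemLp A 2 P → ∫ ω, ⟪A ω, n ω⟫ ∂P = 0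

theorem integrable_inner_of_memLp {P : Measure Ω} {a b : Ω → E} (ha : MemLp a 2 P)
    (hb : MemLp b 2 P) : Integrable (fun ω => ⟪a ω, b ω⟫) P := by
  refine Integrable.mono' (((ha.integrable_norm_pow two_ne_zero).add
    (hb.integrable_norm_pow two_ne_zero))) (ha.1.inner hb.1) (ae_of_all _ fun ω => ?_)
  have := abs_real_inner_le_norm (a ω) (b ω)
  simp only [Real.norm_eq_abs, Pi.add_apply]
  nlinarith [sq_nonneg (‖a ω‖ - ‖b ω‖), sq_nonneg ‖a ω‖, sq_nonneg ‖b ω‖]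

variable [MeasurableSpace E]

theorem IsNoise.add {P : Measure Ω} {n n' : Ω → E} {b b' : ℝ}
    (h : IsNoise P m n b) (h' : IsNoise P m n' b') :
    IsNoise P m (fun ω => n ω + n' ω) (2 * b + 2 * b') where
  memLp := h.memLp.add h'.memLp
  var := by
    calc _ ≤ ∫ ω, (2 * ‖n ω‖ ^ 2 + 2 * ‖n' ω‖ ^ 2) ∂P :=
          integral_mono (memLp_sqInt (h.memLp.add h'.memLp))
            (((memLp_sqInt h.memLp).const_mul 2).add ((memLp_sqInt h'.memLp).const_mul 2))
            fun ω => sq_norm_add_le _ _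
      _ = 2 * ∫ ω, ‖n ω‖ ^ 2 ∂P + 2 * ∫ ω, ‖n' ω‖ ^ 2 ∂P := by
          rw [integral_add ((memLp_sqInt h.memLp).const_mul 2)
            ((memLp_sqInt h'.memLp).const_mul 2), integral_const_mul, integral_const_mul]
      _ ≤ _ := by linarith [h.var, h'.var]
  orth A hA hL := by
    simp only [inner_add_right]
    rw [integral_add (integrable_inner_of_memLp hL h.memLp)
      (integrable_inner_of_memLp hL h'.memLp), h.orth A hA hL, h'.orth A hA hL, add_zero]

/-- The cross term vanishes by orthogonality, so noise costs only the square of the step size. -/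
theorem IsNoise.integral_sq_sub {P : Measure Ω} {n A : Ω → E} {b : ℝ}
    (h : IsNoise P m n b) (hA : Measurable[m] A) (hL : MemLp A 2 P) (c : ℝ) :
    ∫ ω, ‖A ω - c • n ω‖ ^ 2 ∂P ≤ ∫ ω, ‖A ω‖ ^ 2 ∂P + c ^ 2 * b := by
  have e : ∀ ω, ‖A ω - c • n ω‖ ^ 2
      = ‖A ω‖ ^ 2 - (2 * c) * ⟪A ω, n ω⟫ + c ^ 2 * ‖n ω‖ ^ 2 := by
    intro ω
    rw [norm_sub_sq_real, inner_smul_right, norm_smul, mul_pow, Real.norm_eq_abs, sq_abs]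
    ring
  simp only [e]
  have i1 := memLp_sqInt hL
  have i2 := (integrable_inner_of_memLp hL h.memLp).const_mul (2 * c)
  have i3 := (memLp_sqInt h.memLp).const_mul (c ^ 2)
  have i4 : Integrable (fun ω => ‖A ω‖ ^ 2 - 2 * c * ⟪A ω, n ω⟫) P := i1.sub i2
  rw [integral_add i4 i3, integral_sub i1 i2, integral_const_mul, integral_const_mul,
    h.orth A hA hL]
  have := mul_le_mul_of_nonneg_left h.var (sq_nonneg c)
  linarith

theorem map_prod_of_indep {Z Y : Type*} [MeasurableSpace Z] [MeasurableSpace Y] {P : Measure Ω}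
    [IsProbabilityMeasure P] {D : Measure Z} {U : Ω → Z} (hU : Measurable U) (hD : P.map U = D)
    (hI : Indep (MeasurableSpace.comap U inferInstance) m P) (hm : m ≤ mΩ) {y : Ω → Y}
    (hy : Measurable[m] y) : P.map (fun ω => (U ω, y ω)) = D.prod (P.map y) := by
  have hi : IndepFun U y P := by
    rw [IndepFun_iff_Indep]
    exact indep_of_indep_of_le_right hI hy.comap_le
  rw [(indepFun_iff_map_prod_eq_prod_map_map hU.aemeasurable
    (hy.mono hm le_rfl).aemeasurable).1 hi, hD]

/-- A function of an independent sample and of the past, centred given the past, is a noise. -/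
theorem isNoise_of_indep {Z X : Type*} [MeasurableSpace Z] [MeasurableSpace X] [BorelSpace E]
    [SecondCountableTopology E] [CompleteSpace E] {P : Measure Ω} [IsProbabilityMeasure P]
    {D : Measure Z} {U : Ω → Z} (hU : Measurable U) (hD : P.map U = D)
    (hI : Indep (MeasurableSpace.comap U inferInstance) m P) (hm : m ≤ mΩ) {s : Ω → X}
    (hs : Measurable[m] s) {N : Z × X → E} (hN : Measurable N) {b : X → ℝ} (hbm : Measurable b)
    (hL : ∀ a, MemLp (fun z => N (z, a)) 2 D) (h0 : ∀ a, ∫ z, N (z, a) ∂D = 0)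
    (hv : ∀ a, ∫ z, ‖N (z, a)‖ ^ 2 ∂D ≤ b a) (hb : Integrable (fun ω => b (s ω)) P) :
    IsNoise P m (fun ω => N (U ω, s ω)) (∫ ω, b (s ω) ∂P) := by
  have hDp : IsProbabilityMeasure D := hD ▸ Measure.isProbabilityMeasure_map hU.aemeasurable
  have hs' : Measurable s := hs.mono hm le_rfl
  have hps : IsProbabilityMeasure (P.map s) := Measure.isProbabilityMeasure_map hs'.aemeasurable
  have hNs : Measurable fun q : Z × X => ‖N q‖ ^ 2 := hN.norm.pow_const 2
  have hbs : Integrable b (P.map s) :=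
    (integrable_map_measure hbm.aestronglyMeasurable hs'.aemeasurable).2 hb
  -- By independence the pair (U, s) has a product law. Integrating over the sample first, with the
  -- past frozen, leaves the integrable bound `b`.
  have hint : Integrable (fun q : Z × X => ‖N q‖ ^ 2) (D.prod (P.map s)) := by
    rw [integrable_prod_iff' hNs.aestronglyMeasurable]
    refine ⟨ae_of_all _ fun a => memLp_sqInt (hL a), ?_⟩
    refine hbs.mono' ?_ (ae_of_all _ fun a => ?_)
    · exact hNs.norm.aestronglyMeasurable.prod_swap.integral_prod_right'
    · simp only [norm_pow, norm_norm]
      rw [Real.norm_of_nonneg (integral_nonneg fun _ => by positivity)]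
      exact hv a
  have hmeas : Measurable fun ω => (U ω, s ω) := hU.prodMk hs'
  have hn : MemLp (fun ω => N (U ω, s ω)) 2 P := by
    have hc : Measurable fun ω => N (U ω, s ω) := hN.comp hmeas
    rw [memLp_two_iff_integrable_sq_norm hc.aestronglyMeasurable]
    rw [← map_prod_of_indep hU hD hI hm hs, integrable_map_measure hNs.aestronglyMeasurable hmeas.aemeasurable] at hint
    exact hint
  refine ⟨hn, ?_, ?_⟩
  · calc ∫ ω, ‖N (U ω, s ω)‖ ^ 2 ∂P = ∫ q, ‖N q‖ ^ 2 ∂(D.prod (P.map s)) := by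
          rw [← map_prod_of_indep hU hD hI hm hs, integral_map hmeas.aemeasurable hNs.aestronglyMeasurable]
      _ = ∫ a, ∫ z, ‖N (z, a)‖ ^ 2 ∂D ∂(P.map s) := integral_prod_symm _ hint
      _ ≤ ∫ a, b a ∂(P.map s) := integral_mono hint.integral_prod_right hbs hv
      _ = _ := integral_map hs'.aemeasurable hbm.aestronglyMeasurable
  · intro A hA hAL
    -- Now `A` joins `s` as a frozen past variable; the inner integral over the sample vanishes by
    -- centering.
    have hy : Measurable[m] fun ω => (A ω, s ω) := hA.prodMk hs
    have hme : Measurable fun ω => (U ω, (A ω, s ω)) := hU.prodMk (hy.mono hm le_rfl)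
    have hf : Measurable fun q : Z × (E × X) => ⟪q.2.1, N (q.1, q.2.2)⟫ :=
      measurable_snd.fst.inner (hN.comp (measurable_fst.prodMk measurable_snd.snd))
    have hi := integrable_inner_of_memLp hAL hn
    have hi2 : Integrable (fun q : Z × (E × X) => ⟪q.2.1, N (q.1, q.2.2)⟫)
        (D.prod (P.map fun ω => (A ω, s ω))) := by
      rw [← map_prod_of_indep hU hD hI hm hy, integrable_map_measure hf.aestronglyMeasurable hme.aemeasurable]
      exact hi
    have hpy : IsProbabilityMeasure (P.map fun ω => (A ω, s ω)) :=
      Measure.isProbabilityMeasure_map (hy.mono hm le_rfl).aemeasurable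
    calc ∫ ω, ⟪A ω, N (U ω, s ω)⟫ ∂P
        = ∫ q : Z × (E × X), ⟪q.2.1, N (q.1, q.2.2)⟫ ∂(D.prod (P.map fun ω => (A ω, s ω))) := by
          rw [← map_prod_of_indep hU hD hI hm hy, integral_map hme.aemeasurable hf.aestronglyMeasurable]
      _ = ∫ y : E × X, ∫ z, ⟪y.1, N (z, y.2)⟫ ∂D ∂(P.map fun ω => (A ω, s ω)) :=
          integral_prod_symm _ hi2
      _ = 0 := by
          rw [← integral_zero (E × X) ℝ (μ := P.map fun ω => (A ω, s ω))]
          congr 1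
          ext y
          rw [integral_inner ((hL y.2).integrable one_le_two), h0, inner_zero_right]

end Noise

/-! ### Square integrability of Lipschitz functions of adapted variables. -/

section SquareIntegrable

variable {Ω : Type*} {m : MeasurableSpace Ω} {mΩ : MeasurableSpace Ω} {E : Type*}
  [NormedAddCommGroup E] [MeasurableSpace E]

/-- `a` is `m`-measurable and square integrable. -/
structure SqM (P : Measure Ω) (m : MeasurableSpace Ω) (a : Ω → E) : Prop where
  meas : Measurable[m] a
  memLp : MemLp a 2 P

variable {P : Measure Ω}

theorem SqM.int {a : Ω → E} (h : SqM P m a) : Integrable (fun ω => ‖a ω‖ ^ 2) P :=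
  memLp_sqInt h.memLp

variable [BorelSpace E]

theorem SqM.smul [NormedSpace ℝ E] {a : Ω → E} (ha : SqM P m a) (c : ℝ) :
    SqM P m fun ω => c • a ω :=
  ⟨ha.meas.const_smul c, ha.memLp.const_smul c⟩

theorem SqM.add [SecondCountableTopology E] {a b : Ω → E} (ha : SqM P m a) (hb : SqM P m b) :
    SqM P m fun ω => a ω + b ω :=
  ⟨ha.meas.add hb.meas, ha.memLp.add hb.memLp⟩

theorem SqM.sub [SecondCountableTopology E] {a b : Ω → E} (ha : SqM P m a) (hb : SqM P m b) :
    SqM P m fun ω => a ω - b ω :=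
  ⟨ha.meas.sub hb.meas, ha.memLp.sub hb.memLp⟩

variable {F : Type*} [NormedAddCommGroup F] [MeasurableSpace F] [BorelSpace F]
  [SecondCountableTopology F] [IsProbabilityMeasure P]

theorem SqM.of_norm_le {a b : Ω → ℝ} {f : Ω → F} (hm : m ≤ mΩ) (hf : Measurable[m] f)
    {r L : ℝ} (ha : MemLp a 2 P) (hb : MemLp b 2 P) (h : ∀ ω, ‖f ω‖ ≤ r + L * (a ω + b ω)) :
    SqM P m f := by
  refine ⟨hf, ?_⟩
  have : MemLp (fun ω => r + L * (a ω + b ω)) 2 P :=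
    (memLp_const r).add ((ha.add hb).const_mul L)
  exact this.mono (hf.mono hm le_rfl).aestronglyMeasurable
    (ae_of_all _ fun ω => (h ω).trans (le_abs_self _))

theorem SqM.comp_lip {T : E → F} {L : ℝ} (hm : m ≤ mΩ) (hT : ∀ a b, ‖T a - T b‖ ≤ L * ‖a - b‖)
    {a : Ω → E} (ha : SqM P m a) : SqM P m fun ω => T (a ω) := by
  have hc : Continuous T := by
    rw [continuous_iff_continuousAt]
    intro q
    rw [ContinuousAt, tendsto_iff_norm_sub_tendsto_zero]
    have hc : Tendsto (fun p => L * ‖p - q‖) (𝓝 q) (𝓝 (L * ‖q - q‖)) := by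
      apply Continuous.tendsto
      fun_prop
    simp only [sub_self, norm_zero, mul_zero] at hc
    exact squeeze_zero (fun _ => norm_nonneg _) (fun p => hT _ _) hc
  refine SqM.of_norm_le (a := fun ω => ‖a ω‖) (b := fun _ => 0) (r := ‖T 0‖) (L := L) hm
    (hc.measurable.comp ha.meas) ha.memLp.norm (memLp_const _) fun ω => ?_
  have h1 := hT (a ω) 0
  have h2 := norm_sub_norm_le (T (a ω)) (T 0)
  rw [sub_zero] at h1
  linarith

theorem SqM.comp_lip₂ {dx dy : ℕ} {T : Vec dx → Vec dy → F} {L : ℝ} (hm : m ≤ mΩ)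
    (hT : ∀ x x' y y', ‖T x y - T x' y'‖ ≤ L * (‖x - x'‖ + ‖y - y'‖))
    {x : Ω → Vec dx} {y : Ω → Vec dy} (hx : SqM P m x) (hy : SqM P m y) :
    SqM P m fun ω => T (x ω) (y ω) := by
  refine SqM.of_norm_le (a := fun ω => ‖x ω‖) (b := fun ω => ‖y ω‖) (r := ‖T 0 0‖) (L := L)
    hm ((continuous_uncurry_of_norm_sub_le hT).measurable.comp (hx.meas.prodMk hy.meas))
    hx.memLp.norm hy.memLp.norm fun ω => ?_
  have h1 := hT (x ω) 0 (y ω) 0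
  have h2 := norm_sub_norm_le (T (x ω) (y ω)) (T 0 0)
  rw [sub_zero, sub_zero] at h1
  linarith

theorem measurable_clm_apply {X : Type*} {mX : MeasurableSpace X} {d d' : ℕ}
    {A : X → Vec d →L[ℝ] Vec d'} {u : X → Vec d} (hA : Measurable A) (hu : Measurable u) :
    Measurable fun a => A a (u a) :=
  (isBoundedBilinearMap_apply (𝕜 := ℝ) (E := Vec d) (F := Vec d')).continuous.measurable.comp
    (hA.prodMk hu)

theorem SqM.clm_apply {dx dy d' : ℕ} {T : Vec dx → Vec dy → Vec dy →L[ℝ] Vec d'} {L ℓ : ℝ}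
    (hm : m ≤ mΩ) (hT : ∀ x x' y y', ‖T x y - T x' y'‖ ≤ L * (‖x - x'‖ + ‖y - y'‖))
    (hb : ∀ x y, ‖T x y‖ ≤ ℓ) {x : Ω → Vec dx} {y u : Ω → Vec dy} (hx : SqM P m x) (hy : SqM P m y)
    (hu : SqM P m u) : SqM P m fun ω => T (x ω) (y ω) (u ω) := by
  refine SqM.of_norm_le (a := fun ω => ‖u ω‖) (b := fun _ => 0) (r := 0) (L := ℓ)
    hm (measurable_clm_apply ((continuous_uncurry_of_norm_sub_le hT).measurable.comp
      (hx.meas.prodMk hy.meas)) hu.meas) hu.memLp.norm (memLp_const _) fun ω => ?_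
  rw [add_zero, zero_add]
  exact (T (x ω) (y ω)).le_of_opNorm_le (hb _ _) _

end SquareIntegrable

namespace Problem.Regular

variable {dx dy : ℕ} {Zf Zg : Type*} [MeasurableSpace Zf] [MeasurableSpace Zg]
  {B : Problem dx dy Zf Zg} {ℓf ℓg : ℝ≥0} {μg σ : ℝ}
  {Ω : Type*} {m : MeasurableSpace Ω} {mΩ : MeasurableSpace Ω} {P : Measure Ω}
  [IsProbabilityMeasure P]

theorem sqM_gradY_g (R : B.Regular ℓf ℓg μg σ) (hm : m ≤ mΩ) {x : Ω → Vec dx} {y : Ω → Vec dy}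
    (hx : SqM P m x) (hy : SqM P m y) : SqM P m fun ω => gradY B.g (x ω) (y ω) :=
  SqM.comp_lip₂ hm (R.lip_gradY_g.norm_sub_le) hx hy

theorem sqM_hyperDir (R : B.Regular ℓf ℓg μg σ) (hm : m ≤ mΩ) {x : Ω → Vec dx}
    {y u : Ω → Vec dy} (hx : SqM P m x) (hy : SqM P m y) (hu : SqM P m u) :
    SqM P m fun ω => hyperDir B.f B.g (x ω) (y ω) (u ω) :=
  (SqM.comp_lip₂ hm R.gradX_f_lip hx hy).add
    (SqM.clm_apply hm R.lip_hessXY_g.norm_sub_le R.norm_hessXY_le hx hy hu)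

theorem sqM_hessYY (R : B.Regular ℓf ℓg μg σ) (hm : m ≤ mΩ) {x : Ω → Vec dx}
    {y u : Ω → Vec dy} (hx : SqM P m x) (hy : SqM P m y) (hu : SqM P m u) :
    SqM P m fun ω => hessYY B.g (x ω) (y ω) (u ω) :=
  SqM.clm_apply hm R.lip_hessYY_g.norm_sub_le R.norm_hessYY_le hx hy hu

theorem sqM_residual (R : B.Regular ℓf ℓg μg σ) (hm : m ≤ mΩ) {x : Ω → Vec dx}
    {y u : Ω → Vec dy} (hx : SqM P m x) (hy : SqM P m y) (hu : SqM P m u) :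
    SqM P m fun ω => residual B.f B.g (x ω) (y ω) (u ω) :=
  (SqM.comp_lip₂ hm R.gradY_f_lip hx hy).add (R.sqM_hessYY hm hx hy hu)

theorem sqM_yStar (R : B.Regular ℓf ℓg μg σ) (hμ : 0 < μg) (hm : m ≤ mΩ) {x : Ω → Vec dx}
    (hx : SqM P m x) : SqM P m fun ω => B.yStar (x ω) :=
  SqM.comp_lip hm (R.yStar_lip hμ) hx

theorem sqM_uStar (R : B.Regular ℓf ℓg μg σ) (hμ : 0 < μg) (hm : m ≤ mΩ) {x : Ω → Vec dx}
    {y : Ω → Vec dy} (hx : SqM P m x) (hy : SqM P m y) : SqM P m fun ω => B.uStar (x ω) (y ω) :=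
  SqM.comp_lip₂ hm (R.uStar_lip hμ) hx hy

theorem sqM_hyperGrad (R : B.Regular ℓf ℓg μg σ) (hμ : 0 < μg) (hm : m ≤ mΩ) {x : Ω → Vec dx}
    (hx : SqM P m x) : SqM P m fun ω => B.hyperGrad (x ω) :=
  SqM.comp_lip hm (R.hyperGrad_lip hμ) hx

end Problem.Regular

/-! ### Unbiased oracles evaluated at past points are noises. -/

section Estimator

variable {dx dy : ℕ} {Z : Type*} [MeasurableSpace Z] {D : Measure Z}

theorem IsUnbiasedEstimator.map {E F : Type*} [NormedAddCommGroup E] [NormedSpace ℝ E]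
    [CompleteSpace E] [MeasurableSpace E] [BorelSpace E] [NormedAddCommGroup F] [NormedSpace ℝ F]
    [CompleteSpace F] [MeasurableSpace F] [BorelSpace F] [IsProbabilityMeasure D]
    {O : Z → Vec dx → Vec dy → E} {T : Vec dx → Vec dy → E} {σ : ℝ}
    (h : IsUnbiasedEstimator D O T σ) (π : E →L[ℝ] F) (hπ : ∀ v, ‖π v‖ ≤ ‖v‖) :
    IsUnbiasedEstimator D (fun z x y => π (O z x y)) (fun x y => π (T x y)) σ where
  measurable := π.continuous.measurable.comp h.measurable
  memLp x y := π.comp_memLp' (h.memLp x y)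
  unbiased x y := by
    rw [ContinuousLinearMap.integral_comp_comm _ ((h.memLp x y).integrable one_le_two),
      h.unbiased]
  variance x y := by
    refine le_trans (integral_mono ?_ ?_ fun z => ?_) (h.variance x y)
    · exact memLp_sqInt ((π.comp_memLp' (h.memLp x y)).sub (memLp_const _))
    · exact memLp_sqInt ((h.memLp x y).sub (memLp_const _))
    · simp only [← map_sub]
      exact pow_le_pow_left₀ (norm_nonneg _) (hπ _) 2

theorem IsUnbiasedEstimator.measurable_mean {E : Type*} [NormedAddCommGroup E] [NormedSpace ℝ E]
    [MeasurableSpace E] [BorelSpace E] [SecondCountableTopology E] [SFinite D]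
    {O : Z → Vec dx → Vec dy → E} {T : Vec dx → Vec dy → E} {σ : ℝ}
    (h : IsUnbiasedEstimator D O T σ) : Measurable fun q : Vec dx × Vec dy => T q.1 q.2 := by
  have := (h.measurable.stronglyMeasurable.integral_prod_left' (μ := D)).measurable
  simpa only [h.unbiased] using this

variable {Ω : Type*} {m : MeasurableSpace Ω} {mΩ : MeasurableSpace Ω} {P : Measure Ω}
  [IsProbabilityMeasure P]

theorem IsUnbiasedEstimator.isNoise {E : Type*} [NormedAddCommGroup E] [InnerProductSpace ℝ E]
    [MeasurableSpace E] [BorelSpace E] [SecondCountableTopology E] [CompleteSpace E]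
    {O : Z → Vec dx → Vec dy → E} {T : Vec dx → Vec dy → E} {σ : ℝ}
    (h : IsUnbiasedEstimator D O T σ) {U : Ω → Z} (hU : Measurable U) (hD : P.map U = D)
    (hI : Indep (MeasurableSpace.comap U inferInstance) m P) (hm : m ≤ mΩ) {x : Ω → Vec dx}
    {y : Ω → Vec dy} (hx : Measurable[m] x) (hy : Measurable[m] y) :
    IsNoise P m (fun ω => O (U ω) (x ω) (y ω) - T (x ω) (y ω)) (σ ^ 2) := by
  have : IsProbabilityMeasure D := hD ▸ Measure.isProbabilityMeasure_map hU.aemeasurable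
  have hi : ∀ a : Vec dx × Vec dy, Integrable (fun z => O z a.1 a.2) D := fun a =>
    (h.memLp a.1 a.2).integrable one_le_two
  have := isNoise_of_indep (s := fun ω => (x ω, y ω)) (b := fun _ => σ ^ 2)
    (N := fun q : Z × (Vec dx × Vec dy) => O q.1 q.2.1 q.2.2 - T q.2.1 q.2.2) hU hD hI hm
    (hx.prodMk hy) (h.measurable.sub (h.measurable_mean.comp measurable_snd)) measurable_const
    (fun a => (h.memLp a.1 a.2).sub (memLp_const (T a.1 a.2)))
    (fun a => by
      dsimp only
      rw [integral_sub (hi a) (integrable_const _), h.unbiased]; simp)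
    (fun a => h.variance a.1 a.2) (integrable_const _)
  simpa using this

/-- With (x, y, u) frozen the conditional second moment is at most σ²‖u‖², which is why the noise
level of SOBA involves the second moment of `y₂`. -/
theorem IsUnbiasedEstimator.isNoise_apply {d' : ℕ}
    {O : Z → Vec dx → Vec dy → (Vec dy →L[ℝ] Vec d')} {T : Vec dx → Vec dy → (Vec dy →L[ℝ] Vec d')}
    {σ : ℝ} (h : IsUnbiasedEstimator D O T σ) {U : Ω → Z} (hU : Measurable U) (hD : P.map U = D)
    (hI : Indep (MeasurableSpace.comap U inferInstance) m P) (hm : m ≤ mΩ) {x : Ω → Vec dx}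
    {y u : Ω → Vec dy} (hx : Measurable[m] x) (hy : Measurable[m] y) (hu : SqM P m u) :
    IsNoise P m (fun ω => (O (U ω) (x ω) (y ω) - T (x ω) (y ω)) (u ω))
      (σ ^ 2 * ∫ ω, ‖u ω‖ ^ 2 ∂P) := by
  have : IsProbabilityMeasure D := hD ▸ Measure.isProbabilityMeasure_map hU.aemeasurable
  have hi : ∀ a : Vec dx × Vec dy × Vec dy, MemLp (fun z => O z a.1 a.2.1 - T a.1 a.2.1) 2 D :=
    fun a => (h.memLp a.1 a.2.1).sub (memLp_const _)
  have hi2 : ∀ a : Vec dx × Vec dy × Vec dy,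
      MemLp (fun z => (O z a.1 a.2.1 - T a.1 a.2.1) a.2.2) 2 D := fun a =>
    (ContinuousLinearMap.apply ℝ (Vec d') a.2.2).comp_memLp' (hi a)
  have := isNoise_of_indep (s := fun ω => (x ω, y ω, u ω)) (b := fun a => σ ^ 2 * ‖a.2.2‖ ^ 2)
    (N := fun q : Z × (Vec dx × Vec dy × Vec dy) =>
      (O q.1 q.2.1 q.2.2.1 - T q.2.1 q.2.2.1) q.2.2.2) hU hD hI hm
    (hx.prodMk (hy.prodMk hu.meas))
    (measurable_clm_apply ((h.measurable.comp (measurable_fst.prodMk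
      (measurable_snd.fst.prodMk measurable_snd.snd.fst))).sub (h.measurable_mean.comp
        (measurable_snd.fst.prodMk measurable_snd.snd.fst))) measurable_snd.snd.snd)
    (by fun_prop)
    hi2
    (fun a => by
      have e := ContinuousLinearMap.integral_apply ((hi a).integrable one_le_two) a.2.2
      rw [← e, integral_sub ((h.memLp a.1 a.2.1).integrable one_le_two) (integrable_const _),
        h.unbiased]
      simp)
    (fun a => by
      calc _ ≤ ∫ z, ‖O z a.1 a.2.1 - T a.1 a.2.1‖ ^ 2 * ‖a.2.2‖ ^ 2 ∂D :=
            integral_mono (memLp_sqInt (hi2 a)) ((memLp_sqInt (hi a)).mul_const _) fun z => by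
              simp only [← mul_pow]
              exact pow_le_pow_left₀ (norm_nonneg _) (ContinuousLinearMap.le_opNorm _ _) 2
        _ ≤ _ := by
            rw [integral_mul_const]
            exact mul_le_mul_of_nonneg_right (h.variance _ _) (sq_nonneg _))
    (hu.int.const_mul _)
  rwa [integral_const_mul] at this

end Estimator

/-! ### The filtration generated by the initial point and the samples. -/

section Past

variable {dx dy : ℕ} {Zf Zg Ω : Type*} [MeasurableSpace Zf] [MeasurableSpace Zg]

/-- The σ-algebra generated by the initial point and the samples drawn before time `k`. -/
abbrev past (S : Samples Ω Zf Zg) (x₀ : Ω → Vec dx) (y₁₀ y₂₀ : Ω → Vec dy) (k : ℕ) :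
    MeasurableSpace Ω :=
  MeasurableSpace.comap (fun ω => ((x₀ ω, y₁₀ ω, y₂₀ ω), fun j : Fin k => S.at j ω)) inferInstance

variable {S : Samples Ω Zf Zg} {x₀ : Ω → Vec dx} {y₁₀ y₂₀ : Ω → Vec dy}

theorem measurable_past_init (k : ℕ) :
    Measurable[past S x₀ y₁₀ y₂₀ k] fun ω => (x₀ ω, y₁₀ ω, y₂₀ ω) :=
  measurable_fst.comp (comap_measurable _)

theorem measurable_past_at {j k : ℕ} (h : j < k) : Measurable[past S x₀ y₁₀ y₂₀ k] (S.at j) := by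
  have h1 : Measurable fun q : (Vec dx × Vec dy × Vec dy) × (Fin k → Zf × Zf × Zg × Zg × Zg) =>
      q.2 ⟨j, h⟩ := (measurable_pi_apply _).comp measurable_snd
  exact h1.comp (comap_measurable fun ω => ((x₀ ω, y₁₀ ω, y₂₀ ω), fun j : Fin k => S.at j ω))

theorem past_mono (k : ℕ) : past S x₀ y₁₀ y₂₀ k ≤ past S x₀ y₁₀ y₂₀ (k + 1) := by
  have : Measurable[past S x₀ y₁₀ y₂₀ (k + 1)]
      (fun ω => ((x₀ ω, y₁₀ ω, y₂₀ ω), fun j : Fin k => S.at j ω)) := by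
    refine (measurable_past_init (k + 1)).prodMk ?_
    exact @measurable_pi_lambda _ _ _ (_) _ _ fun j => measurable_past_at (j.2.trans k.lt_succ_self)
  exact this.comap_le

variable [MeasurableSpace Ω] {B : Problem dx dy Zf Zg} {P : Measure Ω}

theorem IsSampling.past_le (h : IsSampling B P S x₀ y₁₀ y₂₀) (k : ℕ) :
    past S x₀ y₁₀ y₂₀ k ≤ ‹MeasurableSpace Ω› := by
  have : Measurable (fun ω => ((x₀ ω, y₁₀ ω, y₂₀ ω), fun j : Fin k => S.at j ω)) :=
    (h.meas_x₀.prodMk (h.meas_y₁₀.prodMk h.meas_y₂₀)).prodMk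
      (measurable_pi_iff.2 fun j => h.meas j)
  exact this.comap_le

/-- A component of the sample of time `k` is measurable, independent of the past, and has the
corresponding marginal law. -/
theorem IsSampling.component (h : IsSampling B P S x₀ y₁₀ y₂₀) (k : ℕ) {Z : Type*}
    [MeasurableSpace Z] {D : Measure Z} {π : Zf × Zf × Zg × Zg × Zg → Z}
    (hπ : MeasurePreserving π (B.Df.prod (B.Df.prod (B.Dg.prod (B.Dg.prod B.Dg)))) D) :
    Measurable (fun ω => π (S.at k ω)) ∧ P.map (fun ω => π (S.at k ω)) = D ∧
    Indep (MeasurableSpace.comap (fun ω => π (S.at k ω)) inferInstance)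
      (past S x₀ y₁₀ y₂₀ k) P := by
  refine ⟨hπ.measurable.comp (h.meas k), ?_, ?_⟩
  · rw [← hπ.map_eq, ← h.law k, Measure.map_map hπ.measurable (h.meas k)]
    rfl
  · have hi := h.indep k
    rw [IndepFun_iff_Indep] at hi
    refine indep_of_indep_of_le_left hi ?_
    exact (hπ.measurable.comp (comap_measurable (S.at k))).comap_le

end Past

/-! ### Moving averages, and the SOBA step as mean direction plus noise. -/

/-- The sequence of moving averages of `a`, started at `a 0`. -/
def smooth {Ω E : Type*} [AddCommGroup E] [Module ℝ E] (τ : ℕ → ℝ) (a : ℕ → Ω → E) :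
    ℕ → Ω → E
  | 0 => a 0
  | k + 1 => fun ω => smooth τ a k ω + τ k • (a k ω - smooth τ a k ω)

theorem measurable_sub_smul {Ω : Type*} {m : MeasurableSpace Ω} {d : ℕ} {a b : Ω → Vec d} (c : ℝ)
    (ha : Measurable a) (hb : Measurable b) : Measurable fun ω => a ω - c • b ω :=
  ha.sub (hb.const_smul c)

theorem IsUnbiasedEstimator.measurable_comp {dx dy : ℕ} {Z E Ω : Type*} [MeasurableSpace Z]
    [NormedAddCommGroup E] [NormedSpace ℝ E] [MeasurableSpace E] {D : Measure Z}
    {O : Z → Vec dx → Vec dy → E} {T : Vec dx → Vec dy → E} {σ : ℝ}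
    (h : IsUnbiasedEstimator D O T σ) {m : MeasurableSpace Ω} {U : Ω → Z} {x : Ω → Vec dx}
    {y : Ω → Vec dy} (hU : Measurable U) (hx : Measurable x) (hy : Measurable y) :
    Measurable fun ω => O (U ω) (x ω) (y ω) :=
  h.measurable.comp (hU.prodMk (hx.prodMk hy))

theorem memLp_sub_smul_add {Ω : Type*} {m : MeasurableSpace Ω} {P : Measure Ω} {d : ℕ}
    {a b n : Ω → Vec d} (c : ℝ) (ha : MemLp a 2 P) (hb : MemLp b 2 P) (hn : MemLp n 2 P) :
    MemLp (fun ω => a ω - c • (b ω + n ω)) 2 P :=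
  ha.sub ((hb.add hn).const_smul c)

section Run

variable {dx dy : ℕ} {Zf Zg Ω : Type*} [MeasurableSpace Zf] [MeasurableSpace Zg]
  {B : Problem dx dy Zf Zg} {ℓf ℓg : ℝ≥0} {μg σ : ℝ}
  {S : Samples Ω Zf Zg} {x₀ : Ω → Vec dx} {y₁₀ y₂₀ : Ω → Vec dy} {α β₁ β₂ : ℕ → ℝ}
  {x : ℕ → Ω → Vec dx} {y₁ y₂ : ℕ → Ω → Vec dy}

theorem Problem.Regular.est_gradX_f (R : B.Regular ℓf ℓg μg σ) :
    IsUnbiasedEstimator B.Df (fun ζ => gradX (B.fS ζ)) (gradX B.f) σ :=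
  have := R.prob_f
  R.est_grad_f.map ((ContinuousLinearMap.fst ℝ (Vec dx) (Vec dy)).comp
    (WithLp.prodContinuousLinearEquiv 2 ℝ (Vec dx) (Vec dy)).toContinuousLinearMap)
    (fun v => norm_fst_le v)

theorem Problem.Regular.est_gradY_f (R : B.Regular ℓf ℓg μg σ) :
    IsUnbiasedEstimator B.Df (fun ζ => gradY (B.fS ζ)) (gradY B.f) σ :=
  have := R.prob_f
  R.est_grad_f.map ((ContinuousLinearMap.snd ℝ (Vec dx) (Vec dy)).comp
    (WithLp.prodContinuousLinearEquiv 2 ℝ (Vec dx) (Vec dy)).toContinuousLinearMap)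
    (fun v => norm_snd_le v)

theorem IsSOBA.measurable (h : IsSOBA B S x₀ y₁₀ y₂₀ α β₁ β₂ x y₁ y₂)
    (R : B.Regular ℓf ℓg μg σ) (k : ℕ) :
    Measurable[past S x₀ y₁₀ y₂₀ k] (x k) ∧ Measurable[past S x₀ y₁₀ y₂₀ k] (y₁ k) ∧
      Measurable[past S x₀ y₁₀ y₂₀ k] (y₂ k) := by
  induction k with
  | zero =>
    have := measurable_past_init (S := S) (x₀ := x₀) (y₁₀ := y₁₀) (y₂₀ := y₂₀) 0
    rw [h.init_x, h.init_y₁, h.init_y₂]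
    exact ⟨this.fst, this.snd.fst, this.snd.snd⟩
  | succ k ih =>
    have hx := ih.1.mono (past_mono k) le_rfl
    have hy := ih.2.1.mono (past_mono k) le_rfl
    have hu := ih.2.2.mono (past_mono k) le_rfl
    have hS : Measurable[past S x₀ y₁₀ y₂₀ (k + 1)] (S.at k) := measurable_past_at k.lt_succ_self
    have h1 : Measurable[past S x₀ y₁₀ y₂₀ (k + 1)] (S.ζ₀ k) := hS.fst
    have h2 : Measurable[past S x₀ y₁₀ y₂₀ (k + 1)] (S.ζ₂ k) := hS.snd.fst
    have h3 : Measurable[past S x₀ y₁₀ y₂₀ (k + 1)] (S.φ₀ k) := hS.snd.snd.fst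
    have h4 : Measurable[past S x₀ y₁₀ y₂₀ (k + 1)] (S.φ₁ k) := hS.snd.snd.snd.fst
    have h5 : Measurable[past S x₀ y₁₀ y₂₀ (k + 1)] (S.φ₂ k) := hS.snd.snd.snd.snd
    generalize past S x₀ y₁₀ y₂₀ (k + 1) = m at *
    refine ⟨?_, ?_, ?_⟩
    · rw [funext (h.step_x k)]
      exact measurable_sub_smul _ hx ((R.est_gradX_f.measurable_comp h1 hx hy).add
        (measurable_clm_apply (R.est_hessXY_g.measurable_comp h3 hx hy) hu))
    · rw [funext (h.step_y₁ k)]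
      exact measurable_sub_smul _ hy (R.est_gradY_g.measurable_comp h4 hx hy)
    · rw [funext (h.step_y₂ k)]
      exact measurable_sub_smul _ hu ((R.est_gradY_f.measurable_comp h2 hx hy).add
        (measurable_clm_apply (R.est_hessYY_g.measurable_comp h5 hx hy) hu))

variable [MeasurableSpace Ω] {P : Measure Ω}

/-- One step of SOBA in terms of the mean directions and of noises independent of the past `m`. -/
structure NoisyStep (B : Problem dx dy Zf Zg) (P : Measure Ω) (σ : ℝ) (m : MeasurableSpace Ω)
    (α β₁ β₂ : ℝ) (x x' : Ω → Vec dx) (y y' u u' : Ω → Vec dy) (n₀ : Ω → Vec dx)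
    (n₁ n₂ : Ω → Vec dy) : Prop where
  noise₀ : IsNoise P m n₀ (2 * σ ^ 2 + 2 * (σ ^ 2 * ∫ ω, ‖u ω‖ ^ 2 ∂P))
  noise₁ : IsNoise P m n₁ (σ ^ 2)
  noise₂ : IsNoise P m n₂ (2 * σ ^ 2 + 2 * (σ ^ 2 * ∫ ω, ‖u ω‖ ^ 2 ∂P))
  step_x : ∀ ω, x' ω = x ω - α • (hyperDir B.f B.g (x ω) (y ω) (u ω) + n₀ ω)
  step_y : ∀ ω, y' ω = y ω - β₁ • (gradY B.g (x ω) (y ω) + n₁ ω)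
  step_u : ∀ ω, u' ω = u ω - β₂ • (residual B.f B.g (x ω) (y ω) (u ω) + n₂ ω)

/-- The average at time k + 1 uses `a` only up to time k. This lag keeps the fresh noise out of the
targets. -/
theorem sqM_smooth {d : ℕ} {a : ℕ → Ω → Vec d} (τ : ℕ → ℝ)
    (h : ∀ k, SqM P (past S x₀ y₁₀ y₂₀ k) (a k)) (k : ℕ) :
    SqM P (past S x₀ y₁₀ y₂₀ k) (smooth τ a k) := by
  induction k with
  | zero => exact h 0
  | succ k ih =>
    have h1 := ih.add (((h k).sub ih).smul (τ k))
    exact ⟨h1.meas.mono (past_mono k) le_rfl, h1.memLp⟩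

variable [IsProbabilityMeasure P]

theorem IsSOBA.exists_noisyStep (h : IsSOBA B S x₀ y₁₀ y₂₀ α β₁ β₂ x y₁ y₂)
    (R : B.Regular ℓf ℓg μg σ) (hS : IsSampling B P S x₀ y₁₀ y₂₀) {k : ℕ}
    (hx : Measurable[past S x₀ y₁₀ y₂₀ k] (x k)) (hy : Measurable[past S x₀ y₁₀ y₂₀ k] (y₁ k))
    (hu : SqM P (past S x₀ y₁₀ y₂₀ k) (y₂ k)) :
    ∃ n₀ n₁ n₂, NoisyStep B P σ (past S x₀ y₁₀ y₂₀ k) (α k) (β₁ k) (β₂ k) (x k) (x (k + 1))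
      (y₁ k) (y₁ (k + 1)) (y₂ k) (y₂ (k + 1)) n₀ n₁ n₂ := by
  have := R.prob_f
  have := R.prob_g
  have hm := hS.past_le k
  -- The letters a, b, c, d, e refer to `ζ₀`, `ζ₂`, `φ₀`, `φ₁`, `φ₂`, extracted from the nested
  -- product in that order.
  obtain ⟨a1, a2, a3⟩ := hS.component k (measurePreserving_fst (μ := B.Df)
    (ν := B.Df.prod (B.Dg.prod (B.Dg.prod B.Dg))))
  have p1 := measurePreserving_snd (μ := B.Df) (ν := B.Df.prod (B.Dg.prod (B.Dg.prod B.Dg)))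
  obtain ⟨b1, b2, b3⟩ := hS.component k ((measurePreserving_fst (μ := B.Df)
    (ν := B.Dg.prod (B.Dg.prod B.Dg))).comp p1)
  have p2 := (measurePreserving_snd (μ := B.Df) (ν := B.Dg.prod (B.Dg.prod B.Dg))).comp p1
  obtain ⟨c1, c2, c3⟩ := hS.component k ((measurePreserving_fst (μ := B.Dg)
    (ν := B.Dg.prod B.Dg)).comp p2)
  have p3 := (measurePreserving_snd (μ := B.Dg) (ν := B.Dg.prod B.Dg)).comp p2
  obtain ⟨d1, d2, d3⟩ := hS.component k ((measurePreserving_fst (μ := B.Dg) (ν := B.Dg)).comp p3)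
  obtain ⟨e1, e2, e3⟩ := hS.component k ((measurePreserving_snd (μ := B.Dg) (ν := B.Dg)).comp p3)
  refine ⟨_, _, _, (R.est_gradX_f.isNoise a1 a2 a3 hm hx hy).add
      (R.est_hessXY_g.isNoise_apply c1 c2 c3 hm hx hy hu),
    R.est_gradY_g.isNoise d1 d2 d3 hm hx hy,
    (R.est_gradY_f.isNoise b1 b2 b3 hm hx hy).add
      (R.est_hessYY_g.isNoise_apply e1 e2 e3 hm hx hy hu), fun ω => ?_, fun ω => ?_, fun ω => ?_⟩
  · rw [h.step_x k ω, _root_.sub_apply, hyperDir]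
    congr 2
    simp only [Samples.at, Function.comp]
    abel
  · rw [h.step_y₁ k ω]
    congr 2
    simp only [Samples.at, Function.comp]
    abel
  · rw [h.step_y₂ k ω, _root_.sub_apply, residual]
    congr 2
    simp only [Samples.at, Function.comp]
    abel

/-- Square integrability must be propagated in time together with the noise representation, since
the matrix noises at time k are square integrable only through that of `y₂ k`. -/
theorem IsSOBA.sqM (h : IsSOBA B S x₀ y₁₀ y₂₀ α β₁ β₂ x y₁ y₂)
    (R : B.Regular ℓf ℓg μg σ) (hS : IsSampling B P S x₀ y₁₀ y₂₀) (k : ℕ) :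
    SqM P (past S x₀ y₁₀ y₂₀ k) (x k) ∧ SqM P (past S x₀ y₁₀ y₂₀ k) (y₁ k) ∧
      SqM P (past S x₀ y₁₀ y₂₀ k) (y₂ k) := by
  have hm := h.measurable R
  suffices hL : MemLp (x k) 2 P ∧ MemLp (y₁ k) 2 P ∧ MemLp (y₂ k) 2 P from
    ⟨⟨(hm k).1, hL.1⟩, ⟨(hm k).2.1, hL.2.1⟩, ⟨(hm k).2.2, hL.2.2⟩⟩
  induction k with
  | zero =>
    rw [h.init_x, h.init_y₁, h.init_y₂]
    exact ⟨hS.memLp_x₀, hS.memLp_y₁₀, hS.memLp_y₂₀⟩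
  | succ k ih =>
    have hx : SqM P (past S x₀ y₁₀ y₂₀ k) (x k) := ⟨(hm k).1, ih.1⟩
    have hy : SqM P (past S x₀ y₁₀ y₂₀ k) (y₁ k) := ⟨(hm k).2.1, ih.2.1⟩
    have hu : SqM P (past S x₀ y₁₀ y₂₀ k) (y₂ k) := ⟨(hm k).2.2, ih.2.2⟩
    obtain ⟨n₀, n₁, n₂, hN⟩ := h.exists_noisyStep R hS hx.meas hy.meas hu
    rw [funext hN.step_x, funext hN.step_y, funext hN.step_u]
    exact ⟨memLp_sub_smul_add _ ih.1 (R.sqM_hyperDir (hS.past_le k) hx hy hu).memLp hN.noise₀.memLp,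
      memLp_sub_smul_add _ ih.2.1 (R.sqM_gradY_g (hS.past_le k) hx hy).memLp hN.noise₁.memLp,
      memLp_sub_smul_add _ ih.2.2 (R.sqM_residual (hS.past_le k) hx hy hu).memLp hN.noise₂.memLp⟩

end Run

/-! ### The norm inequalities in expectation, with noise. -/

section ExpectedSteps

variable {Ω : Type*} {m : MeasurableSpace Ω} {mΩ : MeasurableSpace Ω} {P : Measure Ω} {d : ℕ}

theorem integral_smooth_step_le {D v n : Ω → Vec d} {b τ a : ℝ} (hD : SqM P m D) (hv : SqM P m v)
    (hn : IsNoise P m n b) (hτ : 0 < τ) (hτ1 : τ ≤ 1) :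
    ∫ ω, ‖((1 - τ) • D ω - a • v ω) - a • n ω‖ ^ 2 ∂P
      ≤ (1 - τ) * ∫ ω, ‖D ω‖ ^ 2 ∂P + a ^ 2 / τ * ∫ ω, ‖v ω‖ ^ 2 ∂P + a ^ 2 * b := by
  have hs := (hD.smul (1 - τ)).sub (hv.smul a)
  refine (hn.integral_sq_sub hs.meas hs.memLp a).trans (add_le_add_left ?_ _)
  rw [← integral_const_mul, ← integral_const_mul,
    ← integral_add (hD.int.const_mul _) (hv.int.const_mul _)]
  exact integral_mono hs.int ((hD.int.const_mul _).add (hv.int.const_mul _))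
    fun ω => sq_norm_smooth_step hτ hτ1

theorem integral_contract_le {e a r n : Ω → Vec d} {b μ ℓ β : ℝ} (he : SqM P m e) (ha : SqM P m a)
    (hr : SqM P m r) (hn : IsNoise P m n b) (hμ : 0 < μ) (hβ : 0 < β) (hβ1 : β ≤ 1)
    (hℓ : 4 * β * ℓ ^ 2 ≤ μ) (hae : ∀ ω, μ * ‖e ω‖ ^ 2 ≤ inner ℝ (a ω) (e ω))
    (hal : ∀ ω, ‖a ω‖ ≤ ℓ * ‖e ω‖) :
    ∫ ω, ‖(e ω - β • (a ω + r ω)) - β • n ω‖ ^ 2 ∂P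
      ≤ (1 - μ * β) * ∫ ω, ‖e ω‖ ^ 2 ∂P + β * ((2 / μ + 2) * ∫ ω, ‖r ω‖ ^ 2 ∂P)
        + β ^ 2 * b := by
  have hs := he.sub ((ha.add hr).smul β)
  refine (hn.integral_sq_sub hs.meas hs.memLp β).trans (add_le_add_left ?_ _)
  rw [← integral_const_mul, ← integral_const_mul, ← integral_const_mul,
    ← integral_add (he.int.const_mul _) ((hr.int.const_mul _).const_mul _)]
  exact integral_mono hs.int ((he.int.const_mul _).add ((hr.int.const_mul _).const_mul _))
    fun ω => sq_norm_contract hμ hβ hβ1 hℓ (hae ω) (hal ω)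

end ExpectedSteps

/-! ### Moments of a run, the one-step inequalities and their constants. -/

/-- The moments entering the Lyapunov function: the mean objective, the second moments of the
hypergradient and of the mean direction, and the second moments of the tracking errors. -/
structure Moments where
  F : ℝ
  G : ℝ
  V : ℝ
  E₁ : ℝ
  D : ℝ
  E₂ : ℝ
  Q : ℝ

/-- The moments at `(x, y, u)`, with moving averages `z, q` of `x` and `w` of `y`. -/
def moments {dx dy : ℕ} {Zf Zg Ω : Type*} [MeasurableSpace Zf] [MeasurableSpace Zg]
    [MeasurableSpace Ω] (B : Problem dx dy Zf Zg) (P : Measure Ω) (x : Ω → Vec dx)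
    (y u : Ω → Vec dy) (z q : Ω → Vec dx) (w : Ω → Vec dy) : Moments where
  F := ∫ ω, B.F (x ω) ∂P
  G := ∫ ω, ‖B.hyperGrad (x ω)‖ ^ 2 ∂P
  V := ∫ ω, ‖hyperDir B.f B.g (x ω) (y ω) (u ω)‖ ^ 2 ∂P
  E₁ := ∫ ω, ‖y ω - B.yStar (z ω)‖ ^ 2 ∂P
  D := ∫ ω, ‖x ω - z ω‖ ^ 2 ∂P
  E₂ := ∫ ω, ‖u ω - B.uStar (q ω) (w ω)‖ ^ 2 ∂P
  Q := ∫ ω, ‖x ω - q ω‖ ^ 2 ∂P + ∫ ω, ‖y ω - w ω‖ ^ 2 ∂P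

/-- The inequalities between the moments before and after one step. -/
structure StepBound (C μ α β₁ β₂ : ℝ) (s s' : Moments) : Prop where
  F : s'.F ≤ s.F - α / 2 * s.G - α / 4 * s.V + C * α * (s.E₁ + s.D + s.E₂ + s.Q)
    + C * α ^ 2 * (1 + s.E₂)
  D : s'.D ≤ (1 - β₁) * s.D + α ^ 2 / β₁ * s.V + C * α ^ 2 * (1 + s.E₂)
  Q : s'.Q ≤ (1 - β₂) * s.Q + α ^ 2 / β₂ * s.V + β₁ ^ 2 / β₂ * (C * (s.E₁ + s.D))
    + C * α ^ 2 * (1 + s.E₂) + C * β₁ ^ 2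
  E₁ : s'.E₁ ≤ (1 - μ * β₁) * s.E₁ + C * β₁ * s.D + C * β₁ ^ 2
  E₂ : s'.E₂ ≤ (1 - μ * β₂) * s.E₂ + C * β₂ * s.Q + C * β₂ ^ 2 * (1 + s.E₂)

/-- A constant for the bias of the hypergradient estimate. -/
def biasConst (ℓf ℓg μ : ℝ) : ℝ :=
  5 * (Problem.lipDir ℓf ℓg μ * (1 + ℓg / μ) + ℓg * (1 + Problem.lipU ℓf ℓg μ)) ^ 2

/-- A constant for the noise variances. -/
def noiseConst (ℓf μ σ : ℝ) : ℝ := 4 * σ ^ 2 * (1 + (ℓf / μ) ^ 2)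

/-- A constant for all the inequalities of one step. -/
def stepConst (ℓf ℓg μ σ : ℝ) : ℝ :=
  1 + biasConst ℓf ℓg μ + 2 * (ℓg * (1 + ℓg / μ)) ^ 2
    + (2 / μ + 2) * (ℓg + ℓg / μ) ^ 2 + (2 / μ + 2) * (2 * ((ℓg + 1) * Problem.lipU ℓf ℓg μ) ^ 2)
    + noiseConst ℓf μ σ + Problem.lipF ℓf ℓg μ * noiseConst ℓf μ σ
    + 4 * Problem.lipF ℓf ℓg μ + 4 * ℓg ^ 2 / μ

theorem lipU_nonneg (ℓf ℓg : ℝ≥0) {μ : ℝ} (hμ : 0 < μ) : 0 ≤ Problem.lipU ℓf ℓg μ := by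
  unfold Problem.lipU; positivity

theorem lipDir_nonneg (ℓf ℓg : ℝ≥0) {μ : ℝ} (hμ : 0 < μ) : 0 ≤ Problem.lipDir ℓf ℓg μ := by
  have := lipU_nonneg ℓf ℓg hμ
  unfold Problem.lipDir; positivity

theorem lipF_nonneg (ℓf ℓg : ℝ≥0) {μ : ℝ} (hμ : 0 < μ) : 0 ≤ Problem.lipF ℓf ℓg μ := by
  have := lipDir_nonneg ℓf ℓg hμ
  unfold Problem.lipF; positivity

theorem noiseConst_nonneg (ℓf μ σ : ℝ) : 0 ≤ noiseConst ℓf μ σ := by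
  unfold noiseConst; positivity

theorem biasConst_nonneg (ℓf ℓg μ : ℝ) : 0 ≤ biasConst ℓf ℓg μ := by
  unfold biasConst; positivity

theorem stepConst_bounds (ℓf ℓg : ℝ≥0) {μ : ℝ} (hμ : 0 < μ) (σ : ℝ) :
    1 ≤ stepConst ℓf ℓg μ σ ∧ biasConst ℓf ℓg μ ≤ stepConst ℓf ℓg μ σ ∧
    2 * (ℓg * (1 + ℓg / μ)) ^ 2 ≤ stepConst ℓf ℓg μ σ ∧
    (2 / μ + 2) * (ℓg + ℓg / μ) ^ 2 ≤ stepConst ℓf ℓg μ σ ∧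
    (2 / μ + 2) * (2 * ((ℓg + 1) * Problem.lipU ℓf ℓg μ) ^ 2) ≤ stepConst ℓf ℓg μ σ ∧
    noiseConst ℓf μ σ ≤ stepConst ℓf ℓg μ σ ∧
    Problem.lipF ℓf ℓg μ * noiseConst ℓf μ σ ≤ stepConst ℓf ℓg μ σ ∧
    4 * Problem.lipF ℓf ℓg μ ≤ stepConst ℓf ℓg μ σ ∧ 4 * ℓg ^ 2 / μ ≤ stepConst ℓf ℓg μ σ := by
  have h1 := biasConst_nonneg ℓf ℓg μ
  have h2 : 0 ≤ 2 * (ℓg * (1 + ℓg / μ)) ^ 2 := by positivity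
  have h3 : 0 ≤ (2 / μ + 2) * (ℓg + ℓg / μ) ^ 2 := by positivity
  have h4 : 0 ≤ (2 / μ + 2) * (2 * ((ℓg + 1) * Problem.lipU ℓf ℓg μ) ^ 2) := by positivity
  have h5 := noiseConst_nonneg ℓf μ σ
  have h6 := lipF_nonneg ℓf ℓg hμ
  have h7 := mul_nonneg h6 h5
  have h8 : 0 ≤ 4 * (ℓg : ℝ) ^ 2 / μ := by positivity
  unfold stepConst
  refine ⟨?_, ?_, ?_, ?_, ?_, ?_, ?_, ?_, ?_⟩ <;> linarith

/-! ### Proof of the one-step inequalities. -/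

section OneStep

variable {dx dy : ℕ} {Zf Zg Ω : Type*} [MeasurableSpace Zf] [MeasurableSpace Zg]
  {m : MeasurableSpace Ω} [mΩ : MeasurableSpace Ω] {B : Problem dx dy Zf Zg} {ℓf ℓg : ℝ≥0}
  {μg σ : ℝ} {P : Measure Ω} [IsProbabilityMeasure P]

theorem sq_le_of_le_mul_add₅ {t K a b c d e : ℝ} (ht : 0 ≤ t)
    (h : t ≤ K * (a + b + c + d + e)) :
    t ^ 2 ≤ 5 * K ^ 2 * (a ^ 2 + b ^ 2 + c ^ 2 + d ^ 2 + e ^ 2) := by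
  have h1 := pow_le_pow_left₀ ht h 2
  have h2 : (a + b + c + d + e) ^ 2 ≤ 5 * (a ^ 2 + b ^ 2 + c ^ 2 + d ^ 2 + e ^ 2) := by
    linarith [sq_nonneg (a - b), sq_nonneg (a - c), sq_nonneg (a - d), sq_nonneg (a - e),
      sq_nonneg (b - c), sq_nonneg (b - d), sq_nonneg (b - e), sq_nonneg (c - d),
      sq_nonneg (c - e), sq_nonneg (d - e)]
  rw [mul_pow] at h1
  linarith [mul_le_mul_of_nonneg_left h2 (sq_nonneg K)]

theorem sq_le_of_le_mul_add {t K a b : ℝ} (ht : 0 ≤ t) (h : t ≤ K * (a + b)) :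
    t ^ 2 ≤ 2 * K ^ 2 * (a ^ 2 + b ^ 2) := by
  have h1 := pow_le_pow_left₀ ht h 2
  have h2 : (a + b) ^ 2 ≤ 2 * (a ^ 2 + b ^ 2) := by linarith [sq_nonneg (a - b)]
  rw [mul_pow] at h1
  linarith [mul_le_mul_of_nonneg_left h2 (sq_nonneg K)]

namespace Problem.Regular

theorem norm_sub_yStar_le (R : B.Regular ℓf ℓg μg σ) (hμ : 0 < μg) (x z : Vec dx) (y : Vec dy) :
    ‖y - B.yStar x‖ ≤ ‖y - B.yStar z‖ + ℓg / μg * ‖x - z‖ := by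
  have e : y - B.yStar x = (y - B.yStar z) - (B.yStar x - B.yStar z) := by abel
  rw [e]
  exact (norm_sub_le _ _).trans (add_le_add_right (R.yStar_lip hμ x z) _)

theorem sq_bias_le (R : B.Regular ℓf ℓg μg σ) (hμ : 0 < μg) (x z q : Vec dx) (y u w : Vec dy) :
    ‖hyperDir B.f B.g x y u - B.hyperGrad x‖ ^ 2 ≤ biasConst ℓf ℓg μg *
      (‖y - B.yStar z‖ ^ 2 + ‖x - z‖ ^ 2 + ‖u - B.uStar q w‖ ^ 2 + ‖x - q‖ ^ 2 + ‖y - w‖ ^ 2) := by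
  refine sq_le_of_le_mul_add₅ (norm_nonneg _) ((R.hyperDir_error_le hμ x q y u w).trans ?_)
  have h0 := lipDir_nonneg ℓf ℓg hμ
  have h1 := lipU_nonneg ℓf ℓg hμ
  have h2 := mul_le_mul_of_nonneg_left (R.norm_sub_yStar_le hμ x z y) h0
  have h3 : 0 ≤ (ℓg : ℝ) / μg := by positivity
  generalize (ℓg : ℝ) / μg = r at *
  generalize Problem.lipDir ℓf ℓg μg = p at *
  generalize Problem.lipU ℓf ℓg μg = s at *
  have ha := norm_nonneg (y - B.yStar z)
  have hb := norm_nonneg (x - z)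
  have hc := norm_nonneg (u - B.uStar q w)
  have hd := norm_nonneg (x - q)
  have he := norm_nonneg (y - w)
  generalize ‖y - B.yStar z‖ = a at *
  generalize ‖x - z‖ = b at *
  generalize ‖u - B.uStar q w‖ = c at *
  generalize ‖x - q‖ = d at *
  generalize ‖y - w‖ = e at *
  have hg := ℓg.2
  change 0 ≤ (ℓg : ℝ) at hg
  generalize (ℓg : ℝ) = g at *
  have t1 : 0 ≤ p * r * (a + c + d + e) + p * (b + c + d + e) := by positivity
  have t2 : 0 ≤ g * (a + b + d + e) + g * s * (a + b + c) := by positivity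
  linarith

theorem sq_gradY_g_le (R : B.Regular ℓf ℓg μg σ) (hμ : 0 < μg) (x z : Vec dx) (y : Vec dy) :
    ‖gradY B.g x y‖ ^ 2 ≤ 2 * (ℓg * (1 + ℓg / μg)) ^ 2 *
      (‖y - B.yStar z‖ ^ 2 + ‖x - z‖ ^ 2) := by
  refine sq_le_of_le_mul_add (norm_nonneg _) ?_
  have h1 := R.lip_gradY_g.norm_sub_le x x y (B.yStar x)
  rw [R.gradY_yStar hμ, sub_zero, sub_self, norm_zero, zero_add] at h1
  refine h1.trans ?_
  rw [mul_assoc]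
  refine mul_le_mul_of_nonneg_left ((R.norm_sub_yStar_le hμ x z y).trans ?_) ℓg.2
  have h3 : 0 ≤ (ℓg : ℝ) / μg := by positivity
  have := mul_nonneg h3 (norm_nonneg (y - B.yStar z))
  linarith [norm_nonneg (x - z)]

/-- A function with Lipschitz gradient grows at most quadratically. -/
theorem integrable_F (R : B.Regular ℓf ℓg μg σ) (hμ : 0 < μg) {x : Ω → Vec dx} (hm : m ≤ mΩ)
    (hx : SqM P m x) : Integrable (fun ω => B.F (x ω)) P := by
  have hd : Differentiable ℝ B.F := fun a => (R.hasGradientAt_F hμ a).differentiableAt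
  have hL := lipF_nonneg ℓf ℓg hμ
  have i0 := hx.int.const_mul (lipF ℓf ℓg μg + 1)
  have i1 : Integrable (fun ω => |B.F 0| + ‖B.hyperGrad 0‖ ^ 2
      + (lipF ℓf ℓg μg + 1) * ‖x ω‖ ^ 2) P := (integrable_const _).add i0
  refine i1.mono' ((hd.continuous.measurable.comp (hx.meas.mono hm le_rfl)).aestronglyMeasurable)
    (ae_of_all _ fun ω => ?_)
  have h1 := le_of_lipschitz_gradient hL (R.hasGradientAt_F hμ) (R.hyperGrad_lip hμ) 0 (x ω)
  rw [zero_add] at h1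
  have h2 := abs_real_inner_le_norm (B.hyperGrad 0) (x ω)
  have e : B.F (x ω) = (B.F (x ω) - B.F 0 - inner ℝ (B.hyperGrad 0) (x ω)) + B.F 0
    + inner ℝ (B.hyperGrad 0) (x ω) := by ring
  rw [Real.norm_eq_abs, e]
  refine (abs_add_three _ _ _).trans ?_
  nlinarith [sq_nonneg (‖B.hyperGrad 0‖ - ‖x ω‖), sq_nonneg ‖B.hyperGrad 0‖, sq_nonneg ‖x ω‖]

end Problem.Regular

variable {α β₁ β₂ : ℝ} {x x' : Ω → Vec dx} {y y' u u' : Ω → Vec dy} {n₀ : Ω → Vec dx}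
  {n₁ n₂ : Ω → Vec dy} {z q : Ω → Vec dx} {w : Ω → Vec dy}

/-- The noise variances are controlled by the tracking error of the linear system. -/
theorem Problem.Regular.variance_le (R : B.Regular ℓf ℓg μg σ) (hμ : 0 < μg) (hm : m ≤ mΩ)
    (hu : SqM P m u) (hq : SqM P m q) (hw : SqM P m w) :
    2 * σ ^ 2 + 2 * (σ ^ 2 * ∫ ω, ‖u ω‖ ^ 2 ∂P)
      ≤ noiseConst ℓf μg σ * (1 + ∫ ω, ‖u ω - B.uStar (q ω) (w ω)‖ ^ 2 ∂P) := by
  have he := hu.sub (R.sqM_uStar hμ hm hq hw)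
  have h1 : ∫ ω, ‖u ω‖ ^ 2 ∂P ≤ 2 * ∫ ω, ‖u ω - B.uStar (q ω) (w ω)‖ ^ 2 ∂P
      + 2 * (ℓf / μg) ^ 2 := by
    have h2 : ∀ ω, ‖u ω‖ ^ 2 ≤ 2 * ‖u ω - B.uStar (q ω) (w ω)‖ ^ 2 + 2 * (ℓf / μg) ^ 2 := by
      intro ω
      have h3 := sq_norm_add_le (u ω - B.uStar (q ω) (w ω)) (B.uStar (q ω) (w ω))
      rw [sub_add_cancel] at h3
      have h4 := pow_le_pow_left₀ (norm_nonneg _) (R.norm_uStar_le hμ (q ω) (w ω)) 2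
      linarith
    calc _ ≤ ∫ ω, (2 * ‖u ω - B.uStar (q ω) (w ω)‖ ^ 2 + 2 * (ℓf / μg) ^ 2) ∂P :=
          integral_mono hu.int ((he.int.const_mul 2).add (integrable_const _)) h2
      _ = _ := by
          rw [integral_add (he.int.const_mul 2) (integrable_const _), integral_const_mul]
          simp
  have h5 := mul_le_mul_of_nonneg_left h1 (sq_nonneg σ)
  have h6 : 0 ≤ ∫ ω, ‖u ω - B.uStar (q ω) (w ω)‖ ^ 2 ∂P := integral_nonneg fun _ => by positivity
  rw [noiseConst]
  have h7 : 0 ≤ 4 * σ ^ 2 * (ℓf / μg) ^ 2 * ∫ ω, ‖u ω - B.uStar (q ω) (w ω)‖ ^ 2 ∂P := by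
    positivity
  nlinarith [sq_nonneg σ]

theorem Problem.Regular.integral_bias_le (R : B.Regular ℓf ℓg μg σ) (hμ : 0 < μg) (hm : m ≤ mΩ)
    (hx : SqM P m x) (hy : SqM P m y) (hu : SqM P m u) (hz : SqM P m z) (hq : SqM P m q)
    (hw : SqM P m w) :
    ∫ ω, ‖hyperDir B.f B.g (x ω) (y ω) (u ω) - B.hyperGrad (x ω)‖ ^ 2 ∂P
      ≤ biasConst ℓf ℓg μg * ((moments B P x y u z q w).E₁ + (moments B P x y u z q w).D
        + (moments B P x y u z q w).E₂ + (moments B P x y u z q w).Q) := by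
  have e1 := (hy.sub (R.sqM_yStar hμ hm hz)).int
  have e2 := (hx.sub hz).int
  have e3 := (hu.sub (R.sqM_uStar hμ hm hq hw)).int
  have e4 := (hx.sub hq).int
  have e5 := (hy.sub hw).int
  simp only [moments]
  rw [← add_assoc, ← integral_add e1 e2, ← integral_add (e1.fun_add e2) e3,
    ← integral_add ((e1.fun_add e2).fun_add e3) e4, ← integral_add (((e1.fun_add e2).fun_add e3).fun_add e4) e5,
    ← integral_const_mul]
  exact integral_mono ((R.sqM_hyperDir hm hx hy hu).sub (R.sqM_hyperGrad hμ hm hx)).int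
    (((((e1.fun_add e2).fun_add e3).fun_add e4).fun_add e5).const_mul _)
    fun ω => R.sq_bias_le hμ (x ω) (z ω) (q ω) (y ω) (u ω) (w ω)

/-- Descent inequality with ⟨∇F, v⟩ polarized as (‖∇F‖² + ‖v‖² - ‖v - ∇F‖²)/2. Of the gain (α/2)V,
half absorbs the second-order term by the smallness of α; the other half is kept, to pay for the
motion of x in D and Q. -/
theorem NoisyStep.integral_F_le (hN : NoisyStep B P σ m α β₁ β₂ x x' y y' u u' n₀ n₁ n₂)
    (R : B.Regular ℓf ℓg μg σ) (hμ : 0 < μg) (hm : m ≤ mΩ) (hx : SqM P m x) (hy : SqM P m y)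
    (hu : SqM P m u) (hx' : SqM P mΩ x') (hα : 0 < α)
    (hα1 : 4 * Problem.lipF ℓf ℓg μg * α ≤ 1) :
    ∫ ω, B.F (x' ω) ∂P ≤ ∫ ω, B.F (x ω) ∂P - α / 2 * ∫ ω, ‖B.hyperGrad (x ω)‖ ^ 2 ∂P
      - α / 4 * ∫ ω, ‖hyperDir B.f B.g (x ω) (y ω) (u ω)‖ ^ 2 ∂P
      + α / 2 * ∫ ω, ‖hyperDir B.f B.g (x ω) (y ω) (u ω) - B.hyperGrad (x ω)‖ ^ 2 ∂P
      + Problem.lipF ℓf ℓg μg * α ^ 2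
        * (2 * σ ^ 2 + 2 * (σ ^ 2 * ∫ ω, ‖u ω‖ ^ 2 ∂P)) := by
  have hL := lipF_nonneg ℓf ℓg hμ
  have hv := R.sqM_hyperDir hm hx hy hu
  have hG := R.sqM_hyperGrad hμ hm hx
  have hF := R.integrable_F hμ hm hx
  have hb := hv.sub hG
  have hvn : MemLp (fun ω => hyperDir B.f B.g (x ω) (y ω) (u ω) - (-1 : ℝ) • n₀ ω) 2 P :=
    hv.memLp.sub (hN.noise₀.memLp.const_smul (-1 : ℝ))
  have h1 : ∀ ω, B.F (x' ω) ≤ B.F (x ω) - α / 2 * ‖B.hyperGrad (x ω)‖ ^ 2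
      - α / 2 * ‖hyperDir B.f B.g (x ω) (y ω) (u ω)‖ ^ 2
      + α / 2 * ‖hyperDir B.f B.g (x ω) (y ω) (u ω) - B.hyperGrad (x ω)‖ ^ 2
      - α * inner ℝ (B.hyperGrad (x ω)) (n₀ ω)
      + Problem.lipF ℓf ℓg μg * α ^ 2
        * ‖hyperDir B.f B.g (x ω) (y ω) (u ω) - (-1 : ℝ) • n₀ ω‖ ^ 2 := by
    intro ω
    have h2 := (abs_le.1 (le_of_lipschitz_gradient hL (R.hasGradientAt_F hμ) (R.hyperGrad_lip hμ)
      (x ω) (-(α • (hyperDir B.f B.g (x ω) (y ω) (u ω) + n₀ ω))))).2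
    rw [← sub_eq_add_neg, ← hN.step_x, inner_neg_right, inner_smul_right, inner_add_right,
      norm_neg, norm_smul, mul_pow, Real.norm_eq_abs, sq_abs] at h2
    have h3 := norm_sub_sq_real (hyperDir B.f B.g (x ω) (y ω) (u ω)) (B.hyperGrad (x ω))
    rw [real_inner_comm] at h3
    rw [h3, neg_one_smul, sub_neg_eq_add]
    linarith
  have i1 := hG.int.const_mul (α / 2)
  have i2 := hv.int.const_mul (α / 2)
  have i3 := hb.int.const_mul (α / 2)
  have i4 := (integrable_inner_of_memLp hG.memLp hN.noise₀.memLp).const_mul α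
  have i5 := (memLp_sqInt hvn).const_mul (Problem.lipF ℓf ℓg μg * α ^ 2)
  have j1 : Integrable (fun ω => B.F (x ω) - α / 2 * ‖B.hyperGrad (x ω)‖ ^ 2) P := hF.sub i1
  have j2 : Integrable (fun ω => B.F (x ω) - α / 2 * ‖B.hyperGrad (x ω)‖ ^ 2
      - α / 2 * ‖hyperDir B.f B.g (x ω) (y ω) (u ω)‖ ^ 2) P := j1.sub i2
  have j3 := j2.fun_add i3
  have j4 : Integrable (fun ω => B.F (x ω) - α / 2 * ‖B.hyperGrad (x ω)‖ ^ 2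
      - α / 2 * ‖hyperDir B.f B.g (x ω) (y ω) (u ω)‖ ^ 2
      + α / 2 * ‖hyperDir B.f B.g (x ω) (y ω) (u ω) - B.hyperGrad (x ω)‖ ^ 2
      - α * inner ℝ (B.hyperGrad (x ω)) (n₀ ω)) P := j3.sub i4
  have h4 := integral_mono (R.integrable_F hμ le_rfl hx') (j4.fun_add i5) h1
  rw [integral_add j4 i5, integral_sub j3 i4, integral_add j2 i3, integral_sub j1 i2,
    integral_sub hF i1, integral_const_mul, integral_const_mul, integral_const_mul,
    integral_const_mul, integral_const_mul, hN.noise₀.orth _ hG.meas hG.memLp] at h4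
  have h5 := hN.noise₀.integral_sq_sub hv.meas hv.memLp (-1)
  have h6 := mul_le_mul_of_nonneg_left h5 (mul_nonneg hL (sq_nonneg α))
  have hV : 0 ≤ ∫ ω, ‖hyperDir B.f B.g (x ω) (y ω) (u ω)‖ ^ 2 ∂P :=
    integral_nonneg fun _ => by positivity
  have h7 := mul_le_mul_of_nonneg_left hα1 (mul_nonneg hα.le hV)
  linarith

/-- The new gap is (1 - τ)(x - z) minus the noisy step. The weight is left general because the bound
serves both averages of x, with τ = β₁ and τ = β₂. -/
theorem NoisyStep.integral_D_le (hN : NoisyStep B P σ m α β₁ β₂ x x' y y' u u' n₀ n₁ n₂)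
    (R : B.Regular ℓf ℓg μg σ) (hm : m ≤ mΩ) (hx : SqM P m x) (hy : SqM P m y)
    (hu : SqM P m u) (hz : SqM P m z) {τ : ℝ} (hτ : 0 < τ) (hτ1 : τ ≤ 1) :
    ∫ ω, ‖x' ω - (z ω + τ • (x ω - z ω))‖ ^ 2 ∂P ≤ (1 - τ) * ∫ ω, ‖x ω - z ω‖ ^ 2 ∂P
      + α ^ 2 / τ * ∫ ω, ‖hyperDir B.f B.g (x ω) (y ω) (u ω)‖ ^ 2 ∂P
      + α ^ 2 * (2 * σ ^ 2 + 2 * (σ ^ 2 * ∫ ω, ‖u ω‖ ^ 2 ∂P)) := by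
  refine le_trans (le_of_eq ?_) (integral_smooth_step_le (a := α) (hx.sub hz)
    (R.sqM_hyperDir hm hx hy hu) hN.noise₀ hτ hτ1)
  congr 1
  ext ω
  rw [hN.step_x]
  congr 2
  module

theorem NoisyStep.integral_W_le (hN : NoisyStep B P σ m α β₁ β₂ x x' y y' u u' n₀ n₁ n₂)
    (R : B.Regular ℓf ℓg μg σ) (hμ : 0 < μg) (hm : m ≤ mΩ) (hx : SqM P m x) (hy : SqM P m y)
    (hz : SqM P m z) (hw : SqM P m w) {τ : ℝ} (hτ : 0 < τ) (hτ1 : τ ≤ 1) :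
    ∫ ω, ‖y' ω - (w ω + τ • (y ω - w ω))‖ ^ 2 ∂P ≤ (1 - τ) * ∫ ω, ‖y ω - w ω‖ ^ 2 ∂P
      + β₁ ^ 2 / τ * (2 * (ℓg * (1 + ℓg / μg)) ^ 2 *
        (∫ ω, ‖y ω - B.yStar (z ω)‖ ^ 2 ∂P + ∫ ω, ‖x ω - z ω‖ ^ 2 ∂P)) + β₁ ^ 2 * σ ^ 2 := by
  have e1 := (hy.sub (R.sqM_yStar hμ hm hz)).int
  have e2 := (hx.sub hz).int
  have h1 : ∫ ω, ‖gradY B.g (x ω) (y ω)‖ ^ 2 ∂P ≤ 2 * (ℓg * (1 + ℓg / μg)) ^ 2 *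
      (∫ ω, ‖y ω - B.yStar (z ω)‖ ^ 2 ∂P + ∫ ω, ‖x ω - z ω‖ ^ 2 ∂P) := by
    rw [← integral_add e1 e2, ← integral_const_mul]
    exact integral_mono (R.sqM_gradY_g hm hx hy).int ((e1.fun_add e2).const_mul _)
      fun ω => R.sq_gradY_g_le hμ (x ω) (z ω) (y ω)
  have h2 := mul_le_mul_of_nonneg_left h1 (div_nonneg (sq_nonneg β₁) hτ.le)
  refine le_trans (le_of_eq ?_) ((integral_smooth_step_le (a := β₁) (hy.sub hw)
    (R.sqM_gradY_g hm hx hy) hN.noise₁ hτ hτ1).trans (by linarith))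
  congr 1
  ext ω
  rw [hN.step_y]
  congr 2
  module

/-- The coercive field is ∇_y g(z, ·), which vanishes at y*(z). The perturbation collects the error
of evaluating at x instead of z and the motion of the target divided by β₁; since z moves by β₁(x -
z), both are of order ‖x - z‖. -/
theorem NoisyStep.integral_E₁_le (hN : NoisyStep B P σ m α β₁ β₂ x x' y y' u u' n₀ n₁ n₂)
    (R : B.Regular ℓf ℓg μg σ) (hμ : 0 < μg) (hm : m ≤ mΩ) (hx : SqM P m x) (hy : SqM P m y)
    (hz : SqM P m z) (hβ : 0 < β₁) (hβ1 : β₁ ≤ 1) (hℓ : 4 * β₁ * (ℓg : ℝ) ^ 2 ≤ μg) :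
    ∫ ω, ‖y' ω - B.yStar (z ω + β₁ • (x ω - z ω))‖ ^ 2 ∂P
      ≤ (1 - μg * β₁) * ∫ ω, ‖y ω - B.yStar (z ω)‖ ^ 2 ∂P
        + β₁ * ((2 / μg + 2) * (ℓg + ℓg / μg) ^ 2 * ∫ ω, ‖x ω - z ω‖ ^ 2 ∂P)
        + β₁ ^ 2 * σ ^ 2 := by
  have hz' := hz.add ((hx.sub hz).smul β₁)
  have hyz := R.sqM_yStar hμ hm hz
  have hr := ((R.sqM_gradY_g hm hx hy).sub (R.sqM_gradY_g hm hz hy)).add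
    (((R.sqM_yStar hμ hm hz').sub hyz).smul β₁⁻¹)
  have h1 := integral_contract_le (hy.sub hyz) (R.sqM_gradY_g hm hz hy) hr hN.noise₁ hμ hβ hβ1 hℓ
    (fun ω => by
      have := R.gradY_mono (z ω) (y ω) (B.yStar (z ω))
      rwa [R.gradY_yStar hμ, sub_zero] at this)
    (fun ω => by
      have := R.lip_gradY_g.norm_sub_le (z ω) (z ω) (y ω) (B.yStar (z ω))
      rwa [R.gradY_yStar hμ, sub_zero, sub_self, norm_zero, zero_add] at this)
  have h2 : ∀ ω, ‖gradY B.g (x ω) (y ω) - gradY B.g (z ω) (y ω)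
      + β₁⁻¹ • (B.yStar (z ω + β₁ • (x ω - z ω)) - B.yStar (z ω))‖ ^ 2
      ≤ (ℓg + ℓg / μg) ^ 2 * ‖x ω - z ω‖ ^ 2 := by
    intro ω
    rw [← mul_pow]
    refine pow_le_pow_left₀ (norm_nonneg _) ((norm_add_le _ _).trans ?_) 2
    rw [add_mul]
    refine add_le_add ?_ ?_
    · have := R.lip_gradY_g.norm_sub_le (x ω) (z ω) (y ω) (y ω)
      rwa [sub_self, norm_zero, add_zero] at this
    · have := R.yStar_lip hμ (z ω + β₁ • (x ω - z ω)) (z ω)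
      rw [add_sub_cancel_left, norm_smul, Real.norm_of_nonneg hβ.le] at this
      rw [norm_smul, Real.norm_of_nonneg (inv_nonneg.2 hβ.le), inv_mul_le_iff₀ hβ]
      linarith
  have h3 := integral_mono hr.int ((hx.sub hz).int.const_mul _) h2
  rw [integral_const_mul] at h3
  have h4 := mul_le_mul_of_nonneg_left h3 (mul_nonneg hβ.le (by positivity : 0 ≤ 2 / μg + 2))
  refine le_trans (le_of_eq ?_) (h1.trans (by linarith))
  congr 1
  ext ω
  rw [hN.step_y]
  congr 2
  simp only [smul_add, smul_sub, smul_inv_smul₀ hβ.ne']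
  abel

/-- The residual equals the Hessian at (x, y) applied to u - u*(x, y). Replacing u*(x, y) by u*(q,
w), and moving the latter to its next value, are perturbations of order ‖x - q‖ + ‖y - w‖. -/
theorem NoisyStep.integral_E₂_le (hN : NoisyStep B P σ m α β₁ β₂ x x' y y' u u' n₀ n₁ n₂)
    (R : B.Regular ℓf ℓg μg σ) (hμ : 0 < μg) (hm : m ≤ mΩ) (hx : SqM P m x) (hy : SqM P m y)
    (hu : SqM P m u) (hq : SqM P m q) (hw : SqM P m w) (hβ : 0 < β₂) (hβ1 : β₂ ≤ 1)
    (hℓ : 4 * β₂ * (ℓg : ℝ) ^ 2 ≤ μg) :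
    ∫ ω, ‖u' ω - B.uStar (q ω + β₂ • (x ω - q ω)) (w ω + β₂ • (y ω - w ω))‖ ^ 2 ∂P
      ≤ (1 - μg * β₂) * ∫ ω, ‖u ω - B.uStar (q ω) (w ω)‖ ^ 2 ∂P
        + β₂ * ((2 / μg + 2) * (2 * ((ℓg + 1) * Problem.lipU ℓf ℓg μg) ^ 2) *
          (∫ ω, ‖x ω - q ω‖ ^ 2 ∂P + ∫ ω, ‖y ω - w ω‖ ^ 2 ∂P))
        + β₂ ^ 2 * (2 * σ ^ 2 + 2 * (σ ^ 2 * ∫ ω, ‖u ω‖ ^ 2 ∂P)) := by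
  have hq' := hq.add ((hx.sub hq).smul β₂)
  have hw' := hw.add ((hy.sub hw).smul β₂)
  have hus := R.sqM_uStar hμ hm hq hw
  have he := hu.sub hus
  have hr := (R.sqM_hessYY hm hx hy (hus.sub (R.sqM_uStar hμ hm hx hy))).add
    (((R.sqM_uStar hμ hm hq' hw').sub hus).smul β₂⁻¹)
  have h1 := integral_contract_le he (R.sqM_hessYY hm hx hy he) hr hN.noise₂ hμ hβ hβ1 hℓ
    (fun ω => R.hessYY_coercive (x ω) (y ω) _)
    (fun ω => (hessYY B.g (x ω) (y ω)).le_of_opNorm_le (R.norm_hessYY_le _ _) _)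
  have h2 : ∀ ω, ‖hessYY B.g (x ω) (y ω) (B.uStar (q ω) (w ω) - B.uStar (x ω) (y ω))
      + β₂⁻¹ • (B.uStar (q ω + β₂ • (x ω - q ω)) (w ω + β₂ • (y ω - w ω))
        - B.uStar (q ω) (w ω))‖ ^ 2
      ≤ 2 * ((ℓg + 1) * Problem.lipU ℓf ℓg μg) ^ 2 * (‖x ω - q ω‖ ^ 2 + ‖y ω - w ω‖ ^ 2) := by
    intro ω
    refine sq_le_of_le_mul_add (norm_nonneg _) ((norm_add_le _ _).trans ?_)
    rw [add_mul, add_mul, one_mul]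
    refine add_le_add ?_ ?_
    · refine ((hessYY B.g (x ω) (y ω)).le_of_opNorm_le (R.norm_hessYY_le _ _) _).trans ?_
      rw [mul_assoc]
      refine mul_le_mul_of_nonneg_left ?_ ℓg.2
      rw [norm_sub_rev]
      exact R.uStar_lip hμ _ _ _ _
    · have := R.uStar_lip hμ (q ω + β₂ • (x ω - q ω)) (q ω) (w ω + β₂ • (y ω - w ω)) (w ω)
      rw [add_sub_cancel_left, add_sub_cancel_left, norm_smul, norm_smul,
        Real.norm_of_nonneg hβ.le] at this
      rw [norm_smul, Real.norm_of_nonneg (inv_nonneg.2 hβ.le), inv_mul_le_iff₀ hβ]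
      linarith
  have h3 := integral_mono hr.int (((hx.sub hq).int.fun_add (hy.sub hw).int).const_mul _) h2
  rw [integral_const_mul, integral_add (hx.sub hq).int (hy.sub hw).int] at h3
  have h4 := mul_le_mul_of_nonneg_left h3 (mul_nonneg hβ.le (by positivity : 0 ≤ 2 / μg + 2))
  refine le_trans (le_of_eq ?_) (h1.trans (by linarith))
  congr 1
  ext ω
  rw [hN.step_u, residual, ← neg_neg (gradY B.f (x ω) (y ω)), ← R.hessYY_uStar hμ]
  congr 2
  simp only [smul_add, smul_sub, smul_inv_smul₀ hβ.ne', map_sub, smul_neg]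
  abel

theorem NoisyStep.stepBound (hN : NoisyStep B P σ m α β₁ β₂ x x' y y' u u' n₀ n₁ n₂)
    (R : B.Regular ℓf ℓg μg σ) (hμ : 0 < μg) (hm : m ≤ mΩ) (hx : SqM P m x) (hy : SqM P m y)
    (hu : SqM P m u) (hz : SqM P m z) (hq : SqM P m q) (hw : SqM P m w) (hx' : SqM P mΩ x')
    (hα : 0 < α) (hβ₁ : 0 < β₁) (hβ₂ : 0 < β₂) (hα1 : stepConst ℓf ℓg μg σ * α ≤ 1)
    (hβ₁1 : stepConst ℓf ℓg μg σ * β₁ ≤ 1) (hβ₂1 : stepConst ℓf ℓg μg σ * β₂ ≤ 1) :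
    StepBound (stepConst ℓf ℓg μg σ) μg α β₁ β₂ (moments B P x y u z q w)
      (moments B P x' y' u' (fun ω => z ω + β₁ • (x ω - z ω)) (fun ω => q ω + β₂ • (x ω - q ω))
        (fun ω => w ω + β₂ • (y ω - w ω))) := by
  obtain ⟨c1, c2, c3, c4, c5, c6, c7, c8, c9⟩ := stepConst_bounds ℓf ℓg hμ σ
  have hσ : σ ^ 2 ≤ stepConst ℓf ℓg μg σ := by
    refine le_trans ?_ c6
    rw [noiseConst]
    have : 0 ≤ σ ^ 2 * (ℓf / μg) ^ 2 := by positivity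
    nlinarith [sq_nonneg σ]
  have hb := R.variance_le hμ hm hu hq hw
  have hL := lipF_nonneg ℓf ℓg hμ
  have hbias := R.integral_bias_le hμ hm hx hy hu hz hq hw
  have hE1 : 0 ≤ ∫ ω, ‖y ω - B.yStar (z ω)‖ ^ 2 ∂P := integral_nonneg fun _ => by positivity
  have hE2 : 0 ≤ ∫ ω, ‖u ω - B.uStar (q ω) (w ω)‖ ^ 2 ∂P :=
    integral_nonneg fun _ => by positivity
  have hD : 0 ≤ ∫ ω, ‖x ω - z ω‖ ^ 2 ∂P := integral_nonneg fun _ => by positivity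
  have hQ1 : 0 ≤ ∫ ω, ‖x ω - q ω‖ ^ 2 ∂P := integral_nonneg fun _ => by positivity
  have hQ2 : 0 ≤ ∫ ω, ‖y ω - w ω‖ ^ 2 ∂P := integral_nonneg fun _ => by positivity
  -- The summands 1 and 4ℓg²/μ of `stepConst` are there for these two conditions.
  have small : ∀ {β : ℝ}, 0 < β → stepConst ℓf ℓg μg σ * β ≤ 1 → β ≤ 1 ∧
      4 * β * (ℓg : ℝ) ^ 2 ≤ μg := by
    intro β h0 h1
    refine ⟨(le_mul_of_one_le_left h0.le c1).trans h1, ?_⟩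
    have h2 := (mul_le_mul_of_nonneg_right c9 h0.le).trans h1
    rw [div_mul_eq_mul_div, div_le_one hμ] at h2
    linarith
  obtain ⟨s1, s2⟩ := small hβ₁ hβ₁1
  obtain ⟨s3, s4⟩ := small hβ₂ hβ₂1
  have hF := hN.integral_F_le R hμ hm hx hy hu hx' hα
    ((mul_le_mul_of_nonneg_right c8 hα.le).trans hα1)
  have hDz := hN.integral_D_le R hm hx hy hu hz hβ₁ s1
  have hDq := hN.integral_D_le R hm hx hy hu hq hβ₂ s3
  have hW := hN.integral_W_le R hμ hm hx hy hz hw hβ₂ s3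
  have hE₁ := hN.integral_E₁_le R hμ hm hx hy hz hβ₁ s1 s2
  have hE₂ := hN.integral_E₂_le R hμ hm hx hy hu hq hw hβ₂ s3 s4
  simp only [moments] at hbias
  generalize stepConst ℓf ℓg μg σ = C at *
  have hC : 0 ≤ C := zero_le_one.trans c1
  have hbC := hb.trans (mul_le_mul_of_nonneg_right c6 (by linarith))
  refine ⟨?_, ?_, ?_, ?_, ?_⟩ <;> simp only [moments]
  · have t1 := mul_le_mul_of_nonneg_left
      (hbias.trans (mul_le_mul_of_nonneg_right c2 (by linarith))) hα.le
    have t2 := mul_le_mul_of_nonneg_left hb (mul_nonneg hL (sq_nonneg α))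
    have t3 := mul_le_mul_of_nonneg_right c7 (mul_nonneg (sq_nonneg α)
      (by linarith : 0 ≤ 1 + ∫ ω, ‖u ω - B.uStar (q ω) (w ω)‖ ^ 2 ∂P))
    have t4 : 0 ≤ C * α * (∫ ω, ‖y ω - B.yStar (z ω)‖ ^ 2 ∂P + ∫ ω, ‖x ω - z ω‖ ^ 2 ∂P
      + ∫ ω, ‖u ω - B.uStar (q ω) (w ω)‖ ^ 2 ∂P + (∫ ω, ‖x ω - q ω‖ ^ 2 ∂P
      + ∫ ω, ‖y ω - w ω‖ ^ 2 ∂P)) := by positivity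
    linarith
  · linarith [mul_le_mul_of_nonneg_left hbC (sq_nonneg α)]
  · have t1 := mul_le_mul_of_nonneg_left hbC (sq_nonneg α)
    have t2 := mul_le_mul_of_nonneg_left (mul_le_mul_of_nonneg_right c3 (add_nonneg hE1 hD))
      (div_nonneg (sq_nonneg β₁) hβ₂.le)
    have t3 := mul_le_mul_of_nonneg_right hσ (sq_nonneg β₁)
    linarith
  · have t1 := mul_le_mul_of_nonneg_left (mul_le_mul_of_nonneg_right c4 hD) hβ₁.le
    have t3 := mul_le_mul_of_nonneg_right hσ (sq_nonneg β₁)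
    linarith
  · have t1 := mul_le_mul_of_nonneg_left (mul_le_mul_of_nonneg_right c5 (add_nonneg hQ1 hQ2))
      hβ₂.le
    linarith [mul_le_mul_of_nonneg_left hbC (sq_nonneg β₂)]

end OneStep

/-! ### Choice of weights and decrease of the Lyapunov function. -/

section Lyapunov

/-- The second moments are nonnegative. -/
structure Moments.Nonneg (s : Moments) : Prop where
  G : 0 ≤ s.G
  V : 0 ≤ s.V
  E₁ : 0 ≤ s.E₁
  D : 0 ≤ s.D
  E₂ : 0 ≤ s.E₂
  Q : 0 ≤ s.Q

/-- The Lyapunov function with weights `a, b, c`. -/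
def Moments.lyap (a b c : ℝ) (s : Moments) : ℝ := s.F + a * s.E₁ + s.E₂ + b * s.Q + c * s.D

/-- The decrease of the Lyapunov function in one step. -/
theorem lyap_step {C μ M κ α β₁ β₂ a b c : ℝ} {s s' : Moments} (h : StepBound C μ α β₁ β₂ s s')
    (hs : s.Nonneg) (hC : 1 ≤ C) (hM : 0 < M) (hα : 0 < α)
    (hβ₁ : 0 < β₁) (hβ₂ : 0 < β₂) (hακ : α ≤ κ * β₁) (hβM : β₁ ≤ M * β₂) (ha : 0 ≤ a)
    (hb : b = C + 2) (ha' : a * μ = b * M * C + 2) (hc : c = a * C + b * M * C + 2)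
    (k0 : 0 < κ) (k1 : C * κ ≤ 1) (k2 : C * κ * M ≤ 1) (k3 : 8 * (C * κ * M) ≤ μ)
    (k4 : 4 * (κ * (b * M + c)) ≤ 1) (e1 : (1 + b + c) * α ≤ 1) (e2 : 4 * (C * β₂) ≤ μ) :
    s'.lyap a b c + α / 2 * s.G + β₁ * (s.E₁ + s.D) + μ / 2 * β₂ * s.E₂ + β₂ * s.Q
      ≤ s.lyap a b c + C * (1 + a + b + c) * (α ^ 2 + β₁ ^ 2 + β₂ ^ 2) := by
  have hC0 : 0 < C := by linarith
  have hb0 : 0 < b := by linarith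
  have hc0 : 0 < c := by rw [hc]; positivity
  have hακM : α ≤ κ * M * β₂ := by
    calc α ≤ κ * β₁ := hακ
      _ ≤ κ * (M * β₂) := by gcongr
      _ = _ := by ring
  -- The ratio conditions turn the quotients of the one-step bounds into multiples of a single step
  -- size.
  have r1 : α ^ 2 / β₁ ≤ κ * α := by
    rw [div_le_iff₀ hβ₁]; nlinarith
  have r2 : α ^ 2 / β₂ ≤ κ * M * α := by
    rw [div_le_iff₀ hβ₂]; nlinarith
  have r3 : β₁ ^ 2 / β₂ ≤ M * β₁ := by
    rw [div_le_iff₀ hβ₂]; nlinarith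
  have cα₁ : C * α ≤ β₁ := by
    calc C * α ≤ C * (κ * β₁) := by gcongr
      _ = (C * κ) * β₁ := by ring
      _ ≤ 1 * β₁ := by gcongr
      _ = β₁ := one_mul _
  have cα₂ : C * α ≤ C * κ * M * β₂ := by
    calc C * α ≤ C * (κ * M * β₂) := by gcongr
      _ = _ := by ring
  have cα₃ : C * α ≤ β₂ := cα₂.trans (by nlinarith)
  have cα₄ : 8 * (C * α) ≤ μ * β₂ := by nlinarith
  have t1 := mul_le_mul_of_nonneg_left h.E₁ ha
  have t3 := mul_le_mul_of_nonneg_left h.Q hb0.le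
  have t5 := mul_le_mul_of_nonneg_left h.D hc0.le
  have v1 := mul_le_mul_of_nonneg_left (mul_le_mul_of_nonneg_right r2 hs.V) hb0.le
  have v2 := mul_le_mul_of_nonneg_left (mul_le_mul_of_nonneg_right r1 hs.V) hc0.le
  have v3 := mul_le_mul_of_nonneg_left (mul_le_mul_of_nonneg_right r3
    (mul_nonneg hC0.le (add_nonneg hs.E₁ hs.D))) hb0.le
  -- The contributions of V to bQ and cD fit into the (α/4)V released by the descent of F.
  have v4 := mul_le_mul_of_nonneg_right k4 (mul_nonneg hα.le hs.V)
  -- Budget for E₂: of μβ₂E₂, the bias uses 1/8 (`x3`), the noise in `u` 1/4 (`x5`), and the noise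
  -- terms of size α² another 1/8 (`x4` with `x3`); one half remains.
  have x1 := mul_le_mul_of_nonneg_right cα₁ (add_nonneg hs.E₁ hs.D)
  have x2 := mul_le_mul_of_nonneg_right cα₃ hs.Q
  have x3 := mul_le_mul_of_nonneg_right cα₄ hs.E₂
  have x4 := mul_le_mul_of_nonneg_left e1 (mul_nonneg (mul_nonneg hC0.le hα.le) hs.E₂)
  have x5 := mul_le_mul_of_nonneg_right e2 (mul_nonneg hβ₂.le hs.E₂)
  -- Each weight cancels the inflow from the other errors; of the extra 2, one unit covers the bias
  -- in F and one is the decrease retained in the conclusion.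
  have y1 : a * (μ * β₁) * s.E₁ = (b * M * C + 2) * β₁ * s.E₁ := by rw [← ha']; ring
  have y2 : c * β₁ * s.D = (a * C + b * M * C + 2) * β₁ * s.D := by rw [hc]
  have y3 : b * β₂ * s.Q = (C + 2) * β₂ * s.Q := by rw [hb]
  have z1 : 0 ≤ C * (a + b) * α ^ 2 := by positivity
  have z2 : 0 ≤ C * (1 + c) * β₁ ^ 2 := by positivity
  have z3 : 0 ≤ C * (a + b + c) * β₂ ^ 2 := by positivity
  have z4 : 0 ≤ C * a * α ^ 2 := by positivity
  simp only [Moments.lyap]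
  linarith [h.F, h.E₂, mul_nonneg hβ₁.le hs.E₁, mul_nonneg hβ₁.le hs.D, mul_nonneg hβ₂.le hs.Q]

/-- `lyap a b c` decreases for step sizes at most `ε` with `α ≤ κ β₁` and `β₁ ≤ M β₂`. -/
def IsLyapunov (C μ M a b c κ ε A : ℝ) : Prop :=
  ∀ (α β₁ β₂ : ℝ) (s s' : Moments), StepBound C μ α β₁ β₂ s s' → s.Nonneg → 0 < α → 0 < β₁ →
    0 < β₂ → α ≤ ε → β₂ ≤ ε → α ≤ κ * β₁ → β₁ ≤ M * β₂ →
    s'.lyap a b c + α / 2 * s.G + β₁ * (s.E₁ + s.D) + μ / 2 * β₂ * s.E₂ + β₂ * s.Q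
      ≤ s.lyap a b c + A * (α ^ 2 + β₁ ^ 2 + β₂ ^ 2)

/-- Weights, ratio and step bound for which the Lyapunov function decreases. -/
theorem exists_lyapunov {C μ M : ℝ} (hC : 1 ≤ C) (hμ : 0 < μ) (hM : 0 < M) :
    ∃ a > 0, ∃ b > 0, ∃ c > 0, ∃ κ > 0, ∃ ε > 0, ∃ A ≥ 0, κ ≤ 1 ∧ κ * M ≤ 1 ∧ C * ε ≤ 1 ∧
      IsLyapunov C μ M a b c κ ε A := by
  have hC0 : 0 < C := by linarith
  -- The order b, a, c follows the coupling: Q feeds E₂, then E₁ feeds Q, then D feeds E₁ and Q. The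
  -- ratio κ is chosen only after all weights.
  obtain ⟨b, hb⟩ : ∃ b, b = C + 2 := ⟨_, rfl⟩
  have hb0 : 0 < b := by linarith
  obtain ⟨a, ha⟩ : ∃ a, a = (b * M * C + 2) / μ := ⟨_, rfl⟩
  have ha0 : 0 < a := by rw [ha]; positivity
  obtain ⟨c, hc⟩ : ∃ c, c = a * C + b * M * C + 2 := ⟨_, rfl⟩
  have hc0 : 0 < c := by rw [hc]; positivity
  -- Each summand is the coefficient of κ in one requirement, so κ = 1/T meets them all; `U` plays
  -- the same role for the step bound ε.
  obtain ⟨T, hT⟩ : ∃ T, T = 1 + M + C + C * M + 8 * (C * M) / μ + 4 * (b * M + c) := ⟨_, rfl⟩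
  have hCM : 0 < C * M := by positivity
  have hCMμ : 0 < 8 * (C * M) / μ := by positivity
  have hbM : 0 < 4 * (b * M + c) := by positivity
  have hT0 : 0 < T := by linarith
  obtain ⟨U, hU⟩ : ∃ U, U = C + (1 + b + c) + 4 * C / μ := ⟨_, rfl⟩
  have hCμ : 0 < 4 * C / μ := by positivity
  have hU0 : 0 < U := by linarith
  have kT : ∀ {t : ℝ}, t ≤ T → t * T⁻¹ ≤ 1 := fun ht => by
    rw [← div_eq_mul_inv]; exact (div_le_one hT0).2 ht
  have kU : ∀ {t e : ℝ}, 0 ≤ t → t ≤ U → e ≤ U⁻¹ → t * e ≤ 1 := fun h0 ht he =>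
    (mul_le_mul_of_nonneg_left he h0).trans
      (by rw [← div_eq_mul_inv]; exact (div_le_one hU0).2 ht)
  have hk0 : 0 < T⁻¹ := inv_pos.2 hT0
  refine ⟨a, ha0, b, hb0, c, hc0, T⁻¹, hk0, U⁻¹, inv_pos.2 hU0, C * (1 + a + b + c),
    by positivity, ?_, ?_, kU hC0.le (by linarith) le_rfl, ?_⟩
  · simpa using kT (t := 1) (by linarith)
  · rw [mul_comm]; exact kT (by linarith)
  · intro α β₁ β₂ s s' h hs hα hβ₁ hβ₂ hαε hβ₂ε hακ hβM
    refine lyap_step h hs hC hM hα hβ₁ hβ₂ hακ hβM ha0.le hb ?_ hc hk0 (kT (by linarith)) ?_ ?_ ?_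
      (kU (by linarith) (by linarith) hαε) ?_
    · rw [ha]; field_simp
    · have := kT (t := C * M) (by linarith)
      linarith
    · have := kT (t := 8 * (C * M) / μ) (by linarith)
      rw [div_mul_eq_mul_div, div_le_one hμ] at this
      linarith
    · have := kT (t := 4 * (b * M + c)) (by linarith)
      linarith
    · have := kU hCμ.le (by linarith) hβ₂ε
      rw [div_mul_eq_mul_div, div_le_one hμ] at this
      linarith

theorem telescope_le {Ψ t : ℕ → ℝ} {e : ℝ} {K : ℕ} (h : ∀ k < K, Ψ (k + 1) + t k ≤ Ψ k + e) :
    Ψ K + ∑ k ∈ Finset.range K, t k ≤ Ψ 0 + K * e := by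
  induction K with
  | zero => simp
  | succ K ih =>
    have h1 := ih fun k hk => h k (hk.trans K.lt_succ_self)
    have h2 := h K K.lt_succ_self
    rw [Finset.sum_range_succ]
    push_cast
    linarith

/-- The noise floor e/r is the fixed point of t ↦ (1 - r)t + e. -/
theorem geometric_le {Φ : ℕ → ℝ} {r e : ℝ} {K : ℕ} (hr : 0 < r) (hr1 : r ≤ 1) (he : 0 ≤ e)
    (h : ∀ k < K, Φ (k + 1) ≤ (1 - r) * Φ k + e) : Φ K ≤ (1 - r) ^ K * Φ 0 + e / r := by
  induction K with
  | zero => simp only [pow_zero, one_mul]; linarith [div_nonneg he hr.le]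
  | succ K ih =>
    have h1 := mul_le_mul_of_nonneg_left (ih fun k hk => h k (hk.trans K.lt_succ_self))
      (sub_nonneg.2 hr1)
    have h2 := h K K.lt_succ_self
    have h3 : (1 - r) * (e / r) + e = e / r := by field_simp; ring
    rw [pow_succ]
    linarith

end Lyapunov

/-! ### The one-step bounds along a run. -/

section RunMoments

variable {dx dy : ℕ} {Zf Zg Ω : Type*} [MeasurableSpace Zf] [MeasurableSpace Zg]
  [MeasurableSpace Ω] {B : Problem dx dy Zf Zg} {ℓf ℓg : ℝ≥0} {μg σ : ℝ} {P : Measure Ω}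
  {S : Samples Ω Zf Zg} {x₀ : Ω → Vec dx} {y₁₀ y₂₀ : Ω → Vec dy} {α β₁ β₂ : ℕ → ℝ}
  {x : ℕ → Ω → Vec dx} {y₁ y₂ : ℕ → Ω → Vec dy}

/-- The moments along a run. -/
def runMoments (B : Problem dx dy Zf Zg) (P : Measure Ω) (β₁ β₂ : ℕ → ℝ) (x : ℕ → Ω → Vec dx)
    (y₁ y₂ : ℕ → Ω → Vec dy) (k : ℕ) : Moments :=
  moments B P (x k) (y₁ k) (y₂ k) (smooth β₁ x k) (smooth β₂ x k) (smooth β₂ y₁ k)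

theorem runMoments_nonneg (k : ℕ) : (runMoments B P β₁ β₂ x y₁ y₂ k).Nonneg :=
  ⟨integral_nonneg fun _ => by positivity, integral_nonneg fun _ => by positivity,
    integral_nonneg fun _ => by positivity, integral_nonneg fun _ => by positivity,
    integral_nonneg fun _ => by positivity, add_nonneg (integral_nonneg fun _ => by positivity)
      (integral_nonneg fun _ => by positivity)⟩

theorem IsSOBA.runMoments_zero (h : IsSOBA B S x₀ y₁₀ y₂₀ α β₁ β₂ x y₁ y₂) :
    runMoments B P β₁ β₂ x y₁ y₂ 0 = moments B P x₀ y₁₀ y₂₀ x₀ x₀ y₁₀ := by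
  simp only [runMoments, smooth, h.init_x, h.init_y₁, h.init_y₂]

variable [IsProbabilityMeasure P]

theorem IsSOBA.stepBound (h : IsSOBA B S x₀ y₁₀ y₂₀ α β₁ β₂ x y₁ y₂)
    (R : B.Regular ℓf ℓg μg σ) (hμ : 0 < μg) (hS : IsSampling B P S x₀ y₁₀ y₂₀) {k : ℕ}
    (hα : 0 < α k) (hβ₁ : 0 < β₁ k) (hβ₂ : 0 < β₂ k) (hα1 : stepConst ℓf ℓg μg σ * α k ≤ 1)
    (hβ₁1 : stepConst ℓf ℓg μg σ * β₁ k ≤ 1) (hβ₂1 : stepConst ℓf ℓg μg σ * β₂ k ≤ 1) :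
    StepBound (stepConst ℓf ℓg μg σ) μg (α k) (β₁ k) (β₂ k) (runMoments B P β₁ β₂ x y₁ y₂ k)
      (runMoments B P β₁ β₂ x y₁ y₂ (k + 1)) := by
  have hs := h.sqM R hS
  obtain ⟨n₀, n₁, n₂, hN⟩ := h.exists_noisyStep R hS (hs k).1.meas (hs k).2.1.meas (hs k).2.2
  exact hN.stepBound R hμ (hS.past_le k) (hs k).1 (hs k).2.1 (hs k).2.2
    (sqM_smooth β₁ (fun j => (hs j).1) k) (sqM_smooth β₂ (fun j => (hs j).1) k)
    (sqM_smooth β₂ (fun j => (hs j).2.1) k)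
    ⟨(hs (k + 1)).1.meas.mono (hS.past_le _) le_rfl, (hs (k + 1)).1.memLp⟩
    hα hβ₁ hβ₂ hα1 hβ₁1 hβ₂1

/-- Returns from the lagged target y*(z) to the true one y*(x), at the cost of D. -/
theorem IsSOBA.integral_sq_sub_yStar_le (h : IsSOBA B S x₀ y₁₀ y₂₀ α β₁ β₂ x y₁ y₂)
    (R : B.Regular ℓf ℓg μg σ) (hμ : 0 < μg) (hS : IsSampling B P S x₀ y₁₀ y₂₀) (k : ℕ) :
    MemLp (fun ω => y₁ k ω - B.yStar (x k ω)) 2 P ∧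
    ∫ ω, ‖y₁ k ω - B.yStar (x k ω)‖ ^ 2 ∂P ≤ 2 * (1 + ℓg / μg) ^ 2 *
      ((runMoments B P β₁ β₂ x y₁ y₂ k).E₁ + (runMoments B P β₁ β₂ x y₁ y₂ k).D) := by
  have hs := h.sqM R hS
  have hm := hS.past_le k
  have hz := sqM_smooth β₁ (fun j => (hs j).1) k
  have he := (hs k).2.1.sub (R.sqM_yStar hμ hm (hs k).1)
  have e1 := ((hs k).2.1.sub (R.sqM_yStar hμ hm hz)).int
  have e2 := ((hs k).1.sub hz).int
  refine ⟨he.memLp, ?_⟩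
  simp only [runMoments, moments]
  rw [← integral_add e1 e2, ← integral_const_mul]
  refine integral_mono he.int ((e1.fun_add e2).const_mul _) fun ω => ?_
  refine sq_le_of_le_mul_add (norm_nonneg _) ((R.norm_sub_yStar_le hμ _ (smooth β₁ x k ω) _).trans ?_)
  have h3 : 0 ≤ (ℓg : ℝ) / μg := by positivity
  have := mul_nonneg h3 (norm_nonneg (y₁ k ω - B.yStar (smooth β₁ x k ω)))
  linarith [norm_nonneg (x k ω - smooth β₁ x k ω)]

end RunMoments

/-! ### Non-asymptotic bounds for a run with K iterations. -/

/-- Two-sided bounds and ratios of the step sizes of a run with `K` iterations. -/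
structure StepRange (κ M l h : ℝ) (K : ℕ) (α β₁ β₂ : ℕ → ℝ) : Prop where
  α_lo : ∀ k < K, l ≤ α k
  α_hi : ∀ k < K, α k ≤ h
  β₁_lo : ∀ k < K, l ≤ β₁ k
  β₁_hi : ∀ k < K, β₁ k ≤ h
  β₂_lo : ∀ k < K, l ≤ β₂ k
  β₂_hi : ∀ k < K, β₂ k ≤ h
  ratio₁ : ∀ k < K, α k ≤ κ * β₁ k
  ratio₂ : ∀ k < K, β₁ k ≤ M * β₂ k

theorem eventually_stepRange {κ M ε : ℝ} {r : ℕ → ℝ} {α β₁ β₂ : ℕ → ℕ → ℝ}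
    (hα : IsThetaSteps α r) (hβ₁ : IsThetaSteps β₁ r) (hβ₂ : IsThetaSteps β₂ r)
    (hr0 : ∀ᶠ K in atTop, 0 < r K) (hr : Tendsto r atTop (𝓝 0)) (hε : 0 < ε)
    (h : ∀ᶠ K in atTop, ∀ k < K, α K k ≤ κ * β₁ K k ∧ β₁ K k ≤ M * β₂ K k) :
    ∃ c > 0, ∃ C : ℝ, ∀ᶠ K in atTop,
      StepRange κ M (c * r K) (C * r K) K (α K) (β₁ K) (β₂ K) ∧ 0 < r K ∧ C * r K ≤ ε := by
  obtain ⟨c₀, hc₀, C₀, h₀⟩ := hα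
  obtain ⟨c₁, hc₁, C₁, h₁⟩ := hβ₁
  obtain ⟨c₂, hc₂, C₂, h₂⟩ := hβ₂
  refine ⟨min c₀ (min c₁ c₂), lt_min hc₀ (lt_min hc₁ hc₂), max C₀ (max C₁ C₂), ?_⟩
  have hs : ∀ᶠ K in atTop, max C₀ (max C₁ C₂) * r K < ε := by
    have := hr.const_mul (max C₀ (max C₁ C₂))
    rw [mul_zero] at this
    exact this.eventually (gt_mem_nhds hε)
  filter_upwards [h₀, h₁, h₂, hr0, hs, h] with K k0 k1 k2 k3 k4 k5
  have lo : ∀ {c a : ℝ}, min c₀ (min c₁ c₂) ≤ c → c * r K ≤ a →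
      min c₀ (min c₁ c₂) * r K ≤ a := fun hc ha =>
    (mul_le_mul_of_nonneg_right hc k3.le).trans ha
  have hi : ∀ {C a : ℝ}, C ≤ max C₀ (max C₁ C₂) → a ≤ C * r K →
      a ≤ max C₀ (max C₁ C₂) * r K := fun hc ha =>
    ha.trans (mul_le_mul_of_nonneg_right hc k3.le)
  exact ⟨⟨fun k hk => lo (min_le_left _ _) (k0 k hk).1,
    fun k hk => hi (le_max_left _ _) (k0 k hk).2,
    fun k hk => lo ((min_le_right _ _).trans (min_le_left _ _)) (k1 k hk).1,
    fun k hk => hi ((le_max_left _ _).trans (le_max_right _ _)) (k1 k hk).2,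
    fun k hk => lo ((min_le_right _ _).trans (min_le_right _ _)) (k2 k hk).1,
    fun k hk => hi ((le_max_right _ _).trans (le_max_right _ _)) (k2 k hk).2,
    fun k hk => (k5 k hk).1, fun k hk => (k5 k hk).2⟩, k3, k4.le⟩

section Rates

variable {dx dy : ℕ} {Zf Zg Ω : Type*} [MeasurableSpace Zf] [MeasurableSpace Zg]
  [MeasurableSpace Ω] {B : Problem dx dy Zf Zg} {ℓf ℓg : ℝ≥0} {μg σ : ℝ} {P : Measure Ω}
  [IsProbabilityMeasure P]
  {S : Samples Ω Zf Zg} {x₀ : Ω → Vec dx} {y₁₀ y₂₀ : Ω → Vec dy} {α β₁ β₂ : ℕ → ℝ}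
  {x : ℕ → Ω → Vec dx} {y₁ y₂ : ℕ → Ω → Vec dy} {M a b c κ ε A l h : ℝ} {K : ℕ}

theorem IsSOBA.lyap_le (hA : IsSOBA B S x₀ y₁₀ y₂₀ α β₁ β₂ x y₁ y₂) (R : B.Regular ℓf ℓg μg σ)
    (hμ : 0 < μg) (hS : IsSampling B P S x₀ y₁₀ y₂₀)
    (hL : IsLyapunov (stepConst ℓf ℓg μg σ) μg M a b c κ ε A) (hA0 : 0 ≤ A)
    (hε : stepConst ℓf ℓg μg σ * ε ≤ 1) (hr : StepRange κ M l h K α β₁ β₂) (hl : 0 < l)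
    (hh : h ≤ ε) {k : ℕ} (hk : k < K) :
    (runMoments B P β₁ β₂ x y₁ y₂ (k + 1)).lyap a b c
      + α k / 2 * (runMoments B P β₁ β₂ x y₁ y₂ k).G
      + β₁ k * ((runMoments B P β₁ β₂ x y₁ y₂ k).E₁ + (runMoments B P β₁ β₂ x y₁ y₂ k).D)
      + μg / 2 * β₂ k * (runMoments B P β₁ β₂ x y₁ y₂ k).E₂
      + β₂ k * (runMoments B P β₁ β₂ x y₁ y₂ k).Q
      ≤ (runMoments B P β₁ β₂ x y₁ y₂ k).lyap a b c + A * (3 * h ^ 2) := by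
  have hα := hl.trans_le (hr.α_lo k hk)
  have hβ₁ := hl.trans_le (hr.β₁_lo k hk)
  have hβ₂ := hl.trans_le (hr.β₂_lo k hk)
  have hC : 0 ≤ stepConst ℓf ℓg μg σ := zero_le_one.trans (stepConst_bounds ℓf ℓg hμ σ).1
  have hs : ∀ {t : ℝ}, t ≤ h → stepConst ℓf ℓg μg σ * t ≤ 1 := fun ht =>
    (mul_le_mul_of_nonneg_left (ht.trans hh) hC).trans hε
  refine (hL _ _ _ _ _ (hA.stepBound R hμ hS hα hβ₁ hβ₂ (hs (hr.α_hi k hk)) (hs (hr.β₁_hi k hk))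
    (hs (hr.β₂_hi k hk))) (runMoments_nonneg k) hα hβ₁ hβ₂ ((hr.α_hi k hk).trans hh)
    ((hr.β₂_hi k hk).trans hh) (hr.ratio₁ k hk) (hr.ratio₂ k hk)).trans ?_
  have := pow_le_pow_left₀ hα.le (hr.α_hi k hk) 2
  have := pow_le_pow_left₀ hβ₁.le (hr.β₁_hi k hk) 2
  have := pow_le_pow_left₀ hβ₂.le (hr.β₂_hi k hk) 2
  gcongr
  linarith

theorem IsSOBA.le_runMoments_F (hA : IsSOBA B S x₀ y₁₀ y₂₀ α β₁ β₂ x y₁ y₂)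
    (R : B.Regular ℓf ℓg μg σ) (hμ : 0 < μg) (hS : IsSampling B P S x₀ y₁₀ y₂₀) {F₀ : ℝ}
    (hF : ∀ z, F₀ ≤ B.F z) (k : ℕ) : F₀ ≤ (runMoments B P β₁ β₂ x y₁ y₂ k).F := by
  have h1 := integral_mono (integrable_const F₀)
    (R.integrable_F hμ (hS.past_le k) (hA.sqM R hS k).1) fun ω => hF (x k ω)
  rw [integral_const, probReal_univ, one_smul] at h1
  exact h1

/-- A bound for the sum of the errors in terms of the initial Lyapunov gap. -/
theorem IsSOBA.sum_errors_le (hA : IsSOBA B S x₀ y₁₀ y₂₀ α β₁ β₂ x y₁ y₂)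
    (R : B.Regular ℓf ℓg μg σ) (hμ : 0 < μg) (hS : IsSampling B P S x₀ y₁₀ y₂₀)
    (hL : IsLyapunov (stepConst ℓf ℓg μg σ) μg M a b c κ ε A) (hA0 : 0 ≤ A) (ha : 0 < a)
    (hb : 0 < b) (hc : 0 < c) (hε : stepConst ℓf ℓg μg σ * ε ≤ 1)
    (hr : StepRange κ M l h K α β₁ β₂) (hl : 0 < l) (hh : h ≤ ε) {F₀ : ℝ}
    (hF : ∀ z, F₀ ≤ B.F z) {Λ : ℝ}
    (hΛ : (moments B P x₀ y₁₀ y₂₀ x₀ x₀ y₁₀).lyap a b c + K * (A * (3 * h ^ 2)) - F₀ ≤ Λ) :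
    ∑ k ∈ Finset.Icc 1 K, ((∫ ω, ‖gradient B.F (x k ω)‖ ^ 2 ∂P)
        + ∫ ω, ‖y₁ k ω - B.yStar (x k ω)‖ ^ 2 ∂P)
      ≤ (1 + 2 * (1 + ℓg / μg) ^ 2) * (2 / l * Λ
        + (4 * (Problem.lipF ℓf ℓg μg + 1) + 1 / a + 1 / c) * Λ) := by
  have hn : ∀ k, (runMoments B P β₁ β₂ x y₁ y₂ k).Nonneg := fun k => runMoments_nonneg k
  have hy := fun k => (hA.integral_sq_sub_yStar_le R hμ hS k).2
  have hlow := fun k => hA.le_runMoments_F R hμ hS hF k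
  have hst := fun k (hk : k < K) => hA.lyap_le R hμ hS hL hA0 hε hr hl hh hk
  rw [← hA.runMoments_zero (P := P)] at hΛ
  have hgrad : ∀ z, gradient B.F z = B.hyperGrad z := fun z => (R.hasGradientAt_F hμ z).gradient
  have hG : ∀ k, ∫ ω, ‖gradient B.F (x k ω)‖ ^ 2 ∂P = (runMoments B P β₁ β₂ x y₁ y₂ k).G := by
    intro k; simp only [hgrad]; rfl
  -- Telescoping covers the times 0 to K - 1, whereas the sum runs from 1 to K. The gradient at time
  -- K is bounded by the objective gap instead; adding 1 to `lipF` makes the constant positive.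
  have hGF : (runMoments B P β₁ β₂ x y₁ y₂ K).G ≤ 4 * (Problem.lipF ℓf ℓg μg + 1)
      * ((runMoments B P β₁ β₂ x y₁ y₂ K).F - F₀) := by
    have hL0 := lipF_nonneg ℓf ℓg hμ
    have hx := (hA.sqM R hS K).1
    have hi := R.integrable_F hμ (hS.past_le K) hx
    have hi2 : Integrable (fun ω => B.F (x K ω) - F₀) P := hi.sub (integrable_const _)
    have h1 := integral_mono (R.sqM_hyperGrad hμ (hS.past_le K) hx).int
      (hi2.const_mul (4 * (Problem.lipF ℓf ℓg μg + 1))) fun ω =>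
      sq_norm_gradient_le (L := Problem.lipF ℓf ℓg μg + 1) (by linarith) (R.hasGradientAt_F hμ)
        (fun z w => (R.hyperGrad_lip hμ z w).trans
          (mul_le_mul_of_nonneg_right (by linarith) (norm_nonneg _))) hF (x K ω)
    rw [integral_const_mul, integral_sub hi (integrable_const _)] at h1
    simpa [runMoments, moments] using h1
  simp only [hG]
  generalize runMoments B P β₁ β₂ x y₁ y₂ = s at *
  have hL0 := lipF_nonneg ℓf ℓg hμ
  have hr0 : 0 ≤ 2 * (1 + (ℓg : ℝ) / μg) ^ 2 := by positivity
  generalize 2 * (1 + (ℓg : ℝ) / μg) ^ 2 = W at *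
  have hT : ∀ k, (s k).G + ∫ ω, ‖y₁ k ω - B.yStar (x k ω)‖ ^ 2 ∂P
      ≤ (1 + W) * ((s k).G + ((s k).E₁ + (s k).D)) := by
    intro k
    have := mul_nonneg hr0 (hn k).G
    linarith [hy k, (hn k).E₁, (hn k).D]
  have htel := telescope_le (Ψ := fun k => (s k).lyap a b c)
    (t := fun k => l / 2 * ((s k).G + ((s k).E₁ + (s k).D))) (e := A * (3 * h ^ 2)) (K := K)
    fun k hk => by
      have h1 := hst k hk
      have h2 := mul_le_mul_of_nonneg_right (hr.α_lo k hk) (hn k).G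
      have h3 := mul_le_mul_of_nonneg_right (hr.β₁_lo k hk) (add_nonneg (hn k).E₁ (hn k).D)
      have h4 := mul_nonneg hl.le (add_nonneg (hn k).E₁ (hn k).D)
      have h5 := mul_nonneg (mul_nonneg (half_pos hμ).le (hl.le.trans (hr.β₂_lo k hk))) (hn k).E₂
      have h6 := mul_nonneg (hl.le.trans (hr.β₂_lo k hk)) (hn k).Q
      linarith
  rw [← Finset.mul_sum] at htel
  have hΨ : (s K).F - F₀ + a * (s K).E₁ + c * (s K).D ≤ (s K).lyap a b c - F₀ := by
    have := mul_nonneg hb.le (hn K).Q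
    simp only [Moments.lyap]
    linarith [(hn K).E₂]
  have hsum0 : 0 ≤ ∑ k ∈ Finset.range K, ((s k).G + ((s k).E₁ + (s k).D)) :=
    Finset.sum_nonneg fun k _ => add_nonneg (hn k).G (add_nonneg (hn k).E₁ (hn k).D)
  have hsum : ∑ k ∈ Finset.range K, ((s k).G + ((s k).E₁ + (s k).D)) ≤ 2 / l * Λ := by
    have e1 := mul_nonneg ha.le (hn K).E₁
    have e2 := mul_nonneg hc.le (hn K).D
    have h1 : l / 2 * ∑ k ∈ Finset.range K, ((s k).G + ((s k).E₁ + (s k).D)) ≤ Λ := by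
      linarith [hlow K]
    rw [div_mul_eq_mul_div, le_div_iff₀ hl]
    linarith
  have hK : (s K).F - F₀ + a * (s K).E₁ + c * (s K).D ≤ Λ := by
    have := mul_nonneg (half_pos hl).le hsum0
    linarith
  have hlast : (s K).G + ((s K).E₁ + (s K).D)
      ≤ (4 * (Problem.lipF ℓf ℓg μg + 1) + 1 / a + 1 / c) * Λ := by
    have e1 := mul_nonneg ha.le (hn K).E₁
    have e2 := mul_nonneg hc.le (hn K).D
    have h1 : (s K).E₁ ≤ 1 / a * Λ := by
      rw [div_mul_eq_mul_div, le_div_iff₀ ha]; linarith [hlow K]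
    have h2 : (s K).D ≤ 1 / c * Λ := by
      rw [div_mul_eq_mul_div, le_div_iff₀ hc]; linarith [hlow K]
    have h3 : (s K).G ≤ 4 * (Problem.lipF ℓf ℓg μg + 1) * Λ :=
      hGF.trans (mul_le_mul_of_nonneg_left (by linarith) (by linarith))
    linarith
  calc _ ≤ ∑ k ∈ Finset.Icc 1 K, (1 + W) * ((s k).G + ((s k).E₁ + (s k).D)) :=
        Finset.sum_le_sum fun k _ => hT k
    _ ≤ ∑ k ∈ Finset.range (K + 1), (1 + W) * ((s k).G + ((s k).E₁ + (s k).D)) := by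
        refine Finset.sum_le_sum_of_subset_of_nonneg (fun k hk => ?_) fun k _ _ =>
          mul_nonneg (by linarith) (add_nonneg (hn k).G (add_nonneg (hn k).E₁ (hn k).D))
        rw [Finset.mem_range]
        exact Nat.lt_succ_of_le (Finset.mem_Icc.1 hk).2
    _ ≤ _ := by
        rw [← Finset.mul_sum, Finset.sum_range_succ]
        exact mul_le_mul_of_nonneg_left (add_le_add hsum hlast) (by linarith)

/-- A bound for the last iterate when the objective is strongly convex. -/
theorem IsSOBA.last_error_le (hA : IsSOBA B S x₀ y₁₀ y₂₀ α β₁ β₂ x y₁ y₂)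
    (R : B.Regular ℓf ℓg μg σ) (hμ : 0 < μg) (hS : IsSampling B P S x₀ y₁₀ y₂₀)
    (hL : IsLyapunov (stepConst ℓf ℓg μg σ) μg M a b c κ ε A) (hA0 : 0 ≤ A) (ha : 0 < a)
    (hb : 0 < b) (hc : 0 < c) (hκ : κ ≤ 1) (hκM : κ * M ≤ 1)
    (hε : stepConst ℓf ℓg μg σ * ε ≤ 1)
    (hr : StepRange κ M l h K α β₁ β₂) (hl : 0 < l) (hh : h ≤ ε) {μx ρ r : ℝ} (hμx : 0 < μx)
    (hsc : StrongConvexOn Set.univ μx B.F) (hρ0 : 0 < ρ) (hρx : ρ ≤ μx) (hρμ : ρ ≤ μg / 2)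
    (hρa : ρ * (a + b + c) ≤ 1) (hr0 : 0 < r) (hr1 : r ≤ 1) (hα : ∀ k < K, r ≤ ρ * α k) :
    (∫ ω, ‖x K ω - argmin B.F‖ ^ 2 ∂P) + ∫ ω, ‖y₁ K ω - B.yStar (x K ω)‖ ^ 2 ∂P
      ≤ (2 / μx + 2 * (1 + ℓg / μg) ^ 2 * (1 / a + 1 / c)) * ((1 - r) ^ K *
        ((moments B P x₀ y₁₀ y₂₀ x₀ x₀ y₁₀).lyap a b c - B.F (argmin B.F))
        + A * (3 * h ^ 2) / r) := by
  have hd : Differentiable ℝ B.F := fun z => (R.hasGradientAt_F hμ z).differentiableAt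
  have hF : ∀ z, B.F (argmin B.F) ≤ B.F z := argmin_le (exists_minimizer hμx hsc hd)
  have hn : ∀ k, (runMoments B P β₁ β₂ x y₁ y₂ k).Nonneg := fun k => runMoments_nonneg k
  have hy := (hA.integral_sq_sub_yStar_le R hμ hS K).2
  have hlow := fun k => hA.le_runMoments_F R hμ hS hF k
  have hst := fun k (hk : k < K) => hA.lyap_le R hμ hS hL hA0 hε hr hl hh hk
  rw [← hA.runMoments_zero (P := P)]
  have hgrad : ∀ z, gradient B.F z = B.hyperGrad z := fun z => (R.hasGradientAt_F hμ z).gradient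
  have hgap : ∀ k, Integrable (fun ω => B.F (x k ω) - B.F (argmin B.F)) P ∧
      ∫ ω, (B.F (x k ω) - B.F (argmin B.F)) ∂P
        = (runMoments B P β₁ β₂ x y₁ y₂ k).F - B.F (argmin B.F) := by
    intro k
    have hi := R.integrable_F hμ (hS.past_le k) (hA.sqM R hS k).1
    refine ⟨hi.sub (integrable_const _), ?_⟩
    rw [integral_sub hi (integrable_const _)]
    simp [runMoments, moments]
  -- The Polyak–Łojasiewicz inequality in expectation; it replaces G in the decrease by the
  -- objective gap.
  have hPL : ∀ k, 2 * μx * ((runMoments B P β₁ β₂ x y₁ y₂ k).F - B.F (argmin B.F))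
      ≤ (runMoments B P β₁ β₂ x y₁ y₂ k).G := by
    intro k
    have h1 := integral_mono ((hgap k).1.const_mul (2 * μx))
      (R.sqM_hyperGrad hμ (hS.past_le k) (hA.sqM R hS k).1).int fun ω => by
        have := strongConvex_gap_le hμx hsc hd (x k ω) (argmin B.F)
        rwa [hgrad] at this
    rwa [integral_const_mul, (hgap k).2] at h1
  have hx : ∫ ω, ‖x K ω - argmin B.F‖ ^ 2 ∂P
      ≤ 2 / μx * ((runMoments B P β₁ β₂ x y₁ y₂ K).F - B.F (argmin B.F)) := by
    rw [← (hgap K).2, ← integral_const_mul]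
    refine integral_mono (memLp_sqInt ((hA.sqM R hS K).1.memLp.sub (memLp_const _)))
      ((hgap K).1.const_mul _) fun ω => ?_
    have h1 := hsc.le_of_differentiableAt (hd (argmin B.F)) (x K ω)
    rw [gradient_eq_zero_of_minimizer hF, inner_zero_left] at h1
    rw [div_mul_eq_mul_div, le_div_iff₀ hμx]
    linarith
  generalize runMoments B P β₁ β₂ x y₁ y₂ = s at *
  generalize B.F (argmin B.F) = F₀ at *
  have hr2 : 0 ≤ 2 * (1 + (ℓg : ℝ) / μg) ^ 2 := by positivity
  generalize 2 * (1 + (ℓg : ℝ) / μg) ^ 2 = W at *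
  -- Every part of the Lyapunov gap decreases by at least `ρ * α k` times itself: the objective part
  -- by `hPL`, the others because α is at most both β₁ and β₂ and ρ times each weight is at most 1
  -- (at most μg/2 for E₂).
  have hcon : ∀ k < K, (s (k + 1)).lyap a b c - F₀
      ≤ (1 - r) * ((s k).lyap a b c - F₀) + A * (3 * h ^ 2) := by
    intro k hk
    have h0 := hst k hk
    have hαp := hl.trans_le (hr.α_lo k hk)
    have hβ₁p := hl.trans_le (hr.β₁_lo k hk)
    have hβ₂p := hl.trans_le (hr.β₂_lo k hk)
    have hαβ₁ : α k ≤ β₁ k := (hr.ratio₁ k hk).trans (mul_le_of_le_one_left hβ₁p.le hκ)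
    have hκ0 : 0 ≤ κ := by
      by_contra hneg
      have := mul_neg_of_neg_of_pos (not_le.1 hneg) hβ₁p
      linarith [hr.ratio₁ k hk]
    have hαβ₂ : α k ≤ β₂ k := by
      calc α k ≤ κ * β₁ k := hr.ratio₁ k hk
        _ ≤ κ * (M * β₂ k) := mul_le_mul_of_nonneg_left (hr.ratio₂ k hk) hκ0
        _ = (κ * M) * β₂ k := by ring
        _ ≤ β₂ k := mul_le_of_le_one_left hβ₂p.le hκM
    have hgap0 : 0 ≤ (s k).F - F₀ := sub_nonneg.2 (hlow k)
    have g1 := mul_le_mul_of_nonneg_left (hPL k) hαp.le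
    have g2 := mul_le_mul_of_nonneg_right hρx (mul_nonneg hαp.le hgap0)
    have w1 : ρ * a ≤ 1 := by nlinarith
    have w2 : ρ * b ≤ 1 := by nlinarith
    have w3 : ρ * c ≤ 1 := by nlinarith
    have t1 : ρ * α k * (a * (s k).E₁) ≤ β₁ k * (s k).E₁ := by
      calc _ = (ρ * a) * (α k * (s k).E₁) := by ring
        _ ≤ 1 * (α k * (s k).E₁) := mul_le_mul_of_nonneg_right w1 (mul_nonneg hαp.le (hn k).E₁)
        _ ≤ _ := by rw [one_mul]; exact mul_le_mul_of_nonneg_right hαβ₁ (hn k).E₁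
    have t2 : ρ * α k * (c * (s k).D) ≤ β₁ k * (s k).D := by
      calc _ = (ρ * c) * (α k * (s k).D) := by ring
        _ ≤ 1 * (α k * (s k).D) := mul_le_mul_of_nonneg_right w3 (mul_nonneg hαp.le (hn k).D)
        _ ≤ _ := by rw [one_mul]; exact mul_le_mul_of_nonneg_right hαβ₁ (hn k).D
    have t3 : ρ * α k * (b * (s k).Q) ≤ β₂ k * (s k).Q := by
      calc _ = (ρ * b) * (α k * (s k).Q) := by ring
        _ ≤ 1 * (α k * (s k).Q) := mul_le_mul_of_nonneg_right w2 (mul_nonneg hαp.le (hn k).Q)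
        _ ≤ _ := by rw [one_mul]; exact mul_le_mul_of_nonneg_right hαβ₂ (hn k).Q
    have t4 : ρ * α k * (s k).E₂ ≤ μg / 2 * β₂ k * (s k).E₂ :=
      mul_le_mul_of_nonneg_right (mul_le_mul hρμ hαβ₂ hαp.le (half_pos hμ).le) (hn k).E₂
    have hpos : 0 ≤ (s k).lyap a b c - F₀ := by
      have e1 := mul_nonneg ha.le (hn k).E₁
      have e2 := mul_nonneg hb.le (hn k).Q
      have e3 := mul_nonneg hc.le (hn k).D
      simp only [Moments.lyap]
      linarith [(hn k).E₂]
    have h1 := mul_le_mul_of_nonneg_right (hα k hk) hpos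
    have h2 : ρ * α k * ((s k).lyap a b c - F₀) = ρ * (α k * ((s k).F - F₀))
        + ρ * α k * (a * (s k).E₁) + ρ * α k * (s k).E₂ + ρ * α k * (b * (s k).Q)
        + ρ * α k * (c * (s k).D) := by
      simp only [Moments.lyap]; ring
    linarith
  have hgeo := geometric_le (Φ := fun k => (s k).lyap a b c - F₀) hr0 hr1
    (by positivity : 0 ≤ A * (3 * h ^ 2)) hcon
  have hfin : (s K).F - F₀ + a * (s K).E₁ + c * (s K).D ≤ (s K).lyap a b c - F₀ := by
    have := mul_nonneg hb.le (hn K).Q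
    simp only [Moments.lyap]
    linarith [(hn K).E₂]
  set Φ := (1 - r) ^ K * ((s 0).lyap a b c - F₀) + A * (3 * h ^ 2) / r
  have e1 := mul_nonneg ha.le (hn K).E₁
  have e2 := mul_nonneg hc.le (hn K).D
  have h1 : (s K).E₁ ≤ 1 / a * Φ := by
    rw [div_mul_eq_mul_div, le_div_iff₀ ha]; linarith [hlow K]
  have h2 : (s K).D ≤ 1 / c * Φ := by
    rw [div_mul_eq_mul_div, le_div_iff₀ hc]; linarith [hlow K]
  have h3 : 2 / μx * ((s K).F - F₀) ≤ 2 / μx * Φ :=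
    mul_le_mul_of_nonneg_left (by linarith) (by positivity)
  have h4 := mul_le_mul_of_nonneg_left (add_le_add h1 h2) hr2
  linarith

end Rates

/-! ### Asymptotics of the step sizes. -/

theorem tendsto_log_div_nat : Tendsto (fun K : ℕ => Real.log K / K) atTop (𝓝 0) :=
  (Real.isLittleO_log_id_atTop.tendsto_div_nhds_zero).comp tendsto_natCast_atTop_atTop

theorem eventually_log_div_pos : ∀ᶠ K : ℕ in atTop, 0 < Real.log K / K := by
  filter_upwards [eventually_ge_atTop 2] with K hK
  have h1 : (1 : ℝ) < K := by exact_mod_cast hK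
  exact div_pos (Real.log_pos h1) (by linarith)

theorem tendsto_one_div_sqrt_nat : Tendsto (fun K : ℕ => 1 / √(K : ℝ)) atTop (𝓝 0) := by
  simp only [one_div]
  exact tendsto_inv_atTop_zero.comp (Real.tendsto_sqrt_atTop.comp tendsto_natCast_atTop_atTop)

theorem one_sub_log_div_pow_le {K : ℕ} (hK : 0 < K) (h : Real.log K / K ≤ 1) :
    (1 - Real.log K / K) ^ K ≤ 1 / K := by
  have hK' : (0 : ℝ) < K := by exact_mod_cast hK
  calc (1 - Real.log K / K) ^ K ≤ Real.exp (-(Real.log K / K)) ^ K :=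
        pow_le_pow_left₀ (sub_nonneg.2 h) (Real.one_sub_le_exp_neg _) K
    _ = Real.exp (-Real.log K) := by
        rw [← Real.exp_nat_mul]; congr 1; field_simp
    _ = 1 / K := by rw [Real.exp_neg, Real.exp_log hK', one_div]

end Bilevel

end

/-! ### The two convergence rates. -/

theorem corollary1 (ℓf ℓg : ℝ≥0) (μg μx σ : ℝ) (hμg : 0 < μg) (hμx : 0 < μx)
    (M : ℝ) (hM : 0 < M) :
    -- strongly convex objective, step sizes of order `log K / K`
    (∃ c > 0, ∃ κ > 0, ∀ (dx dy : ℕ)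
      (Zf Zg Ω : Type*) [MeasurableSpace Zf] [MeasurableSpace Zg] [MeasurableSpace Ω]
      (B : Bilevel.Problem dx dy Zf Zg) (P : Measure Ω) [IsProbabilityMeasure P]
      (S : Bilevel.Samples Ω Zf Zg)
      (x₀ : Ω → Bilevel.Vec dx) (y₁₀ y₂₀ : Ω → Bilevel.Vec dy)
      (α β₁ β₂ : ℕ → ℕ → ℝ)
      (x : ℕ → ℕ → Ω → Bilevel.Vec dx) (y₁ y₂ : ℕ → ℕ → Ω → Bilevel.Vec dy),
      B.Regular ℓf ℓg μg σ →
      StrongConvexOn Set.univ μx B.F →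
      Bilevel.IsSampling B P S x₀ y₁₀ y₂₀ →
      (∀ K, Bilevel.IsSOBA B S x₀ y₁₀ y₂₀ (α K) (β₁ K) (β₂ K) (x K) (y₁ K) (y₂ K)) →
      Bilevel.IsThetaSteps α (fun K => Real.log K / K) →
      Bilevel.IsThetaSteps β₁ (fun K => Real.log K / K) →
      Bilevel.IsThetaSteps β₂ (fun K => Real.log K / K) →
      (∀ᶠ K : ℕ in atTop, ∀ k < K, c * (Real.log K / K) ≤ α K k ∧
        α K k ≤ κ * β₁ K k ∧ β₁ K k ≤ M * β₂ K k) →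
      (∀ K, MemLp (fun ω => x K K ω - Bilevel.argmin B.F) 2 P ∧
        MemLp (fun ω => y₁ K K ω - B.yStar (x K K ω)) 2 P) ∧
      Bilevel.IsSoftO
        (fun K => (∫ ω, ‖x K K ω - Bilevel.argmin B.F‖ ^ 2 ∂P)
          + ∫ ω, ‖y₁ K K ω - B.yStar (x K K ω)‖ ^ 2 ∂P)
        (fun K => 1 / (K : ℝ))) ∧
    -- lower bounded objective, step sizes of order `1 / √K`
    (∃ κ > 0, ∀ (dx dy : ℕ)
      (Zf Zg Ω : Type*) [MeasurableSpace Zf] [MeasurableSpace Zg] [MeasurableSpace Ω]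
      (B : Bilevel.Problem dx dy Zf Zg) (P : Measure Ω) [IsProbabilityMeasure P]
      (S : Bilevel.Samples Ω Zf Zg)
      (x₀ : Ω → Bilevel.Vec dx) (y₁₀ y₂₀ : Ω → Bilevel.Vec dy)
      (α β₁ β₂ : ℕ → ℕ → ℝ)
      (x : ℕ → ℕ → Ω → Bilevel.Vec dx) (y₁ y₂ : ℕ → ℕ → Ω → Bilevel.Vec dy),
      B.Regular ℓf ℓg μg σ →
      BddBelow (Set.range B.F) →
      Bilevel.IsSampling B P S x₀ y₁₀ y₂₀ →
      (∀ K, Bilevel.IsSOBA B S x₀ y₁₀ y₂₀ (α K) (β₁ K) (β₂ K) (x K) (y₁ K) (y₂ K)) →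
      Bilevel.IsThetaSteps α (fun K => 1 / √K) →
      Bilevel.IsThetaSteps β₁ (fun K => 1 / √K) →
      Bilevel.IsThetaSteps β₂ (fun K => 1 / √K) →
      (∀ᶠ K : ℕ in atTop, ∀ k < K, α K k ≤ κ * β₁ K k ∧ β₁ K k ≤ M * β₂ K k) →
      Differentiable ℝ B.F ∧
      (∀ K k, MemLp (fun ω => gradient B.F (x K k ω)) 2 P ∧
        MemLp (fun ω => y₁ K k ω - B.yStar (x K k ω)) 2 P) ∧
      (fun K : ℕ => (1 / (K : ℝ)) * ∑ k ∈ Finset.Icc 1 K,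
          ((∫ ω, ‖gradient B.F (x K k ω)‖ ^ 2 ∂P)
            + ∫ ω, ‖y₁ K k ω - B.yStar (x K k ω)‖ ^ 2 ∂P))
        =O[atTop] fun K => 1 / √(K : ℝ)) := by
  have hC := (Bilevel.stepConst_bounds ℓf ℓg hμg σ).1
  obtain ⟨a, ha, b, hb, c, hc, κ, hκ, ε, hε, A, hA, hκ1, hκM, hCε, hL⟩ :=
    Bilevel.exists_lyapunov hC hμg hM
  constructor
  · obtain ⟨ρ, hρ⟩ : ∃ ρ, ρ = min μx (min (μg / 2) (1 / (a + b + c))) := ⟨_, rfl⟩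
    have habc : 0 < a + b + c := by linarith
    have hρ0 : 0 < ρ := hρ ▸ lt_min hμx (lt_min (half_pos hμg) (one_div_pos.2 habc))
    have hρ1 : ρ ≤ μx := hρ ▸ min_le_left _ _
    have hρ2 : ρ ≤ μg / 2 := hρ ▸ (min_le_right _ _).trans (min_le_left _ _)
    have hρ3 : ρ * (a + b + c) ≤ 1 :=
      (le_div_iff₀ habc).1 (hρ ▸ (min_le_right _ _).trans (min_le_right _ _))
    -- With α ≥ (1/ρ) log K / K the contraction rate per step is at least r = log K / K, exactly
    -- what makes (1 - r)^K at most 1/K.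
    refine ⟨1 / ρ, one_div_pos.2 hρ0, κ, hκ, ?_⟩
    intro dx dy Zf Zg Ω _ _ _ B P _ S x₀ y₁₀ y₂₀ α β₁ β₂ x y₁ y₂ R hsc hS hA' hα hβ₁ hβ₂ hrel
    refine ⟨fun K => ⟨((hA' K).sqM R hS K).1.memLp.sub (memLp_const _),
      ((hA' K).integral_sq_sub_yStar_le R hμg hS K).1⟩, ?_⟩
    obtain ⟨c₀, hc₀, C₀, hev⟩ := Bilevel.eventually_stepRange hα hβ₁ hβ₂
      Bilevel.eventually_log_div_pos Bilevel.tendsto_log_div_nat hε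
      (hrel.mono fun K h k hk => (h k hk).2)
    -- The averages start at the initial point, so the initial Lyapunov gap does not depend on K.
    obtain ⟨G₀, hG₀⟩ : ∃ G₀, G₀ = (Bilevel.moments B P x₀ y₁₀ y₂₀ x₀ x₀ y₁₀).lyap a b c
      - B.F (Bilevel.argmin B.F) := ⟨_, rfl⟩
    have hW : 0 ≤ 2 / μx + 2 * (1 + (ℓg : ℝ) / μg) ^ 2 * (1 / a + 1 / c) := by positivity
    refine IsBigO.of_bound ((2 / μx + 2 * (1 + ℓg / μg) ^ 2 * (1 / a + 1 / c))
      * (|G₀| + A * (3 * C₀ ^ 2))) ?_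
    filter_upwards [hev, hrel, eventually_ge_atTop 2,
      Bilevel.tendsto_log_div_nat.eventually (gt_mem_nhds one_pos)] with K hK hrelK hK2 hK1
    obtain ⟨hr, hr0, hh⟩ := hK
    have hK0 : 0 < K := by omega
    have hK0' : (0 : ℝ) < K := by exact_mod_cast hK0
    have hbound := (hA' K).last_error_le R hμg hS hL hA ha hb hc hκ1 hκM hCε hr
      (mul_pos hc₀ hr0) hh hμx hsc hρ0 hρ1 hρ2 hρ3 hr0 hK1.le fun k hk => by
        have := mul_le_mul_of_nonneg_left (hrelK k hk).1 hρ0.le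
        rwa [← mul_assoc, mul_one_div_cancel hρ0.ne', one_mul] at this
    rw [← hG₀] at hbound
    have hlog : 0 ≤ Real.log K := Real.log_natCast_nonneg K
    have hmax1 : 1 ≤ max 1 |Real.log (1 / (K : ℝ))| := le_max_left _ _
    have hmax2 : Real.log K ≤ max 1 |Real.log (1 / (K : ℝ))| := by
      refine le_trans ?_ (le_max_right _ _)
      rw [one_div, Real.log_inv, abs_neg]
      exact le_abs_self _
    generalize max 1 |Real.log (1 / (K : ℝ))| = m at *
    rw [Real.norm_of_nonneg (add_nonneg (integral_nonneg fun _ => by positivity)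
      (integral_nonneg fun _ => by positivity)),
      Real.norm_of_nonneg (mul_nonneg (by positivity) (by linarith)), mul_assoc]
    refine hbound.trans (mul_le_mul_of_nonneg_left ?_ hW)
    have h1 : (1 - Real.log K / K) ^ K * G₀ ≤ 1 / K * m * |G₀| := by
      calc _ ≤ (1 - Real.log K / K) ^ K * |G₀| :=
            mul_le_mul_of_nonneg_left (le_abs_self _) (pow_nonneg (sub_nonneg.2 hK1.le) _)
        _ ≤ 1 / K * |G₀| := mul_le_mul_of_nonneg_right
            (Bilevel.one_sub_log_div_pow_le hK0 hK1.le) (abs_nonneg _)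
        _ ≤ _ := mul_le_mul_of_nonneg_right (le_mul_of_one_le_right (by positivity) hmax1)
            (abs_nonneg _)
    -- The noise floor h²/r is of order log K / K, the source of the logarithm in the rate.
    have h2 : A * (3 * (C₀ * (Real.log K / K)) ^ 2) / (Real.log K / K)
        ≤ 1 / K * m * (A * (3 * C₀ ^ 2)) := by
      calc _ = 1 / K * Real.log K * (A * (3 * C₀ ^ 2)) := by
            rw [div_eq_iff hr0.ne']; ring
        _ ≤ _ := by gcongr
    linarith
  · refine ⟨κ, hκ, ?_⟩
    intro dx dy Zf Zg Ω _ _ _ B P _ S x₀ y₁₀ y₂₀ α β₁ β₂ x y₁ y₂ R hbdd hS hA' hα hβ₁ hβ₂ hrel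
    have hgrad : ∀ z, gradient B.F z = B.hyperGrad z := fun z =>
      (R.hasGradientAt_F hμg z).gradient
    refine ⟨fun z => (R.hasGradientAt_F hμg z).differentiableAt, fun K k => ⟨?_,
      ((hA' K).integral_sq_sub_yStar_le R hμg hS k).1⟩, ?_⟩
    · simp only [hgrad]
      exact (R.sqM_hyperGrad hμg (hS.past_le k) ((hA' K).sqM R hS k).1).memLp
    obtain ⟨F₀, hF₀⟩ := hbdd
    have hF : ∀ z, F₀ ≤ B.F z := fun z => hF₀ (Set.mem_range_self z)
    have hpos : ∀ᶠ K : ℕ in atTop, 0 < 1 / √(K : ℝ) := by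
      filter_upwards [eventually_gt_atTop 0] with K hK
      have : (0 : ℝ) < K := by exact_mod_cast hK
      positivity
    obtain ⟨c₀, hc₀, C₀, hev⟩ := Bilevel.eventually_stepRange hα hβ₁ hβ₂ hpos
      Bilevel.tendsto_one_div_sqrt_nat hε hrel
    -- With h = C₀/√K the accumulated noise K·A·3h² equals 3AC₀², so `Λ` bounds the whole budget
    -- independently of K. Dividing by the lower step bound c₀/√K and by K gives the rate 1/√K.
    obtain ⟨Λ, hΛ⟩ : ∃ Λ, Λ = |(Bilevel.moments B P x₀ y₁₀ y₂₀ x₀ x₀ y₁₀).lyap a b c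
      + A * (3 * C₀ ^ 2) - F₀| := ⟨_, rfl⟩
    have hΛ0 : 0 ≤ Λ := hΛ ▸ abs_nonneg _
    have hL0 := Bilevel.lipF_nonneg ℓf ℓg hμg
    refine IsBigO.of_bound ((1 + 2 * (1 + ℓg / μg) ^ 2) * (2 / c₀ * Λ
      + (4 * (Bilevel.Problem.lipF ℓf ℓg μg + 1) + 1 / a + 1 / c) * Λ)) ?_
    filter_upwards [hev, eventually_gt_atTop 0] with K hK hK0
    obtain ⟨hr, hr0, hh⟩ := hK
    have hK0' : (1 : ℝ) ≤ K := by exact_mod_cast hK0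
    have hs0 : 0 < √(K : ℝ) := Real.sqrt_pos.2 (by linarith)
    have hs1 : 1 ≤ √(K : ℝ) := Real.one_le_sqrt.2 hK0'
    have hsq : (K : ℝ) = √(K : ℝ) ^ 2 := (Real.sq_sqrt (by linarith)).symm
    have hbound := (hA' K).sum_errors_le R hμg hS hL hA ha hb hc hCε hr (mul_pos hc₀ hr0) hh hF
      (Λ := Λ) (by
        refine le_trans (le_of_eq ?_) (hΛ ▸ le_abs_self _)
        rw [hsq, Real.sqrt_sq hs0.le]
        field_simp)
    rw [Real.norm_of_nonneg (mul_nonneg (by positivity) (Finset.sum_nonneg fun _ _ =>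
      add_nonneg (integral_nonneg fun _ => by positivity)
        (integral_nonneg fun _ => by positivity))), Real.norm_of_nonneg hr0.le]
    refine (mul_le_mul_of_nonneg_left hbound (by positivity)).trans ?_
    have hT : 0 ≤ 4 * (Bilevel.Problem.lipF ℓf ℓg μg + 1) + 1 / a + 1 / c := by positivity
    generalize 4 * (Bilevel.Problem.lipF ℓf ℓg μg + 1) + 1 / a + 1 / c = T at *
    have hW : 0 ≤ 1 + 2 * (1 + (ℓg : ℝ) / μg) ^ 2 := by positivity
    generalize 1 + 2 * (1 + (ℓg : ℝ) / μg) ^ 2 = W at *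
    have h1 : 1 / (K : ℝ) * (2 / (c₀ * (1 / √(K : ℝ))) * Λ)
        = 2 / c₀ * Λ * (1 / √(K : ℝ)) := by
      rw [hsq, Real.sqrt_sq hs0.le]
      field_simp
    have h2 : 1 / (K : ℝ) * (T * Λ) ≤ T * Λ * (1 / √(K : ℝ)) := by
      rw [mul_comm]
      refine mul_le_mul_of_nonneg_left ?_ (mul_nonneg hT hΛ0)
      exact one_div_le_one_div_of_le hs0 (by nlinarith)
    calc _ = W * (1 / (K : ℝ) * (2 / (c₀ * (1 / √(K : ℝ))) * Λ) + 1 / (K : ℝ) * (T * Λ)) := by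
          ring
      _ ≤ W * (2 / c₀ * Λ * (1 / √(K : ℝ)) + T * Λ * (1 / √(K : ℝ))) := by
          rw [h1]; gcongr
      _ = _ := by ring
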